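/- Let $\mathbb K$ be a field of characteristic $0$. **Setting.** For a finite set $I$, let $\overline{\mathbf{GP}}[I]$ be the vector space with basis the generalized permutahedra in $\mathbb R I$ (polytopes whose normal fan coarsens the braid fan) up to normal equivalence, and $\mathbf P[I]$ the vector space with basis the poset structures on $I$. The Brion map $B:\overline{\mathbf{GP}}\to\mathbf P$ is $B(P)=\sum_{v}\mathrm{poset}_v(P)$, over the vertices $v$ of $P$, where $\mathrm{poset}_v(P)$ is the poset $q$ whose cone $\mathrm{cone}(e_i-e_j : i\ge_q j)$ is the tangent cone of $P$ at $v$. Let $\overline{\mathbf\Pi}$, $\overline{\mathbf A}$, $\overline{\mathbf{OP}}\subseteq\overline{\mathbf{GP}}$ be spanned by the products, over decompositions $I=S_1\sqcup\dots\sqcup S_k$, of standard permutahedra $\pi_{S_j}$, of Loday associahedra $a_{\ell_j}$ ($\ell_j$ a linear order on $S_j$), and of orbit polytopes $\mathcal O_{\alpha_j,S_j}$ ($\alpha_j$ a composition of $|S_j|$), respectively. Here, for a composition $\lambda=(\lambda_1,\dots,\lambda_k)$ of $n$, $\mathcal O_\lambda$ is the class of the convex hull of all coordinate permutations of the point with $\lambda_1$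 coordinates $k$, $\lambda_2$ coordinates $k-1$, …, $\lambda_k$ coordinates $1$. Forgetting labels (the Fock functor) turns these species into graded vector spaces (Hopf algebras) $GP, P, \Pi, A, OP$ with bases the isomorphism classes of the basis elements above, and $B$ into a graded map $B:GP\to P$. Let $^*$ denote graded duals and dual basis vectors, and for $H\in\{\Pi,A,OP\}$ let $B_H^*:P^*\to H^*$ be the graded dual of the restriction of $B$ to $H$, so $B_H^*(f)=f\circ B|_H$. The product on $P$ is disjoint union; an element of $P^*$ is primitive if it vanishes in degree $0$ and on all products of elements of positive degree. **Theorem.** For a finite unlabelled poset $p$ with $n$ elements, $p^*\in P^*$ is primitive if and only if $p$ is connected (and nonempty). In this case: 1. $B_\Pi^*(p^*)=n!\,\pi_n^*$ if $p$ is the $n$-element chain, and $B_\Pi^*(p^*)=0$ otherwise. 2. $B_A^*(p^*)=2^{\,n-m(p)-s(p)}\,a_n^*$ if $p$ is an RBT poset, and $B_A^*(p^*)=0$ otherwise. Here an RBT poset is the poset of the (internal) nodes of a rooted binary tree, with the root as minimum and each node below its descendants; $m(p)$ is the number of maximal elements of $p$; and $s(p)$ is the number of symmetric elements, that is, of elements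 $v$ covered by two distinct elements $v_1,v_2$ with $p_{\ge v_1}\cong p_{\ge v_2}$. 3. $B_{OP}^*(p^*)=\dfrac{n!}{\lambda_1!\cdots\lambda_k!}\,\mathcal O_\lambda^*$ if $p=p(\lambda)$ for some composition $\lambda=(\lambda_1,\dots,\lambda_k)$ of $n$, and $B_{OP}^*(p^*)=0$ otherwise. Here $p(\lambda)$ is the layered poset with $\lambda_i$ pairwise incomparable elements on level $i$ (level $1$ at the bottom), every element of a lower level lying below every element of a higher level. -/

import Mathlib

open scoped Pointwise Nat

noncomputable section

namespace BrionMap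

/-! ### Polytopes, faces and normal fans

Points of `ℝI` and linear functionals on it are both functions `I → ℝ`, paired by the
dot product `y ⬝ᵥ x = ∑ i, y i * x i`. -/

/-- The basis vector `e_i` of `ℝI`. -/
def basisVec {I : Type} (i : I) : I → ℝ := Set.indicator {i} 1

/-- The set of points of `P` at which the linear functional `y` is maximal on `P`. -/
def maxFace {I : Type} [Fintype I] (P : Set (I → ℝ)) (y : I → ℝ) : Set (I → ℝ) :=
  {x | x ∈ P ∧ ∀ z ∈ P, y ⬝ᵥ z ≤ y ⬝ᵥ x}

/-- `P` is a (nonempty) polytope: the convex hull of a nonempty finite set. -/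
def IsPolytope {I : Type} (P : Set (I → ℝ)) : Prop :=
  ∃ V : Set (I → ℝ), V.Finite ∧ V.Nonempty ∧ P = convexHull ℝ V

/-- `F` is a (nonempty) face of `P`. -/
def IsFace {I : Type} [Fintype I] (P F : Set (I → ℝ)) : Prop :=
  F.Nonempty ∧ ∃ y : I → ℝ, F = maxFace P y

/-- The normal cone of `F`: the functionals that are maximal on `P` at every point of `F`. -/
def normalCone {I : Type} [Fintype I] (P F : Set (I → ℝ)) : Set (I → ℝ) :=
  {y | ∀ x ∈ F, ∀ z ∈ P, y ⬝ᵥ z ≤ y ⬝ᵥ x}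

/-- The normal fan of `P`, as a collection of cones. -/
def normalFan {I : Type} [Fintype I] (P : Set (I → ℝ)) : Set (Set (I → ℝ)) :=
  {C | ∃ F, IsFace P F ∧ C = normalCone P F}

/-- The fan `G` is a coarsening of the fan `F`. -/
def IsCoarsening {I : Type} (G F : Set (Set (I → ℝ))) : Prop :=
  ∀ C ∈ F, ∃ D ∈ G, C ⊆ D

/-- The standard permutahedron `π_I`: the convex hull of the points `∑ i, f(i) e_i`, over the
bijections `f : I → {1, …, |I|}`. -/
def permutahedron (I : Type) [Fintype I] : Set (I → ℝ) :=
  convexHull ℝ (Set.range fun (f : I ≃ Fin (Fintype.card I)) (i : I) => ((f i : ℕ) : ℝ) + 1)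

/-- A generalized permutahedron in `ℝI`: a polytope whose normal fan coarsens the braid fan. -/
structure GenPerm (I : Type) [Fintype I] where
  carrier : Set (I → ℝ)
  isPolytope : IsPolytope carrier
  isCoarsening : IsCoarsening (normalFan carrier) (normalFan (permutahedron I))

/-- Two polytopes are normally equivalent if they have the same normal fan. -/
instance normalEquiv (I : Type) [Fintype I] : Setoid (GenPerm I) where
  r P Q := normalFan P.carrier = normalFan Q.carrier
  iseqv := ⟨fun _ => rfl, fun h => h.symm, fun h h' => h.trans h'⟩

/-- Generalized permutahedra in `ℝI` up to normal equivalence. -/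
abbrev GPClass (I : Type) [Fintype I] : Type := Quotient (normalEquiv I)

/-! ### Vertices, tangent cones and vertex posets -/

/-- The vertices of `P`: its zero-dimensional faces. -/
def vertices {I : Type} [Fintype I] (P : Set (I → ℝ)) : Set (I → ℝ) :=
  {v | IsFace P {v}}

/-- The tangent cone of `P` at the vertex `v`: it is generated by the directions `w - v` of the
edges `[v, w]` of `P`. -/
def tangentCone {I : Type} [Fintype I] (P : Set (I → ℝ)) (v : I → ℝ) : PointedCone ℝ (I → ℝ) :=
  PointedCone.hull ℝ {d | ∃ w, w ≠ v ∧ IsFace P (segment ℝ v w) ∧ d = w - v}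

/-- The cone of a poset structure `p` on `I`, generated by the `e_i - e_j` with `i ≥ j`. -/
def posetCone {I : Type} (p : PartialOrder I) : PointedCone ℝ (I → ℝ) :=
  PointedCone.hull ℝ {d | ∃ i j, p.le j i ∧ d = basisVec i - basisVec j}

theorem basisVec_self {I : Type} (i : I) : basisVec i i = 1 := by simp [basisVec]

theorem basisVec_ne {I : Type} {i j : I} (h : j ≠ i) : basisVec i j = 0 := by
  simp [basisVec, h]

theorem basisVec_injective {I : Type} : Function.Injective (basisVec (I := I)) := by
  intro i j h
  by_contra hne
  have := congrFun h i
  rw [basisVec_self, basisVec_ne hne] at this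
  exact one_ne_zero this

theorem dot_basisVec {I : Type} [Fintype I] (y : I → ℝ) (i : I) : y ⬝ᵥ basisVec i = y i := by
  rw [dotProduct, Finset.sum_eq_single i]
  · simp [basisVec_self]
  · intro j _ hj; simp [basisVec_ne hj]
  · simp

theorem mem_maxFace_singleton {I : Type} [Fintype I] {P : Set (I → ℝ)} {v y w : I → ℝ}
    (h : {v} = maxFace P y) (hw : w ∈ P) (hne : w ≠ v) : y ⬝ᵥ w < y ⬝ᵥ v := by
  have hv : v ∈ maxFace P y := h ▸ rfl
  refine lt_of_le_of_ne (hv.2 w hw) fun he => hne ?_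
  have : w ∈ maxFace P y := ⟨hw, fun z hz => he ▸ hv.2 z hz⟩
  rw [← h] at this
  exact this

theorem tangentCone_dot {I : Type} [Fintype I] {P : Set (I → ℝ)} {v y : I → ℝ}
    (h : {v} = maxFace P y) {d : I → ℝ} (hd : d ∈ tangentCone P v) : d = 0 ∨ y ⬝ᵥ d < 0 := by
  refine Submodule.span_induction ?_ (Or.inl rfl) ?_ ?_ hd
  · rintro x ⟨w, hne, ⟨_, u, hu⟩, rfl⟩
    right
    have hw : w ∈ P := by
      have : w ∈ maxFace P u := hu ▸ right_mem_segment ℝ v w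
      exact this.1
    have := mem_maxFace_singleton h hw hne
    rw [dotProduct_sub]
    linarith
  · rintro a b _ _ (rfl | ha) (rfl | hb)
    · simp
    · simp [hb]
    · simp [ha]
    · right; rw [dotProduct_add]; linarith
  · rintro ⟨c, hc⟩ x _ (rfl | hx)
    · simp
    · rcases hc.eq_or_lt with rfl | hc
      · left; ext i; simp
      · right
        have : y ⬝ᵥ ((⟨c, hc.le⟩ : {x : ℝ // 0 ≤ x}) • x) = c * (y ⬝ᵥ x) := by
          change y ⬝ᵥ (c • x) = _
          rw [dotProduct_smul, smul_eq_mul]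
        rw [this]
        exact mul_neg_of_pos_of_neg hc hx

/-- The poset `poset_v(P)` at the vertex `v` of `P`: we have `i ≥ j` if and only if `e_i - e_j`
lies in the tangent cone at `v`. -/
@[reducible] def vertexPoset {I : Type} [Fintype I] (P : Set (I → ℝ)) (v : vertices P) : PartialOrder I where
  le j i := basisVec i - basisVec j ∈ tangentCone P v.1
  le_refl i := by rw [sub_self]; exact Submodule.zero_mem _
  le_trans a b c hab hbc := by
    have := Submodule.add_mem _ hbc hab
    rwa [sub_add_sub_cancel] at this
  le_antisymm a b hab hba := by
    obtain ⟨_, y, hy⟩ := v.2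
    rcases tangentCone_dot hy hab with h | h
    · exact (basisVec_injective (sub_eq_zero.1 h)).symm
    · rcases tangentCone_dot hy hba with h' | h'
      · exact basisVec_injective (sub_eq_zero.1 h')
      · rw [dotProduct_sub] at h h'
        linarith

/-- The vertex poset is the poset whose cone is the tangent cone. -/
theorem vertexPoset_eq {I : Type} [Fintype I] (P : Set (I → ℝ)) (v : vertices P)
    (p : PartialOrder I) (h : posetCone p = tangentCone P v.1) : vertexPoset P v = p := by
  classical
  refine PartialOrder.ext fun j i => ?_
  change basisVec i - basisVec j ∈ tangentCone P v.1 ↔ p.le j i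
  rw [← h]
  refine ⟨fun hm => ?_, fun hle => Submodule.subset_span ⟨i, j, hle, rfl⟩⟩
  by_contra hle
  let y : I → ℝ := fun a => if p.le j a then 1 else 0
  have key : ∀ d ∈ posetCone p, 0 ≤ y ⬝ᵥ d := by
    intro d hd
    refine Submodule.span_induction ?_ (by simp) ?_ ?_ hd
    · rintro x ⟨a, b, hab, rfl⟩
      rw [dotProduct_sub, dot_basisVec, dot_basisVec]
      by_cases hb : p.le j b
      · have ha : p.le j a := p.le_trans _ _ _ hb hab
        simp [y, ha, hb]
      · simp only [y, hb, if_false, sub_zero]; split_ifs <;> norm_num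
    · intro a b _ _ ha hb; rw [dotProduct_add]; linarith
    · rintro ⟨c, hc⟩ x _ hx
      change 0 ≤ y ⬝ᵥ (c • x)
      rw [dotProduct_smul, smul_eq_mul]
      exact mul_nonneg hc hx
  have := key _ hm
  rw [dotProduct_sub, dot_basisVec, dot_basisVec] at this
  simp only [y, hle, if_false, p.le_refl j, if_true] at this
  linarith

theorem dot_le_of_convexHull {I : Type} [Fintype I] {V : Set (I → ℝ)} {y : I → ℝ} {M : ℝ}
    (h : ∀ x ∈ V, y ⬝ᵥ x ≤ M) {x : I → ℝ} (hx : x ∈ convexHull ℝ V) : y ⬝ᵥ x ≤ M := by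
  have hc : Convex ℝ {x : I → ℝ | y ⬝ᵥ x ≤ M} :=
    convex_halfSpace_le ⟨fun a b => dotProduct_add y a b, fun c a => dotProduct_smul c y a⟩ M
  exact convexHull_min h hc hx

theorem exists_mem_maxFace {I : Type} [Fintype I] {V : Set (I → ℝ)} (hf : V.Finite)
    (hn : V.Nonempty) (y : I → ℝ) : ∃ x ∈ V, x ∈ maxFace (convexHull ℝ V) y := by
  obtain ⟨x, hx, hmax⟩ := Set.exists_max_image V (fun x => y ⬝ᵥ x) hf hn
  exact ⟨x, hx, subset_convexHull ℝ V hx, fun z hz => dot_le_of_convexHull hmax hz⟩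

theorem vertices_finite {I : Type} [Fintype I] {P : Set (I → ℝ)} (h : IsPolytope P) :
    (vertices P).Finite := by
  obtain ⟨V, hf, hn, rfl⟩ := h
  refine hf.subset ?_
  rintro v ⟨_, y, hy⟩
  obtain ⟨x, hx, hxm⟩ := exists_mem_maxFace hf hn y
  rw [← hy] at hxm
  obtain rfl : x = v := hxm
  exact hx

/-! ### Normally equivalent polytopes have the same vertex posets -/

theorem exists_perturb {I : Type} [Fintype I] {P : Set (I → ℝ)} (h : IsPolytope P)
    (w u : I → ℝ) : ∃ ε : ℝ, maxFace P (w + ε • u) = maxFace (maxFace P w) u ∧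
      (maxFace P (w + ε • u)).Nonempty ∧ 0 < ε := by
  obtain ⟨V, hf, hn, rfl⟩ := h
  obtain ⟨x₀, hx₀, hm₀⟩ := exists_mem_maxFace hf hn w
  obtain ⟨x₁, ⟨hx₁, hm₁⟩, hmax⟩ := Set.exists_max_image (V ∩ {x | x ∈ maxFace (convexHull ℝ V) w})
    (fun x => u ⬝ᵥ x) (hf.inter_of_left _) ⟨x₀, hx₀, hm₀⟩
  have hev : ∀ᶠ δ : ℝ in nhdsWithin 0 (Set.Ioi 0), ∀ v ∈ V,
      (w + δ • u) ⬝ᵥ v ≤ (w + δ • u) ⬝ᵥ x₁ := by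
    rw [Filter.eventually_all_finite hf]
    intro v hv
    rcases (hm₁.2 v (subset_convexHull ℝ V hv)).lt_or_eq with hlt | heq
    · have hc : Filter.Tendsto (fun δ : ℝ => (w ⬝ᵥ x₁ - w ⬝ᵥ v) + δ * (u ⬝ᵥ x₁ - u ⬝ᵥ v))
          (nhdsWithin 0 (Set.Ioi 0)) (nhds ((w ⬝ᵥ x₁ - w ⬝ᵥ v) + 0 * (u ⬝ᵥ x₁ - u ⬝ᵥ v))) := by
        apply Filter.Tendsto.mono_left _ nhdsWithin_le_nhds
        apply Continuous.tendsto
        fun_prop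
      have := hc.eventually (lt_mem_nhds (show 0 < _ by linarith))
      filter_upwards [this] with δ hδ
      simp only [add_dotProduct, smul_dotProduct, smul_eq_mul]
      linarith
    · filter_upwards [self_mem_nhdsWithin] with δ hδ
      have hvm : v ∈ maxFace (convexHull ℝ V) w :=
        ⟨subset_convexHull ℝ V hv, fun z hz => heq ▸ hm₁.2 z hz⟩
      have := mul_le_mul_of_nonneg_left (hmax v ⟨hv, hvm⟩) (le_of_lt (Set.mem_Ioi.1 hδ))
      simp only [add_dotProduct, smul_dotProduct, smul_eq_mul]
      linarith
  obtain ⟨δ, hδ, hδ0⟩ := (hev.and self_mem_nhdsWithin).exists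
  have hδ0 : 0 < δ := hδ0
  have hall : ∀ z ∈ convexHull ℝ V, w ⬝ᵥ z + δ * (u ⬝ᵥ z) ≤ w ⬝ᵥ x₁ + δ * (u ⬝ᵥ x₁) := by
    intro z hz
    have := dot_le_of_convexHull hδ hz
    simpa only [add_dotProduct, smul_dotProduct, smul_eq_mul] using this
  have hmem : x₁ ∈ maxFace (convexHull ℝ V) (w + (δ / 2) • u) := by
    refine ⟨hm₁.1, fun z hz => ?_⟩
    simp only [add_dotProduct, smul_dotProduct, smul_eq_mul]
    have h1 := hall z hz
    have h2 := hm₁.2 z hz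
    linarith
  refine ⟨δ / 2, ?_, ⟨x₁, hmem⟩, half_pos hδ0⟩
  ext x
  constructor
  · rintro ⟨hx, hxm⟩
    have h0 := hxm x₁ hm₁.1
    simp only [add_dotProduct, smul_dotProduct, smul_eq_mul] at h0
    have h1 := hall x hx
    have h2 := hm₁.2 x hx
    have e1 : w ⬝ᵥ x = w ⬝ᵥ x₁ := by linarith
    have e2 : u ⬝ᵥ x = u ⬝ᵥ x₁ := by
      have : δ * (u ⬝ᵥ x) = δ * (u ⬝ᵥ x₁) := by linarith
      exact mul_left_cancel₀ hδ0.ne' this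
    refine ⟨⟨hx, fun z hz => e1 ▸ hm₁.2 z hz⟩, fun z hz => ?_⟩
    have h3 := hall z hz.1
    have h4 := hz.2 x₁ hm₁.1
    rw [e2]
    exact le_of_mul_le_mul_left (by linarith) hδ0
  · rintro ⟨hx, hxm⟩
    refine ⟨hx.1, fun z hz => (hmem.2 z hz).trans ?_⟩
    have h1 := hxm x₁ hm₁
    have h2 := hx.2 x₁ hm₁.1
    have := mul_le_mul_of_nonneg_left h1 (half_pos hδ0).le
    simp only [add_dotProduct, smul_dotProduct, smul_eq_mul]
    linarith

theorem IsFace.mem_normalCone {I : Type} [Fintype I] {P F : Set (I → ℝ)} {w : I → ℝ}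
    (h : F = maxFace P w) : w ∈ normalCone P F := by
  subst h; exact fun x hx => hx.2

theorem IsFace.subset {I : Type} [Fintype I] {P F : Set (I → ℝ)} (h : IsFace P F) : F ⊆ P := by
  obtain ⟨_, w, rfl⟩ := h; exact fun x hx => hx.1

theorem IsFace.face {I : Type} [Fintype I] {P F : Set (I → ℝ)} (hP : IsPolytope P)
    (h : IsFace P F) (u : I → ℝ) : IsFace P (maxFace F u) := by
  obtain ⟨_, w, rfl⟩ := h
  obtain ⟨ε, he, hne, _⟩ := exists_perturb hP w u
  exact ⟨he ▸ hne, _, he.symm⟩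

/-- Faces with the larger normal cone are smaller. -/
theorem IsFace.le_of_normalCone {I : Type} [Fintype I] {P F G : Set (I → ℝ)} (hF : IsFace P F)
    (hG : IsFace P G) (h : normalCone P G ⊆ normalCone P F) : F ⊆ G := by
  obtain ⟨_, w, rfl⟩ := hG
  intro x hx
  exact ⟨hF.subset hx, h (IsFace.mem_normalCone rfl) x hx⟩

theorem const_transfer {I : Type} [Fintype I] {P Q F G : Set (I → ℝ)} (hP : IsPolytope P)
    (hF : IsFace P F) (hG : IsFace Q G) (h : normalCone P F = normalCone Q G) {u : I → ℝ}
    (hu : ∀ x ∈ F, ∀ z ∈ F, u ⬝ᵥ x = u ⬝ᵥ z) : ∀ x ∈ G, ∀ z ∈ G, u ⬝ᵥ x = u ⬝ᵥ z := by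
  obtain ⟨hne, w, hw⟩ := hF
  obtain ⟨ε, he, -, hε⟩ := exists_perturb hP w u
  rw [← hw] at he
  have hFF : maxFace F u = F := by
    ext x; exact ⟨fun hx => hx.1, fun hx => ⟨hx, fun z hz => (hu z hz x hx).le⟩⟩
  rw [hFF] at he
  have h1 : w ∈ normalCone Q G := h ▸ IsFace.mem_normalCone hw
  have h2 : w + ε • u ∈ normalCone Q G := h ▸ IsFace.mem_normalCone he.symm
  intro x hx z hz
  have e1 : w ⬝ᵥ x = w ⬝ᵥ z :=
    le_antisymm (h1 z hz x (hG.subset hx)) (h1 x hx z (hG.subset hz))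
  have e2 : (w + ε • u) ⬝ᵥ x = (w + ε • u) ⬝ᵥ z :=
    le_antisymm (h2 z hz x (hG.subset hx)) (h2 x hx z (hG.subset hz))
  simp only [add_dotProduct, smul_dotProduct, smul_eq_mul] at e2
  exact mul_left_cancel₀ hε.ne' (by linarith)

theorem exists_vertex_of_fan {I : Type} [Fintype I] {P Q : Set (I → ℝ)} (hP : IsPolytope P)
    (h : normalFan P = normalFan Q) (v : vertices P) :
    ∃ v' : vertices Q, normalCone P {v.1} = normalCone Q {v'.1} := by
  have : normalCone P {v.1} ∈ normalFan Q := h ▸ ⟨_, v.2, rfl⟩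
  obtain ⟨G, hG, hc⟩ := this
  have hconst : ∀ u : I → ℝ, ∀ x ∈ G, ∀ z ∈ G, u ⬝ᵥ x = u ⬝ᵥ z := fun u =>
    const_transfer hP v.2 hG hc (by rintro x rfl z rfl; rfl)
  obtain ⟨g, hg⟩ := hG.1
  have hGs : G = {g} := by
    refine Set.eq_singleton_iff_unique_mem.2 ⟨hg, fun x hx => ?_⟩
    ext i
    have := hconst (basisVec i) x hx g hg
    rwa [dotProduct_comm, dot_basisVec, dotProduct_comm, dot_basisVec] at this
  subst hGs
  exact ⟨⟨g, hG⟩, hc⟩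

theorem vertex_eq_of_normalCone {I : Type} [Fintype I] {P : Set (I → ℝ)} {v w : vertices P}
    (h : normalCone P {v.1} = normalCone P {w.1}) : v = w := by
  have := IsFace.le_of_normalCone v.2 w.2 h.symm.subset
  exact Subtype.ext (by simpa using this)

theorem tangentCone_le {I : Type} [Fintype I] {P Q : Set (I → ℝ)} (hP : IsPolytope P)
    (hQ : IsPolytope Q) (h : normalFan P = normalFan Q) (v : vertices P) (v' : vertices Q)
    (hv : normalCone P {v.1} = normalCone Q {v'.1}) : tangentCone P v.1 ≤ tangentCone Q v'.1 := by
  obtain ⟨v, hvP⟩ := v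
  obtain ⟨v', hvQ⟩ := v'
  simp only at hv ⊢
  refine Submodule.span_le.2 ?_
  rintro _ ⟨w, hne, hF, rfl⟩
  have hd : 0 < (w - v) ⬝ᵥ (w - v) := by
    have : w - v ≠ 0 := sub_ne_zero.2 hne
    exact lt_of_le_of_ne (Finset.sum_nonneg fun i _ => mul_self_nonneg _)
      (fun h0 => this (dotProduct_self_eq_zero.1 h0.symm))
  have hsegdot : ∀ x ∈ segment ℝ v w, ∃ t : ℝ, t ≤ 1 ∧ x = v + t • (w - v) := by
    rintro x hx
    rw [segment_eq_image'] at hx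
    obtain ⟨t, ht, rfl⟩ := hx
    exact ⟨t, ht.2, rfl⟩
  -- the other endpoint of the edge is a vertex too
  have hwP : w ∈ vertices P := by
    have hface := IsFace.face hP hF (w - v)
    have : maxFace (segment ℝ v w) (w - v) = {w} := by
      refine Set.eq_singleton_iff_unique_mem.2 ⟨⟨right_mem_segment ℝ v w, ?_⟩, ?_⟩
      · intro z hz
        obtain ⟨t, ht, rfl⟩ := hsegdot z hz
        rw [show w = v + (1 : ℝ) • (w - v) by simp]
        simp only [add_sub_cancel_left, dotProduct_add, dotProduct_smul, smul_eq_mul, one_smul]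
        nlinarith
      · rintro z ⟨hz, hzm⟩
        obtain ⟨t, ht, rfl⟩ := hsegdot z hz
        have h1 := hzm w (right_mem_segment ℝ v w)
        have h2 : (w - v) ⬝ᵥ w = (w - v) ⬝ᵥ v + (w - v) ⬝ᵥ (w - v) := by
          rw [← dotProduct_add]; simp
        rw [dotProduct_add, dotProduct_smul, smul_eq_mul, h2] at h1
        have : t = 1 := le_antisymm ht (by
          by_contra hlt
          nlinarith)
        subst this; simp
    rwa [this] at hface
  obtain ⟨⟨w', hwQ⟩, hw'⟩ := exists_vertex_of_fan hP h ⟨w, hwP⟩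
  simp only at hw'
  have hGm : normalCone P (segment ℝ v w) ∈ normalFan Q := h ▸ ⟨_, hF, rfl⟩
  obtain ⟨G, hG, hc⟩ := hGm
  have hv'G : v' ∈ G := by
    have := IsFace.le_of_normalCone hvQ hG (by
      rw [← hc, ← hv]
      exact fun y hy x hx => hy x (by rw [Set.mem_singleton_iff.1 hx]; exact left_mem_segment ℝ v w))
    exact this rfl
  have hw'G : w' ∈ G := by
    have := IsFace.le_of_normalCone hwQ hG (by
      rw [← hc, ← hw']
      exact fun y hy x hx => hy x (by rw [Set.mem_singleton_iff.1 hx]; exact right_mem_segment ℝ v w))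
    exact this rfl
  have hline : ∀ g ∈ G, ∃ c : ℝ, g = v' + c • (w - v) := by
    intro g hg
    refine ⟨((w - v) ⬝ᵥ (g - v')) / ((w - v) ⬝ᵥ (w - v)), ?_⟩
    set c := ((w - v) ⬝ᵥ (g - v')) / ((w - v) ⬝ᵥ (w - v)) with hcdef
    set r := (g - v') - c • (w - v) with hr
    have hr0 : (w - v) ⬝ᵥ r = 0 := by
      rw [hr, dotProduct_sub, dotProduct_smul, smul_eq_mul, hcdef]
      field_simp
      ring
    have hrc : ∀ x ∈ segment ℝ v w, ∀ z ∈ segment ℝ v w, r ⬝ᵥ x = r ⬝ᵥ z := by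
      intro x hx z hz
      obtain ⟨t, _, rfl⟩ := hsegdot x hx
      obtain ⟨s, _, rfl⟩ := hsegdot z hz
      rw [dotProduct_comm] at hr0
      simp [dotProduct_add, dotProduct_smul, hr0]
    have := const_transfer hP hF hG hc hrc g hg v' hv'G
    have hrr : r ⬝ᵥ r = 0 := by
      conv_lhs => rhs; rw [hr]
      rw [dotProduct_sub, dotProduct_sub, dotProduct_smul, dotProduct_comm r (w - v), hr0, this]
      simp
    have : r = 0 := dotProduct_self_eq_zero.1 hrr
    rw [hr, sub_eq_zero] at this
    rw [← this]; simp
  have hvw' : v' ≠ w' := by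
    rintro rfl
    have := vertex_eq_of_normalCone (v := ⟨v, hvP⟩) (w := ⟨w, hwP⟩) (hv.trans hw'.symm)
    exact hne (congrArg Subtype.val this).symm
  obtain ⟨c', hc'⟩ := hline w' hw'G
  obtain ⟨yv, hyv⟩ := hvP.2
  obtain ⟨yw, hyw⟩ := hwP.2
  have n1 : yv ⬝ᵥ (w - v) < 0 := by
    rw [dotProduct_sub]
    linarith [mem_maxFace_singleton hyv (IsFace.subset hwP rfl) hne]
  have n2 : 0 < yw ⬝ᵥ (w - v) := by
    rw [dotProduct_sub]
    linarith [mem_maxFace_singleton hyw (IsFace.subset hvP rfl) hne.symm]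
  have m1 : yv ∈ normalCone Q {v'} := hv ▸ IsFace.mem_normalCone hyv
  have m2 : yw ∈ normalCone Q {w'} := hw' ▸ IsFace.mem_normalCone hyw
  have hnn : ∀ c : ℝ, v' + c • (w - v) ∈ G → 0 ≤ c ∧ c ≤ c' := by
    intro c hcG
    have k1 := m1 v' rfl _ (hG.subset hcG)
    have k2 := m2 w' rfl _ (hG.subset hcG)
    rw [hc'] at k2
    simp only [dotProduct_add, dotProduct_smul, smul_eq_mul] at k1 k2
    constructor
    · by_contra hlt; nlinarith
    · by_contra hlt; nlinarith
  have hc'0 : 0 < c' := by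
    refine lt_of_le_of_ne (hnn c' (hc' ▸ hw'G)).1 ?_
    rintro rfl
    exact hvw' (by simp [hc'])
  have hconvQ : Convex ℝ G := by
    obtain ⟨V, _, _, rfl⟩ := hQ
    obtain ⟨_, u, rfl⟩ := hG
    intro a ha b hb s t hs ht hst
    refine ⟨convex_convexHull ℝ V ha.1 hb.1 hs ht hst, fun z hz => ?_⟩
    have e : u ⬝ᵥ a = u ⬝ᵥ b := le_antisymm (hb.2 a ha.1) (ha.2 b hb.1)
    rw [dotProduct_add, dotProduct_smul, dotProduct_smul, e, ← add_smul, hst, one_smul]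
    exact hb.2 z hz
  have hGseg : G = segment ℝ v' w' := by
    apply Set.Subset.antisymm
    · intro g hg
      obtain ⟨c, rfl⟩ := hline g hg
      obtain ⟨h0, h1⟩ := hnn c hg
      rw [segment_eq_image']
      refine ⟨c / c', ⟨by positivity, (div_le_one hc'0).2 h1⟩, ?_⟩
      simp only [hc', add_sub_cancel_left, smul_smul]
      rw [div_mul_cancel₀ _ hc'0.ne']
    · exact hconvQ.segment_subset hv'G hw'G
  have hmem : w' - v' ∈ tangentCone Q v' :=
    Submodule.subset_span ⟨w', hvw'.symm, hGseg ▸ hG, rfl⟩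
  have : w - v = (⟨c'⁻¹, by positivity⟩ : {x : ℝ // 0 ≤ x}) • (w' - v') := by
    change _ = c'⁻¹ • (w' - v')
    rw [hc', add_sub_cancel_left, smul_smul, inv_mul_cancel₀ hc'0.ne', one_smul]
  rw [this]
  exact Submodule.smul_mem _ _ hmem

theorem vertexPoset_congr {I : Type} [Fintype I] {P Q : Set (I → ℝ)} {v : vertices P}
    {v' : vertices Q} (h : tangentCone P v.1 = tangentCone Q v'.1) :
    vertexPoset P v = vertexPoset Q v' := by
  refine PartialOrder.ext fun j i => ?_
  change _ ∈ tangentCone P v.1 ↔ _ ∈ tangentCone Q v'.1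
  rw [h]

/-- The vertices of normally equivalent polytopes correspond, with the same vertex posets. -/
theorem exists_vertices_equiv {I : Type} [Fintype I] {P Q : Set (I → ℝ)} (hP : IsPolytope P)
    (hQ : IsPolytope Q) (h : normalFan P = normalFan Q) :
    ∃ f : vertices P → vertices Q, Function.Bijective f ∧
      ∀ v, vertexPoset P v = vertexPoset Q (f v) := by
  choose f hf using exists_vertex_of_fan hP h
  refine ⟨f, ⟨fun v w hvw => ?_, fun v' => ?_⟩, fun v => vertexPoset_congr ?_⟩
  · exact vertex_eq_of_normalCone ((hf v).trans (hvw ▸ (hf w).symm))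
  · obtain ⟨v, hv⟩ := exists_vertex_of_fan hQ h.symm v'
    exact ⟨v, vertex_eq_of_normalCone ((hf v).symm.trans hv.symm)⟩
  · exact le_antisymm (tangentCone_le hP hQ h v _ (hf v))
      (tangentCone_le hQ hP h.symm _ v (hf v).symm)

/-! ### Relabelling -/

/-- The image of `P ⊆ ℝI` in `ℝJ` under the relabelling `e_i ↦ e_{σ(i)}`. -/
def relabelSet {I J : Type} (σ : I ≃ J) (P : Set (I → ℝ)) : Set (J → ℝ) :=
  {x | x ∘ σ ∈ P}

theorem relabelSet_eq_image {I J : Type} (σ : I ≃ J) (P : Set (I → ℝ)) :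
    relabelSet σ P = LinearMap.funLeft ℝ ℝ σ.symm '' P := by
  ext x
  constructor
  · intro hx
    exact ⟨x ∘ σ, hx, by ext j; simp [LinearMap.funLeft]⟩
  · rintro ⟨y, hy, rfl⟩
    have : (LinearMap.funLeft ℝ ℝ σ.symm y) ∘ σ = y := by ext j; simp [LinearMap.funLeft]
    change _ ∈ P
    rwa [this]

theorem relabelSet_symm {I J : Type} (σ : I ≃ J) (P : Set (I → ℝ)) :
    relabelSet σ.symm (relabelSet σ P) = P := by
  ext x
  simp [relabelSet, Function.comp_assoc]

theorem relabelSet_symm' {I J : Type} (σ : I ≃ J) (P : Set (J → ℝ)) :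
    relabelSet σ (relabelSet σ.symm P) = P := by
  ext x
  simp [relabelSet, Function.comp_assoc]

theorem relabelSet_convexHull {I J : Type} (σ : I ≃ J) (V : Set (I → ℝ)) :
    relabelSet σ (convexHull ℝ V) = convexHull ℝ (relabelSet σ V) := by
  rw [relabelSet_eq_image, relabelSet_eq_image, LinearMap.image_convexHull]

theorem relabelSet_segment {I J : Type} (σ : I ≃ J) (v w : I → ℝ) :
    relabelSet σ (segment ℝ v w) = segment ℝ (v ∘ σ.symm) (w ∘ σ.symm) := by
  rw [relabelSet_eq_image]
  exact image_segment ℝ (LinearMap.funLeft ℝ ℝ σ.symm).toAffineMap v w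

theorem relabelSet_singleton {I J : Type} (σ : I ≃ J) (v : I → ℝ) :
    relabelSet σ {v} = {v ∘ σ.symm} := by
  rw [relabelSet_eq_image, Set.image_singleton]; rfl

theorem dot_comp {I J : Type} [Fintype I] [Fintype J] (σ : I ≃ J) (y x : J → ℝ) :
    (y ∘ σ) ⬝ᵥ (x ∘ σ) = y ⬝ᵥ x := by
  simp only [dotProduct, Function.comp]
  exact Equiv.sum_comp σ fun j => y j * x j

theorem forall_relabelSet {I J : Type} (σ : I ≃ J) (P : Set (I → ℝ)) (p : (J → ℝ) → Prop) :
    (∀ z ∈ relabelSet σ P, p z) ↔ ∀ z ∈ P, p (z ∘ σ.symm) := by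
  rw [relabelSet_eq_image, Set.forall_mem_image]; rfl

theorem maxFace_relabelSet {I J : Type} [Fintype I] [Fintype J] (σ : I ≃ J) (P : Set (I → ℝ))
    (y : J → ℝ) : maxFace (relabelSet σ P) y = relabelSet σ (maxFace P (y ∘ σ)) := by
  ext x
  simp only [maxFace, Set.mem_ofPred_eq, forall_relabelSet]
  refine and_congr Iff.rfl (forall₂_congr fun z _ => ?_)
  rw [dot_comp, ← dot_comp σ y (z ∘ σ.symm)]
  simp [Function.comp_assoc]

theorem normalCone_relabelSet {I J : Type} [Fintype I] [Fintype J] (σ : I ≃ J)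
    (P F : Set (I → ℝ)) :
    normalCone (relabelSet σ P) (relabelSet σ F) = relabelSet σ (normalCone P F) := by
  ext y
  simp only [normalCone, Set.mem_ofPred_eq, forall_relabelSet]
  change _ ↔ ∀ x ∈ F, ∀ z ∈ P, (y ∘ σ) ⬝ᵥ z ≤ (y ∘ σ) ⬝ᵥ x
  refine forall₂_congr fun x _ => forall₂_congr fun z _ => ?_
  rw [← dot_comp σ y (z ∘ σ.symm), ← dot_comp σ y (x ∘ σ.symm)]
  simp [Function.comp_assoc]

theorem IsFace.relabel {I J : Type} [Fintype I] [Fintype J] (σ : I ≃ J) {P F : Set (I → ℝ)}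
    (h : IsFace P F) : IsFace (relabelSet σ P) (relabelSet σ F) := by
  obtain ⟨⟨x, hx⟩, y, rfl⟩ := h
  refine ⟨⟨x ∘ σ.symm, ?_⟩, y ∘ σ.symm, ?_⟩
  · change (x ∘ σ.symm) ∘ σ ∈ maxFace P y
    simpa [Function.comp_assoc] using hx
  · rw [maxFace_relabelSet]
    simp [Function.comp_assoc]

theorem normalFan_relabelSet {I J : Type} [Fintype I] [Fintype J] (σ : I ≃ J)
    (P : Set (I → ℝ)) : normalFan (relabelSet σ P) = relabelSet σ '' normalFan P := by
  apply Set.Subset.antisymm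
  · rintro _ ⟨F, hF, rfl⟩
    have hF' := hF.relabel σ.symm
    rw [relabelSet_symm] at hF'
    refine ⟨_, ⟨_, hF', rfl⟩, ?_⟩
    rw [← normalCone_relabelSet, relabelSet_symm']
  · rintro _ ⟨_, ⟨F, hF, rfl⟩, rfl⟩
    exact ⟨_, hF.relabel σ, (normalCone_relabelSet σ P F).symm⟩

theorem relabelSet_permutahedron {I J : Type} [Fintype I] [Fintype J] (σ : I ≃ J) :
    relabelSet σ (permutahedron I) = permutahedron J := by
  rw [permutahedron, relabelSet_convexHull, permutahedron]
  congr 1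
  ext x
  constructor
  · rintro ⟨f, hf⟩
    refine ⟨(σ.symm.trans f).trans (finCongr (Fintype.card_congr σ)), ?_⟩
    ext j
    have := congrFun hf (σ.symm j)
    simpa using this
  · rintro ⟨f, rfl⟩
    refine ⟨(σ.trans f).trans (finCongr (Fintype.card_congr σ).symm), ?_⟩
    ext i
    simp

theorem IsPolytope.relabel {I J : Type} (σ : I ≃ J) {P : Set (I → ℝ)} (h : IsPolytope P) :
    IsPolytope (relabelSet σ P) := by
  obtain ⟨V, hf, hn, rfl⟩ := h
  refine ⟨relabelSet σ V, ?_, ?_, relabelSet_convexHull σ V⟩ <;> rw [relabelSet_eq_image]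
  · exact hf.image _
  · exact hn.image _

/-- The relabelling of a generalized permutahedron. -/
def GenPerm.relabel {I J : Type} [Fintype I] [Fintype J] (σ : I ≃ J) (P : GenPerm I) :
    GenPerm J where
  carrier := relabelSet σ P.carrier
  isPolytope := P.isPolytope.relabel σ
  isCoarsening := by
    rw [← relabelSet_permutahedron σ, normalFan_relabelSet, normalFan_relabelSet]
    rintro _ ⟨C, hC, rfl⟩
    obtain ⟨D, hD, hCD⟩ := P.isCoarsening C hC
    exact ⟨_, ⟨D, hD, rfl⟩, fun x hx => hCD hx⟩

/-- The relabelling of a poset structure. -/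
@[reducible] def relabelOrder {I J : Type} (σ : I ≃ J) (p : PartialOrder I) : PartialOrder J where
  le a b := p.le (σ.symm a) (σ.symm b)
  le_refl a := p.le_refl _
  le_trans a b c := p.le_trans _ _ _
  le_antisymm a b h h' := σ.symm.injective (p.le_antisymm _ _ h h')

theorem vertices_relabel {I J : Type} [Fintype I] [Fintype J] (σ : I ≃ J) {P : Set (I → ℝ)}
    {v : I → ℝ} (h : v ∈ vertices P) : v ∘ σ.symm ∈ vertices (relabelSet σ P) := by
  have := IsFace.relabel σ h
  rwa [relabelSet_singleton] at this

theorem tangentCone_relabel {I J : Type} [Fintype I] [Fintype J] (σ : I ≃ J) {P : Set (I → ℝ)}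
    {v d : I → ℝ} (h : d ∈ tangentCone P v) :
    d ∘ σ.symm ∈ tangentCone (relabelSet σ P) (v ∘ σ.symm) := by
  refine Submodule.span_induction ?_ (Submodule.zero_mem _) ?_ ?_ h
  · rintro _ ⟨w, hne, hF, rfl⟩
    refine Submodule.subset_span ⟨w ∘ σ.symm, fun he => hne ?_, ?_, rfl⟩
    · ext i; simpa using congrFun he (σ i)
    · rw [← relabelSet_segment]; exact hF.relabel σ
  · intro a b _ _ ha hb; exact Submodule.add_mem _ ha hb
  · intro c a _ ha; exact Submodule.smul_mem _ c ha

theorem basisVec_comp {I J : Type} (σ : I ≃ J) (i : I) :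
    basisVec i ∘ σ.symm = basisVec (σ i) := by
  ext j
  by_cases h : j = σ i
  · subst h; simp [basisVec_self]
  · rw [basisVec_ne h, Function.comp_apply, basisVec_ne]
    rintro rfl; simp at h

theorem vertexPoset_relabel {I J : Type} [Fintype I] [Fintype J] (σ : I ≃ J) (P : Set (I → ℝ))
    (v : vertices P) : vertexPoset (relabelSet σ P) ⟨_, vertices_relabel σ v.2⟩ =
      relabelOrder σ (vertexPoset P v) := by
  refine PartialOrder.ext fun j i => ?_
  change basisVec i - basisVec j ∈ tangentCone (relabelSet σ P) (v.1 ∘ σ.symm) ↔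
    basisVec (σ.symm i) - basisVec (σ.symm j) ∈ tangentCone P v.1
  constructor
  · intro h
    have := tangentCone_relabel σ.symm h
    rw [relabelSet_symm] at this
    have e : (basisVec i - basisVec j) ∘ σ.symm.symm
        = basisVec (σ.symm i) - basisVec (σ.symm j) := by
      rw [← basisVec_comp, ← basisVec_comp]; rfl
    rw [e] at this
    simpa [Function.comp_assoc] using this
  · intro h
    have := tangentCone_relabel σ h
    have e : (basisVec (σ.symm i) - basisVec (σ.symm j)) ∘ σ.symm = basisVec i - basisVec j := by
      have hi := basisVec_comp σ (σ.symm i)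
      have hj := basisVec_comp σ (σ.symm j)
      rw [σ.apply_symm_apply] at hi hj
      rw [← hi, ← hj]; rfl
    rwa [e] at this

/-! ### Species -/

/-- A set species. It spans a vector species `I ↦ X[I] →₀ K`. -/
structure SetSpecies where
  obj : (I : Type) → [Fintype I] → Type
  map : {I J : Type} → [Fintype I] → [Fintype J] → (I ≃ J) → obj I → obj J
  map_refl : ∀ (I : Type) [Fintype I] (x : obj I), map (Equiv.refl I) x = x
  map_trans : ∀ {I J L : Type} [Fintype I] [Fintype J] [Fintype L] (σ : I ≃ J) (τ : J ≃ L)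
    (x : obj I), map (σ.trans τ) x = map τ (map σ x)

/-- Generalized permutahedra up to normal equivalence. -/
@[reducible] def gpSpecies : SetSpecies where
  obj I := GPClass I
  map σ := Quotient.map (GenPerm.relabel σ) fun P Q (h : normalFan _ = normalFan _) => by
    change normalFan (relabelSet σ P.carrier) = normalFan (relabelSet σ Q.carrier)
    rw [normalFan_relabelSet, normalFan_relabelSet, h]
  map_refl _ _ x := by induction x using Quotient.ind; rfl
  map_trans _ _ x := by induction x using Quotient.ind; rfl

/-- Poset structures on finite sets. -/
@[reducible] def posetSpecies : SetSpecies where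
  obj I := PartialOrder I
  map σ := relabelOrder σ
  map_refl _ _ _ := PartialOrder.ext fun _ _ => Iff.rfl
  map_trans _ _ _ := PartialOrder.ext fun _ _ => Iff.rfl

/-- A morphism between the vector species spanned by two set species. -/
structure SpeciesHom (K : Type*) [Field K] (X Y : SetSpecies) where
  app : (I : Type) → [Fintype I] → (X.obj I →₀ K) →ₗ[K] (Y.obj I →₀ K)
  naturality : ∀ {I J : Type} [Fintype I] [Fintype J] (σ : I ≃ J) (x : X.obj I →₀ K),
    app J (Finsupp.mapDomain (X.map σ) x) = Finsupp.mapDomain (Y.map σ) (app I x)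

/-- `∑ poset_v(P)` over the vertices `v` of `P`. -/
def brionSum (K : Type*) [Field K] {I : Type} [Fintype I] (P : GenPerm I) : PartialOrder I →₀ K :=
  haveI : Fintype (vertices P.carrier) := (vertices_finite P.isPolytope).fintype
  ∑ v : vertices P.carrier, Finsupp.single (vertexPoset P.carrier v) 1

theorem brionSum_congr (K : Type*) [Field K] {I : Type} [Fintype I] (P Q : GenPerm I)
    (h : normalFan P.carrier = normalFan Q.carrier) : brionSum K P = brionSum K Q := by
  obtain ⟨f, hf, hp⟩ := exists_vertices_equiv P.isPolytope Q.isPolytope h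
  unfold brionSum
  exact @Fintype.sum_bijective _ _ _ (_) (_) _ f hf _ _ fun v => by rw [hp v]

theorem brionSum_relabel (K : Type*) [Field K] {I J : Type} [Fintype I] [Fintype J] (σ : I ≃ J)
    (P : GenPerm I) :
    brionSum K (P.relabel σ) = Finsupp.mapDomain (relabelOrder σ) (brionSum K P) := by
  unfold brionSum
  rw [Finsupp.mapDomain_finsetSum]
  symm
  refine @Fintype.sum_bijective _ _ _ (_) (_) _
    (fun v : vertices P.carrier =>
      (⟨v.1 ∘ σ.symm, vertices_relabel σ v.2⟩ : vertices (relabelSet σ P.carrier)))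
    ⟨fun v w h => ?_, fun w => ?_⟩ _ _ fun v => ?_
  · ext i
    simpa using congrFun (congrArg Subtype.val h) (σ i)
  · have := vertices_relabel σ.symm w.2
    rw [relabelSet_symm] at this
    refine ⟨⟨_, this⟩, Subtype.ext ?_⟩
    ext j; simp
  · rw [Finsupp.mapDomain_single]
    exact congrArg (fun p => Finsupp.single p (1 : K)) (vertexPoset_relabel σ P.carrier v).symm

/-- The Brion map `B(P) = ∑ poset_v(P)`, as a morphism of vector species. -/
def brion (K : Type*) [Field K] : SpeciesHom K gpSpecies posetSpecies where
  app I _ := Finsupp.linearCombination K (Quotient.lift (brionSum K (I := I)) (brionSum_congr K))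
  naturality {I J} _ _ σ x := by
    induction x using Finsupp.induction_linear with
    | zero => simp
    | add a b ha hb => simp only [Finsupp.mapDomain_add, map_add, ha, hb]
    | single a c =>
      induction a using Quotient.ind with
      | _ P =>
      simp only [Finsupp.mapDomain_single, Finsupp.linearCombination_single,
        Finsupp.mapDomain_smul]
      exact congrArg (c • ·) (brionSum_relabel K σ P)

/-! ### The Fock functor

The degree `n` part of the graded space associated to the vector species spanned by `X` is the
space of coinvariants of `X[n] →₀ K` under the symmetric group; as this is a permutation
module, it has the isomorphism classes of `X`-structures on `n` points as a basis. -/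

/-- Isomorphism classes of (unlabelled) `X`-structures on `n` points. -/
abbrev IsoClass (X : SetSpecies) (n : ℕ) : Type :=
  Quot fun a b : X.obj (Fin n) => ∃ σ : Fin n ≃ Fin n, X.map σ a = b

/-- The unlabelled structure underlying a structure labelled by `Fin n`. -/
abbrev IsoClass.mk (X : SetSpecies) {n : ℕ} (x : X.obj (Fin n)) : IsoClass X n :=
  Quot.mk _ x

theorem IsoClass.mk_map (X : SetSpecies) {n : ℕ} (σ : Fin n ≃ Fin n) (x : X.obj (Fin n)) :
    IsoClass.mk X (X.map σ x) = IsoClass.mk X x :=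
  (Quot.sound ⟨σ, rfl⟩).symm

/-- The unlabelled structure underlying a structure on a finite set. -/
def IsoClass.of (X : SetSpecies) {I : Type} [Fintype I] (x : X.obj I) :
    IsoClass X (Fintype.card I) :=
  IsoClass.mk X (X.map (Fintype.equivFin I) x)

/-- The degree `n` part of the graded space obtained from the species spanned by `X`. -/
abbrev Fock (K : Type*) [Field K] (X : SetSpecies) (n : ℕ) : Type _ := IsoClass X n →₀ K

/-- Forgetting the labels. -/
def forgetLabels (K : Type*) [Field K] (X : SetSpecies) (n : ℕ) :
    (X.obj (Fin n) →₀ K) →ₗ[K] Fock K X n :=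
  Finsupp.lmapDomain K K (IsoClass.mk X)

/-- The map induced by a morphism of species, determined by `fockMap_forgetLabels`. -/
def fockMap {K : Type*} [Field K] {X Y : SetSpecies} (Φ : SpeciesHom K X Y) (n : ℕ) :
    Fock K X n →ₗ[K] Fock K Y n :=
  Finsupp.linearCombination K <|
    Quot.lift (fun x => forgetLabels K Y n (Φ.app (Fin n) (Finsupp.single x 1))) <| by
      rintro a _ ⟨σ, rfl⟩
      have := Φ.naturality σ (Finsupp.single a 1)
      rw [Finsupp.mapDomain_single] at this
      rw [this, forgetLabels, Finsupp.lmapDomain_apply, Finsupp.lmapDomain_apply,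
        ← Finsupp.mapDomain_comp]
      congr 1
      ext y
      exact (IsoClass.mk_map Y σ y).symm

theorem fockMap_forgetLabels {K : Type*} [Field K] {X Y : SetSpecies} (Φ : SpeciesHom K X Y)
    (n : ℕ) (x : X.obj (Fin n) →₀ K) :
    fockMap Φ n (forgetLabels K X n x) = forgetLabels K Y n (Φ.app (Fin n) x) := by
  induction x using Finsupp.induction_linear with
  | zero => simp
  | add a b ha hb => simp only [map_add, ha, hb]
  | single a c =>
    have : Finsupp.single a c = c • Finsupp.single a (1 : K) := by simp
    rw [this, map_smul, map_smul, map_smul, map_smul, forgetLabels, Finsupp.lmapDomain_apply,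
      Finsupp.mapDomain_single, fockMap, Finsupp.linearCombination_single, one_smul]

/-- The graded dual of a graded vector space. -/
abbrev GradedDual (K : Type*) [Field K] (H : ℕ → Type*) [∀ n, AddCommGroup (H n)]
    [∀ n, Module K (H n)] : Type _ :=
  DirectSum ℕ fun n => Module.Dual K (H n)

/-- The dual basis vector `u^*`, for `u` an isomorphism class of `X`-structures. -/
def dualVec (K : Type*) [Field K] (X : SetSpecies) {n : ℕ} (u : IsoClass X n) :
    GradedDual K (Fock K X) :=
  DirectSum.lof K ℕ (fun n => Module.Dual K (Fock K X n)) n (Finsupp.lapply u)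

/-- The dual Brion map `p^* ↦ p^* ∘ B`. -/
def dualBrion (K : Type*) [Field K] :
    GradedDual K (Fock K posetSpecies) →ₗ[K] GradedDual K (Fock K gpSpecies) :=
  DirectSum.lmap fun n => (fockMap (brion K) n).dualMap

/-- A family of subspaces of the vector species of generalized permutahedra. -/
abbrev SubGP (K : Type*) [Field K] : Type _ :=
  (I : Type) → [Fintype I] → Submodule K (GPClass I →₀ K)

/-- The graded subspace of unlabelled structures obtained from `S`. -/
def SubGP.fock {K : Type*} [Field K] (S : SubGP K) (n : ℕ) : Submodule K (Fock K gpSpecies n) :=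
  (S (Fin n)).map (forgetLabels K gpSpecies n)

/-- The surjection `ι^*` dual to the inclusion of `S` into generalized permutahedra. -/
def SubGP.dualIncl {K : Type*} [Field K] (S : SubGP K) :
    GradedDual K (Fock K gpSpecies) →ₗ[K] GradedDual K (fun n => S.fock n) :=
  DirectSum.lmap fun n => (S.fock n).subtype.dualMap

/-- The dual Brion map with values in the graded dual of `S`. -/
def SubGP.dualBrion {K : Type*} [Field K] (S : SubGP K) :
    GradedDual K (Fock K posetSpecies) →ₗ[K] GradedDual K (fun n => S.fock n) :=
  S.dualIncl ∘ₗ BrionMap.dualBrion K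

/-- The dual basis vector `P^*` in the graded dual of `S`, for `P` a generalized permutahedron
whose class is one of the basis vectors of `S`. -/
def SubGP.dualVec {K : Type*} [Field K] (S : SubGP K) {n : ℕ} (P : GenPerm (Fin n)) :
    GradedDual K (fun n => S.fock n) :=
  S.dualIncl (BrionMap.dualVec K gpSpecies (IsoClass.mk gpSpecies (Quotient.mk _ P)))

/-! ### Permutahedra, associahedra and orbit polytopes -/

/-- The Loday associahedron `a_ℓ`: the Minkowski sum over all `i ≤ j` of the simplices with
vertices `e_k`, `i ≤ k ≤ j`. -/
def associahedron (I : Type) [Fintype I] (ℓ : LinearOrder I) : Set (I → ℝ) :=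
  haveI : Fintype {t : I × I // ℓ.le t.1 t.2} := Fintype.ofFinite _
  ∑ t : {t : I × I // ℓ.le t.1 t.2},
    convexHull ℝ (basisVec '' {k | ℓ.le t.1.1 k ∧ ℓ.le k t.1.2})

/-- The point `(k, …, k, …, 1, …, 1)`, with `lam₁` entries `k`, …, `lam_k` entries `1`, of a
composition `lam` with `k` parts. -/
def compositionPoint {n : ℕ} (lam : Composition n) (i : Fin n) : ℝ :=
  (lam.length : ℝ) - (lam.index i : ℕ)

/-- The orbit polytope `O_lam` in `ℝI` of a composition `lam` of `|I|`: the convex hull of all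
arrangements in `ℝI` of the coordinates of `compositionPoint lam`. -/
def orbitPolytope {n : ℕ} (lam : Composition n) (I : Type) : Set (I → ℝ) :=
  convexHull ℝ (Set.range fun (f : I ≃ Fin n) (i : I) => compositionPoint lam (f i))

/-- The product of polytopes `P j ⊆ ℝ(S_j)`, for the decomposition of `I` into the
sets `S_j = c⁻¹(j)`. -/
def prodPolytope {I : Type} {k : ℕ} (c : I → Fin k) (P : ∀ j, Set ({i // c i = j} → ℝ)) :
    Set (I → ℝ) :=
  {x | ∀ j, (fun i : {i // c i = j} => x i.1) ∈ P j}

/-- The span of the classes of products of standard permutahedra. -/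
def permSpecies (K : Type*) [Field K] : SubGP K := fun I _ =>
  Submodule.span K {b | ∃ (Q : GenPerm I) (k : ℕ) (c : I → Fin k),
    Q.carrier = prodPolytope c (fun j => permutahedron {i // c i = j}) ∧
    b = Finsupp.single (Quotient.mk _ Q) 1}

/-- The span of the classes of products of associahedra. -/
def assocSpecies (K : Type*) [Field K] : SubGP K := fun I _ =>
  Submodule.span K {b | ∃ (Q : GenPerm I) (k : ℕ) (c : I → Fin k)
    (ℓ : ∀ j, LinearOrder {i // c i = j}),
    Q.carrier = prodPolytope c (fun j => associahedron {i // c i = j} (ℓ j)) ∧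
    b = Finsupp.single (Quotient.mk _ Q) 1}

/-- The span of the classes of products of orbit polytopes. -/
def orbitSpecies (K : Type*) [Field K] : SubGP K := fun I _ =>
  Submodule.span K {b | ∃ (Q : GenPerm I) (k : ℕ) (c : I → Fin k)
    (lam : ∀ j, Composition (Fintype.card {i // c i = j})),
    Q.carrier = prodPolytope c (fun j => orbitPolytope (lam j) {i // c i = j}) ∧
    b = Finsupp.single (Quotient.mk _ Q) 1}

theorem maxFace_subset_of_vertices {I : Type} [Fintype I] {V : Set (I → ℝ)} (hf : V.Finite)
    {w y : I → ℝ} (h : ∀ x ∈ V, x ∈ maxFace (convexHull ℝ V) w → ∀ z ∈ V, y ⬝ᵥ z ≤ y ⬝ᵥ x) :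
    maxFace (convexHull ℝ V) w ⊆ maxFace (convexHull ℝ V) y := by
  intro x hx
  have hn : V.Nonempty := convexHull_nonempty_iff.1 ⟨x, hx.1⟩
  obtain ⟨ε, he, -, -⟩ := exists_perturb ⟨V, hf, hn, rfl⟩ w (-y)
  obtain ⟨x₀, hx₀, hm₀⟩ := exists_mem_maxFace hf hn (w + ε • -y)
  rw [he] at hm₀
  have h1 := hm₀.2 x hx
  rw [neg_dotProduct, neg_dotProduct] at h1
  refine ⟨hx.1, fun z hz => ?_⟩
  have := dot_le_of_convexHull (h x₀ hx₀ hm₀.1) hz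
  linarith

theorem swap_dot {I : Type} [Fintype I] [DecidableEq I] (y x : I → ℝ) (i j : I) :
    y ⬝ᵥ x - y ⬝ᵥ (x ∘ Equiv.swap i j) = (y i - y j) * (x i - x j) := by
  have e : x ∘ Equiv.swap i j = x - (x i - x j) • (basisVec i - basisVec j) := by
    ext k
    by_cases hi : k = i
    · subst hi
      by_cases hj : k = j
      · subst hj; simp
      · simp [basisVec_self, basisVec_ne hj]
    · by_cases hj : k = j
      · subst hj; simp [basisVec_self, basisVec_ne hi]
      · simp [basisVec_ne hi, basisVec_ne hj, Equiv.swap_apply_of_ne_of_ne hi hj]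
  rw [e, dotProduct_sub, dotProduct_smul, dotProduct_sub, dot_basisVec, dot_basisVec,
    smul_eq_mul]
  ring

theorem permutahedron_isPolytope (I : Type) [Fintype I] : IsPolytope (permutahedron I) :=
  ⟨_, Set.finite_range _, ⟨_, Fintype.equivFin I, rfl⟩, rfl⟩

/-- A criterion for the normal fan to coarsen the braid fan. -/
theorem coarsening_of_maxFace {I : Type} [Fintype I] {P : Set (I → ℝ)} (hP : IsPolytope P)
    (h : ∀ w y : I → ℝ, (∀ i j, w i ≤ w j → y i ≤ y j) → maxFace P w ⊆ maxFace P y) :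
    IsCoarsening (normalFan P) (normalFan (permutahedron I)) := by
  classical
  rintro _ ⟨F, ⟨_, w, rfl⟩, rfl⟩
  have hne : (maxFace P w).Nonempty := by
    obtain ⟨V, hf, hn, rfl⟩ := hP
    obtain ⟨x, _, hx⟩ := exists_mem_maxFace hf hn w
    exact ⟨x, hx⟩
  refine ⟨_, ⟨_, ⟨hne, w, rfl⟩, rfl⟩, fun y hy => ?_⟩
  have hcomp : ∀ i j, w i ≤ w j → y i ≤ y j := by
    intro i j hij
    rcases eq_or_ne i j with rfl | hne
    · exact le_rfl
    let u : I → ℝ := basisVec j - basisVec i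
    obtain ⟨ε, he, -, hε⟩ := exists_perturb (permutahedron_isPolytope I) w u
    obtain ⟨_, ⟨f, rfl⟩, hm⟩ := exists_mem_maxFace (V := Set.range fun
      (f : I ≃ Fin (Fintype.card I)) (i : I) => ((f i : ℕ) : ℝ) + 1)
      (Set.finite_range _) ⟨_, Fintype.equivFin I, rfl⟩ (w + ε • u)
    change _ ∈ maxFace (permutahedron I) _ at hm
    have hswap : ∀ f : I ≃ Fin (Fintype.card I),
        (fun i => ((f i : ℕ) : ℝ) + 1) ∘ Equiv.swap i j ∈ permutahedron I := fun f =>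
      subset_convexHull ℝ _ ⟨(Equiv.swap i j).trans f, rfl⟩
    have h1 := hm.2 _ (hswap f)
    rw [he] at hm
    have h2 := hy _ hm.1 _ (hswap f)
    rw [← sub_nonneg, swap_dot] at h1 h2
    have e : (w + ε • u) i - (w + ε • u) j = (w i - w j) - 2 * ε := by
      simp only [u, Pi.add_apply, Pi.smul_apply, Pi.sub_apply, basisVec_self, basisVec_ne hne,
        basisVec_ne hne.symm, smul_eq_mul]
      ring
    rw [e] at h1
    have hneg : (w i - w j) - 2 * ε < 0 := by linarith
    have hfne : ((f i : ℕ) : ℝ) + 1 - (((f j : ℕ) : ℝ) + 1) ≠ 0 := by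
      intro h0
      apply hne
      apply f.injective
      apply Fin.ext
      have : ((f i : ℕ) : ℝ) = ((f j : ℕ) : ℝ) := by linarith
      exact_mod_cast this
    have hfneg : ((f i : ℕ) : ℝ) + 1 - (((f j : ℕ) : ℝ) + 1) < 0 := by
      refine lt_of_le_of_ne ?_ hfne
      by_contra hpos
      nlinarith
    by_contra hlt
    nlinarith
  exact fun x hx => (h w y hcomp hx).2

/-- The standard permutahedron `π_n`. -/
def permGP (n : ℕ) : GenPerm (Fin n) where
  carrier := permutahedron (Fin n)
  isPolytope := permutahedron_isPolytope _
  isCoarsening := fun C hC => ⟨C, hC, subset_rfl⟩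

theorem associahedron_isPolytope (I : Type) [Fintype I] (ℓ : LinearOrder I) :
    IsPolytope (associahedron I ℓ) := by
  unfold associahedron
  rw [← convexHull_sum]
  refine ⟨_, ?_, ?_, rfl⟩
  · refine Finset.sum_induction _ Set.Finite (fun a b => Set.Finite.add) Set.finite_zero ?_
    intro t _
    exact (Set.toFinite _).image _
  · refine Finset.sum_induction _ Set.Nonempty (fun a b => Set.Nonempty.add)
      (Set.singleton_nonempty _) ?_
    intro t _
    exact ⟨_, t.1.1, ⟨ℓ.le_refl _, t.2⟩, rfl⟩

theorem maxFace_sum {I T : Type} [Fintype I] [Fintype T] (P : T → Set (I → ℝ)) {w y : I → ℝ}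
    (h : ∀ t, maxFace (P t) w ⊆ maxFace (P t) y) :
    maxFace (∑ t, P t) w ⊆ maxFace (∑ t, P t) y := by
  classical
  rintro x ⟨hx, hm⟩
  refine ⟨hx, ?_⟩
  rw [Set.mem_finsetSum] at hx
  obtain ⟨g, hg, rfl⟩ := hx
  have hgt : ∀ t, g t ∈ maxFace (P t) w := by
    intro t
    refine ⟨hg (Finset.mem_univ t), fun z hz => ?_⟩
    have hz' : ∑ s, Function.update g t z s ∈ ∑ s, P s := by
      rw [Set.mem_finsetSum]
      refine ⟨_, fun {s} _ => ?_, rfl⟩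
      rcases eq_or_ne s t with rfl | hs
      · simpa using hz
      · rw [Function.update_of_ne hs]; exact hg (Finset.mem_univ s)
    have := hm _ hz'
    rw [Finset.sum_update_of_mem (Finset.mem_univ t),
      ← Finset.add_sum_erase _ _ (Finset.mem_univ t), dotProduct_add, dotProduct_add,
      Finset.sdiff_singleton_eq_erase] at this
    linarith
  intro z hz
  rw [Set.mem_finsetSum] at hz
  obtain ⟨g', hg', rfl⟩ := hz
  rw [dotProduct_sum, dotProduct_sum]
  exact Finset.sum_le_sum fun t _ => (h t (hgt t)).2 _ (hg' (Finset.mem_univ t))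

/-- The associahedron `a_n`, for the standard linear order on `n` points. -/
def assocGP (n : ℕ) : GenPerm (Fin n) where
  carrier := associahedron (Fin n) inferInstance
  isPolytope := associahedron_isPolytope _ _
  isCoarsening := by
    refine coarsening_of_maxFace (associahedron_isPolytope _ _) fun w y hwy => ?_
    refine @maxFace_sum _ _ _ (_) _ _ _ fun t => ?_
    refine maxFace_subset_of_vertices ((Set.toFinite _).image _) ?_
    rintro _ ⟨a, ha, rfl⟩ hm _ ⟨b, hb, rfl⟩
    have := hm.2 _ (subset_convexHull ℝ _ ⟨b, hb, rfl⟩)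
    rw [dot_basisVec, dot_basisVec] at this ⊢
    exact hwy _ _ this

theorem orbitPolytope_isPolytope {n : ℕ} (lam : Composition n) :
    IsPolytope (orbitPolytope lam (Fin n)) :=
  ⟨_, Set.finite_range _, ⟨_, Equiv.refl _, rfl⟩, rfl⟩

/-- The orbit polytope `O_lam` on `n` points. -/
def orbitGP {n : ℕ} (lam : Composition n) : GenPerm (Fin n) where
  carrier := orbitPolytope lam (Fin n)
  isPolytope := orbitPolytope_isPolytope lam
  isCoarsening := by
    classical
    refine coarsening_of_maxFace (orbitPolytope_isPolytope lam) fun w y hwy => ?_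
    refine maxFace_subset_of_vertices (Set.finite_range _) ?_
    rintro _ ⟨f, rfl⟩ hm _ ⟨g, rfl⟩
    have hmono : Monovary y (fun i => compositionPoint lam (f i)) := by
      intro i j hij
      refine hwy i j ?_
      have := hm.2 _ (subset_convexHull ℝ _ ⟨(Equiv.swap i j).trans f, rfl⟩)
      have h2 := swap_dot w (fun i => compositionPoint lam (f i)) i j
      simp only at hij h2
      have h3 : 0 ≤ (w i - w j) * (compositionPoint lam (f i) - compositionPoint lam (f j)) := by
        rw [← h2, sub_nonneg]; exact this
      by_contra hlt
      nlinarith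
    have := hmono.sum_mul_comp_perm_le_sum_mul (σ := g.trans f.symm)
    simpa [dotProduct] using this

/-! ### Posets -/

/-- A finite poset is connected if it is nonempty and not a nontrivial disjoint union. -/
def IsConnectedPoset (α : Type) [PartialOrder α] : Prop :=
  Nonempty α ∧ ∀ S : Set α, (∀ a ∈ S, ∀ b ∉ S, ¬ a ≤ b ∧ ¬ b ≤ a) → S = ∅ ∨ S = Set.univ

/-- The disjoint union of two posets. -/
@[reducible] def sumOrder {I J : Type} (p : PartialOrder I) (q : PartialOrder J) :
    PartialOrder (I ⊕ J) where
  le := Sum.LiftRel p.le q.le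
  lt a b := Sum.LiftRel p.le q.le a b ∧ ¬ Sum.LiftRel p.le q.le b a
  lt_iff_le_not_ge _ _ := Iff.rfl
  le_refl := by
    rintro (a | b)
    · exact .inl (p.le_refl a)
    · exact .inr (q.le_refl b)
  le_trans := by
    rintro _ _ _ (h | h) (h' | h')
    · exact .inl (p.le_trans _ _ _ h h')
    · exact .inr (q.le_trans _ _ _ h h')
  le_antisymm := by
    rintro _ _ (h | h) (h' | h')
    · exact congrArg _ (p.le_antisymm _ _ h h')
    · exact congrArg _ (q.le_antisymm _ _ h h')

theorem relabel_sumOrder {I J L : Type} (σ : I ≃ I) (τ : J ≃ J) (p : PartialOrder I)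
    (q : PartialOrder J) (e : I ⊕ J ≃ L) :
    relabelOrder (e.symm.trans ((σ.sumCongr τ).trans e)) (relabelOrder e (sumOrder p q)) =
      relabelOrder e (sumOrder (relabelOrder σ p) (relabelOrder τ q)) := by
  refine PartialOrder.ext fun a b => ?_
  obtain ⟨a, rfl⟩ := e.surjective a
  obtain ⟨b, rfl⟩ := e.surjective b
  have h : ∀ c, e.symm ((e.symm.trans ((σ.sumCongr τ).trans e)).symm (e c)) =
      Sum.map σ.symm τ.symm c := by rintro (c | c) <;> simp
  change Sum.LiftRel p.le q.le (e.symm ((e.symm.trans ((σ.sumCongr τ).trans e)).symm (e a)))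
      (e.symm ((e.symm.trans ((σ.sumCongr τ).trans e)).symm (e b))) ↔
    Sum.LiftRel (relabelOrder σ p).le (relabelOrder τ q).le (e.symm (e a)) (e.symm (e b))
  rw [h, h, e.symm_apply_apply, e.symm_apply_apply]
  rcases a with a | a <;> rcases b with b | b
  · rw [Sum.map_inl, Sum.map_inl, Sum.liftRel_inl_inl, Sum.liftRel_inl_inl]; rfl
  · exact ⟨fun h => by simp at h, fun h => by simp at h⟩
  · exact ⟨fun h => by simp at h, fun h => by simp at h⟩
  · rw [Sum.map_inr, Sum.map_inr, Sum.liftRel_inr_inr, Sum.liftRel_inr_inr]; rfl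

/-- The product (disjoint union) of unlabelled posets. -/
def posetClassMul {m n : ℕ} (a : IsoClass posetSpecies m) (b : IsoClass posetSpecies n) :
    IsoClass posetSpecies (m + n) :=
  Quot.map₂ (fun (p : PartialOrder (Fin m)) (q : PartialOrder (Fin n)) =>
      relabelOrder finSumFinEquiv (sumOrder p q))
    (by
      rintro p q _ ⟨σ, rfl⟩
      refine ⟨finSumFinEquiv.symm.trans (((Equiv.refl _).sumCongr σ).trans finSumFinEquiv), ?_⟩
      exact relabel_sumOrder (Equiv.refl _) σ p q _)
    (by
      rintro p _ q ⟨σ, rfl⟩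
      refine ⟨finSumFinEquiv.symm.trans ((σ.sumCongr (Equiv.refl _)).trans finSumFinEquiv), ?_⟩
      exact relabel_sumOrder σ (Equiv.refl _) p q _) a b

/-- The product on the Hopf algebra of posets, in degrees `m` and `n`. -/
def posetMul (K : Type*) [Field K] (m n : ℕ) :
    Fock K posetSpecies m →ₗ[K] Fock K posetSpecies n →ₗ[K] Fock K posetSpecies (m + n) :=
  Finsupp.lsum K fun a => LinearMap.toSpanSingleton K _
    (Finsupp.lmapDomain K K (posetClassMul a))

/-- The primitive elements of the graded dual of the Hopf algebra of posets: those which vanish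
in degree `0` and whose dual coproduct `f ∘ μ` vanishes in all degrees `m, n > 0`. -/
def posetPrimitives (K : Type*) [Field K] : Submodule K (GradedDual K (Fock K posetSpecies)) where
  carrier := {f | f 0 = 0 ∧ ∀ m n : ℕ, 0 < m → 0 < n →
    ∀ (x : Fock K posetSpecies m) (y : Fock K posetSpecies n),
      f (m + n) (posetMul K m n x y) = 0}
  add_mem' := by
    rintro f g ⟨hf, hf'⟩ ⟨hg, hg'⟩
    refine ⟨by simp [hf, hg], fun m n hm hn x y => ?_⟩
    rw [DirectSum.add_apply, LinearMap.add_apply, hf' m n hm hn, hg' m n hm hn, add_zero]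
  zero_mem' := ⟨rfl, fun _ _ _ _ _ _ => rfl⟩
  smul_mem' := by
    rintro c f ⟨hf, hf'⟩
    refine ⟨by simp [DirectSum.smul_apply, hf], fun m n hm hn x y => ?_⟩
    rw [DirectSum.smul_apply, LinearMap.smul_apply, hf' m n hm hn, smul_zero]

/-- The dual basis vector `α^*` of the unlabelled poset underlying a finite poset `α`. -/
def posetDual (K : Type*) [Field K] (α : Type) [Fintype α] [p : PartialOrder α] :
    GradedDual K (Fock K posetSpecies) :=
  dualVec K posetSpecies (IsoClass.of posetSpecies (I := α) p)

/-- The nodes of a rooted binary tree (in its pruned representation). -/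
def RBTNode : BinaryTree Unit → Type
  | .nil => Empty
  | .node _ l r => WithBot (RBTNode l ⊕ RBTNode r)

/-- The poset of a rooted binary tree: the root is the minimum, and the left and right subtrees
above it are incomparable to each other. -/
instance rbtOrder : (T : BinaryTree Unit) → PartialOrder (RBTNode T)
  | .nil => inferInstanceAs (PartialOrder Empty)
  | .node _ l r =>
    haveI := rbtOrder l
    haveI := rbtOrder r
    inferInstanceAs (PartialOrder (WithBot (RBTNode l ⊕ RBTNode r)))

/-- Unlabelled RBT posets. -/
def IsRBTPoset (α : Type) [PartialOrder α] : Prop :=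
  ∃ T : BinaryTree Unit, Nonempty (α ≃o RBTNode T)

/-- The number of maximal elements. -/
def numMaximal (α : Type) [PartialOrder α] : ℕ := Nat.card {a : α // IsMax a}

/-- `v` is symmetric if it is covered by two elements above which the poset looks the same. -/
def IsSymmetricElt {α : Type} [PartialOrder α] (v : α) : Prop :=
  ∃ v₁ v₂ : α, v₁ ≠ v₂ ∧ v ⋖ v₁ ∧ v ⋖ v₂ ∧ Nonempty (Set.Ici v₁ ≃o Set.Ici v₂)

/-- The number of symmetric elements. -/
def numSymmetric (α : Type) [PartialOrder α] : ℕ := Nat.card {v : α // IsSymmetricElt v}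

/-- The elements of the layered poset `p(lam)`: the `i`-th level has `lam_i` elements. -/
def LayeredPoset {n : ℕ} (lam : Composition n) : Type :=
  Σ i : Fin lam.length, Fin (lam.blocksFun i)

/-- In `p(lam)`, everything on a lower level is below everything on a higher level. -/
instance layeredOrder {n : ℕ} (lam : Composition n) : PartialOrder (LayeredPoset lam) where
  le a b := a = b ∨ a.1 < b.1
  le_refl a := Or.inl rfl
  le_trans a b c := by
    rintro (rfl | h) (rfl | h')
    · exact Or.inl rfl
    · exact Or.inr h'
    · exact Or.inr h
    · exact Or.inr (h.trans h')
  le_antisymm a b := by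
    rintro (rfl | h) (h' | h')
    · rfl
    · rfl
    · exact h'.symm
    · exact absurd (h.trans h') (lt_irrefl _)

end BrionMap

end

open BrionMap

/-!
The dual Brion map sends `p^*` to the functional which counts, on a basis polytope, the vertices
whose vertex poset is isomorphic to `p` (`dualBrion_posetDual_apply`). So each formula splits into
two statements: the only basis polytope with such a vertex is the one named (up to relabelling and
normal equivalence), and the number of these vertices is the coefficient
(`SubGP.dualBrion_eq_smul`, `SubGP.dualBrion_eq_zero`). That `p^*` is primitive exactly if `p` is
connected holds since a basis element of the product in `P` is a disjoint union.

Products of several polytopes do not matter for connected `p`: the coordinate sum of every factor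
is constant, so no tangent cone contains `e_i - e_j` with `i` and `j` in different blocks
(`exists_block_of_isConnectedPoset`). What remains are the vertex posets of single polytopes.
Tangent cones are defined by the edges at a vertex, and the bridge to computations is
`sub_mem_tangentCone`: at a vertex `v` of a polytope they contain `w - v` for all points `w`. Thus
`e_i - e_j` lies in the tangent cone as soon as one finds a point of the polytope in that direction.

For orbit polytopes, one exchanges two coordinates of a vertex: the vertex poset is, at every
vertex, the layered poset of the composition, with the largest coordinates at the bottom, and the
vertices are the cosets of the stabilizer of an arrangement, which gives the multinomial coefficient
(`isoPoset_vertexPoset_orbitPolytope`, `card_vertices_orbitPolytope`). The levels of a layered poset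
are its heights, so the composition can be recovered. The permutahedron is the orbit polytope of the
composition `(1, …, 1)`.

The associahedron is the Minkowski sum of the simplices on all intervals. A vertex is the sum of one
vertex of each simplex, that of the largest coordinate of a functional on the interval; conversely,
moving one summand shows that `e_i - e_j` is in the tangent cone if `j` is the chosen element of the
interval between `i` and `j`. So the vertices correspond to the search orders on the linear order,
each being its own vertex poset (`vertexCount_associahedron`), and these are the inorder numberings
of binary trees (`vertexCount_assocGP`). It remains to count the binary trees with a given poset of
nodes. A tree decomposes as a bottom element and two subtrees, whose unordered pair is determined by
the poset; hence exchanging subtrees at the nodes where they are not isomorphic gives a power of two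
(`RBTNode.ncard_sameShape`). Every node is either a leaf, or symmetric, or has subtrees which are
not isomorphic, so the exponent is `n - m(p) - s(p)`
(`RBTNode.twists_add_numMaximal_add_numSymmetric`).
-/

namespace BrionMap

/-! ### Evaluating dual basis vectors and the dual Brion map -/

/-- The poset structure `q` on `I` is isomorphic to the poset `α`. -/
def IsoPoset {I : Type} (q : PartialOrder I) (α : Type) [PartialOrder α] : Prop :=
  ∃ e : I ≃ α, ∀ a b, q.le a b ↔ e a ≤ e b

theorem IsoPoset.card_eq {I : Type} [Fintype I] {q : PartialOrder I} {α : Type} [Fintype α]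
    [PartialOrder α] (h : IsoPoset q α) : Fintype.card I = Fintype.card α :=
  Fintype.card_congr h.choose

theorem isoPoset_relabelOrder {I J : Type} (σ : I ≃ J) (q : PartialOrder I) (α : Type)
    [PartialOrder α] : IsoPoset (relabelOrder σ q) α ↔ IsoPoset q α := by
  constructor
  · rintro ⟨e, he⟩
    refine ⟨σ.trans e, fun a b => ?_⟩
    rw [Equiv.trans_apply, Equiv.trans_apply, ← he]
    change _ ↔ q.le (σ.symm (σ a)) (σ.symm (σ b))
    rw [σ.symm_apply_apply, σ.symm_apply_apply]
  · rintro ⟨e, he⟩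
    exact ⟨σ.symm.trans e, fun a b => he _ _⟩

theorem isoClass_of_eq_mk {n : ℕ} {I : Type} [Fintype I] (p : PartialOrder I)
    (h : Fintype.card I = n) (q : PartialOrder (Fin n)) :
    h ▸ IsoClass.of posetSpecies p = IsoClass.mk posetSpecies q ↔ @IsoPoset _ q I p := by
  subst h
  have hequiv : Equivalence fun a b : posetSpecies.obj (Fin (Fintype.card I)) =>
      ∃ σ : Fin (Fintype.card I) ≃ Fin (Fintype.card I), posetSpecies.map σ a = b :=
    { refl := fun a => ⟨Equiv.refl _, posetSpecies.map_refl _ a⟩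
      symm := by
        rintro a _ ⟨σ, rfl⟩
        refine ⟨σ.symm, ?_⟩
        rw [← posetSpecies.map_trans, Equiv.self_trans_symm, posetSpecies.map_refl]
      trans := by
        rintro a _ _ ⟨σ, rfl⟩ ⟨τ, rfl⟩
        exact ⟨σ.trans τ, posetSpecies.map_trans _ _ _⟩ }
  change Quot.mk _ _ = Quot.mk _ _ ↔ _
  rw [Quot.eq, hequiv.eqvGen_iff]
  constructor
  · rintro ⟨σ, rfl⟩
    exact (isoPoset_relabelOrder _ _ _).2 ((isoPoset_relabelOrder _ _ _).2
      ⟨Equiv.refl _, fun _ _ => Iff.rfl⟩)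
  · rintro ⟨e, he⟩
    refine ⟨(Fintype.equivFin I).symm.trans e.symm, PartialOrder.ext fun a b => ?_⟩
    rw [he]
    change p.le ((Fintype.equivFin I).symm ((Fintype.equivFin I) (e a)))
      ((Fintype.equivFin I).symm ((Fintype.equivFin I) (e b))) ↔ _
    rw [Equiv.symm_apply_apply, Equiv.symm_apply_apply]

open Classical in
theorem posetDual_apply (K : Type*) [Field K] (α : Type) [Fintype α] [PartialOrder α] {m : ℕ}
    (q : PartialOrder (Fin m)) :
    posetDual K α m (Finsupp.single (IsoClass.mk posetSpecies q) 1) =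
      if IsoPoset q α then 1 else 0 := by
  by_cases hm : Fintype.card α = m
  · have := isoClass_of_eq_mk (I := α) inferInstance hm q
    subst hm
    rw [posetDual, dualVec, DirectSum.lof_apply, Finsupp.lapply_apply, Finsupp.single_apply]
    refine if_congr ?_ rfl rfl
    rw [← this, eq_comm]
  · rw [if_neg fun h => hm (by simpa using h.card_eq.symm), posetDual, dualVec,
      DirectSum.lof_eq_of, DirectSum.of_eq_of_ne _ _ _ (Ne.symm hm)]
    rfl

/-- The number of vertices of `P` whose vertex poset is isomorphic to `α`. -/
noncomputable def vertexCount {I : Type} [Fintype I] (P : Set (I → ℝ)) (α : Type)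
    [PartialOrder α] : ℕ :=
  Nat.card {v : vertices P // IsoPoset (vertexPoset P v) α}

theorem exists_vertex_of_vertexCount_ne_zero {I : Type} [Fintype I] {P : Set (I → ℝ)} {α : Type}
    [PartialOrder α] (h : vertexCount P α ≠ 0) :
    ∃ v : vertices P, IsoPoset (vertexPoset P v) α := by
  obtain ⟨⟨v, hv⟩⟩ := (Nat.card_ne_zero.1 h).1
  exact ⟨v, hv⟩

theorem dualBrion_posetDual_apply (K : Type*) [Field K] (α : Type) [Fintype α] [PartialOrder α]
    {m : ℕ} (Q : GenPerm (Fin m)) :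
    BrionMap.dualBrion K (posetDual K α) m
      (Finsupp.single (IsoClass.mk gpSpecies (Quotient.mk _ Q)) 1) =
      (vertexCount Q.carrier α : K) := by
  classical
  let _ : Fintype (vertices Q.carrier) := (vertices_finite Q.isPolytope).fintype
  have h1 : BrionMap.dualBrion K (posetDual K α) m
      (Finsupp.single (IsoClass.mk gpSpecies (Quotient.mk _ Q)) 1) =
      posetDual K α m (forgetLabels K posetSpecies m (brionSum K Q)) := by
    rw [BrionMap.dualBrion, DirectSum.lmap_apply, LinearMap.dualMap_apply, fockMap,
      Finsupp.linearCombination_single, one_smul]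
    change posetDual K α m (forgetLabels K posetSpecies m
      (Finsupp.linearCombination K _ (Finsupp.single _ 1))) = _
    rw [Finsupp.linearCombination_single, one_smul]
    rfl
  rw [h1, brionSum, map_sum, map_sum, vertexCount, Nat.card_eq_fintype_card, Fintype.card_subtype,
    Finset.card_filter, Nat.cast_sum]
  refine Finset.sum_congr rfl fun v _ => ?_
  rw [forgetLabels, Finsupp.lmapDomain_apply, Finsupp.mapDomain_single, posetDual_apply]
  split_ifs <;> simp

/-- To identify the image of a dual basis vector, it suffices to compare values on the spanning
polytopes in its degree, where the dual Brion map counts vertices. -/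
theorem SubGP.dualBrion_ext {K : Type*} [Field K] {S : SubGP K} {α : Type} [Fintype α]
    [PartialOrder α] {G : GenPerm (Fin (Fintype.card α)) → Prop}
    (hS : S (Fin (Fintype.card α)) ≤ Submodule.span K
      {b | ∃ Q, G Q ∧ b = Finsupp.single (Quotient.mk _ Q) 1})
    (F : GradedDual K (Fock K gpSpecies)) (hF : ∀ m, m ≠ Fintype.card α → F m = 0)
    (h : ∀ Q, G Q → F _ (Finsupp.single (IsoClass.mk gpSpecies (Quotient.mk _ Q)) 1) =
      (vertexCount Q.carrier α : K)) :
    S.dualBrion (posetDual K α) = S.dualIncl F := by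
  rw [SubGP.dualBrion, LinearMap.comp_apply]
  refine DFinsupp.ext fun m => ?_
  change S.dualIncl (BrionMap.dualBrion K (posetDual K α)) m = S.dualIncl F m
  rw [SubGP.dualIncl, DirectSum.lmap_apply, DirectSum.lmap_apply]
  ext ⟨x, y, hy, rfl⟩
  rw [LinearMap.dualMap_apply, LinearMap.dualMap_apply]
  change (BrionMap.dualBrion K (posetDual K α) m) (forgetLabels K gpSpecies m y) =
    F m (forgetLabels K gpSpecies m y)
  by_cases hm : m = Fintype.card α
  · subst hm
    refine Submodule.span_induction ?_ (by simp) ?_ ?_ (hS hy)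
    · rintro _ ⟨Q, hQ, rfl⟩
      rw [forgetLabels, Finsupp.lmapDomain_apply, Finsupp.mapDomain_single, h Q hQ,
        dualBrion_posetDual_apply]
    · intro a b _ _ ha hb; rw [map_add, map_add, map_add, ha, hb]
    · intro c a _ ha; rw [map_smul, map_smul, map_smul, ha]
  · rw [hF m hm]
    have : posetDual K α m = 0 := by
      rw [posetDual, BrionMap.dualVec, DirectSum.lof_eq_of, DirectSum.of_eq_of_ne _ _ _ hm]
    rw [BrionMap.dualBrion, DirectSum.lmap_apply, this, map_zero]

/-- If the basis polytopes with a vertex poset isomorphic to `α` are all isomorphic to `P`,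
then the dual Brion map sends the dual basis vector of `α` to a multiple of that of `P`. -/
theorem SubGP.dualBrion_eq_smul {K : Type*} [Field K] {S : SubGP K} {α : Type} [Fintype α]
    [PartialOrder α] {G : GenPerm (Fin (Fintype.card α)) → Prop}
    (hS : S (Fin (Fintype.card α)) ≤ Submodule.span K
      {b | ∃ Q, G Q ∧ b = Finsupp.single (Quotient.mk _ Q) 1})
    {c : K} (P : GenPerm (Fin (Fintype.card α))) (hP : (vertexCount P.carrier α : K) = c)
    (h : ∀ Q, G Q → vertexCount Q.carrier α ≠ 0 →
      IsoClass.mk gpSpecies (Quotient.mk _ Q) = IsoClass.mk gpSpecies (Quotient.mk _ P)) :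
    S.dualBrion (posetDual K α) = c • S.dualVec P := by
  rw [SubGP.dualVec, ← map_smul]
  refine SubGP.dualBrion_ext hS _ (fun m hm => ?_) fun Q hQ => ?_
  · rw [DirectSum.smul_apply, BrionMap.dualVec, DirectSum.lof_eq_of,
      DirectSum.of_eq_of_ne _ _ _ hm, smul_zero]
  · rw [DirectSum.smul_apply, BrionMap.dualVec, DirectSum.lof_apply, LinearMap.smul_apply,
      Finsupp.lapply_apply, smul_eq_mul]
    by_cases hQP : IsoClass.mk gpSpecies (Quotient.mk _ Q) =
      IsoClass.mk gpSpecies (Quotient.mk _ P)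
    · rw [hQP, Finsupp.single_eq_same, mul_one, ← hP, ← dualBrion_posetDual_apply,
        ← dualBrion_posetDual_apply, hQP]
    · rw [Finsupp.single_eq_of_ne (Ne.symm hQP), mul_zero]
      by_contra h0
      exact hQP (h Q hQ fun hz => h0 (by rw [hz, Nat.cast_zero]))

theorem SubGP.dualBrion_eq_zero {K : Type*} [Field K] {S : SubGP K} {α : Type} [Fintype α]
    [PartialOrder α] {G : GenPerm (Fin (Fintype.card α)) → Prop}
    (hS : S (Fin (Fintype.card α)) ≤ Submodule.span K
      {b | ∃ Q, G Q ∧ b = Finsupp.single (Quotient.mk _ Q) 1})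
    (h : ∀ Q, G Q → vertexCount Q.carrier α = 0) :
    S.dualBrion (posetDual K α) = 0 := by
  rw [← map_zero S.dualIncl]
  exact SubGP.dualBrion_ext hS _ (fun m _ => rfl) fun Q hQ => by
    rw [h Q hQ, Nat.cast_zero]; rfl

/-! ### Primitive dual basis vectors -/

theorem posetDual_posetMul (K : Type*) [Field K] (α : Type) [Fintype α] [PartialOrder α]
    {m n : ℕ} (p : PartialOrder (Fin m)) (q : PartialOrder (Fin n))
    [Decidable (IsoPoset (sumOrder p q) α)] :
    posetDual K α (m + n) (posetMul K m n
      (Finsupp.single (IsoClass.mk posetSpecies p) 1)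
      (Finsupp.single (IsoClass.mk posetSpecies q) 1)) =
      if IsoPoset (sumOrder p q) α then 1 else 0 := by
  classical
  rw [posetMul, Finsupp.lsum_single, LinearMap.toSpanSingleton_apply, one_smul,
    Finsupp.lmapDomain_apply, Finsupp.mapDomain_single]
  change posetDual K α (m + n) (Finsupp.single (IsoClass.mk posetSpecies
    (relabelOrder finSumFinEquiv (sumOrder p q))) 1) = _
  rw [posetDual_apply]
  exact if_congr (isoPoset_relabelOrder _ _ _) rfl rfl

theorem not_isConnectedPoset_of_sumOrder {I J : Type} [Nonempty I] [Nonempty J]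
    {p : PartialOrder I} {q : PartialOrder J} {α : Type} [PartialOrder α]
    (h : IsoPoset (sumOrder p q) α) : ¬ IsConnectedPoset α := by
  rintro ⟨-, hc⟩
  obtain ⟨e, he⟩ := h
  obtain ⟨i⟩ := ‹Nonempty I›
  obtain ⟨j⟩ := ‹Nonempty J›
  have hsep : ∀ a ∈ Set.range fun i => e (.inl i), ∀ b ∉ Set.range fun i => e (.inl i),
      ¬ a ≤ b ∧ ¬ b ≤ a := by
    rintro _ ⟨a, rfl⟩ b hb
    obtain ⟨b | b, rfl⟩ := e.surjective b
    · exact absurd ⟨b, rfl⟩ hb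
    · rw [← he, ← he]
      exact ⟨fun h => (nomatch h), fun h => (nomatch h)⟩
  rcases hc _ hsep with h0 | h0
  · exact (h0 ▸ Set.mem_range_self i : e (.inl i) ∈ (∅ : Set α))
  · have : e (.inr j) ∈ Set.range fun i => e (.inl i) := h0 ▸ Set.mem_univ _
    obtain ⟨i', hi'⟩ := this
    exact Sum.inl_ne_inr (e.injective hi')

theorem mem_posetPrimitives_iff (K : Type*) [Field K] (α : Type) [Fintype α] [PartialOrder α] :
    posetDual K α ∈ posetPrimitives K ↔ IsConnectedPoset α := by
  classical
  constructor
  · rintro ⟨h0, hmul⟩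
    refine ⟨?_, fun S hS => ?_⟩
    · by_contra hne
      rw [not_nonempty_iff] at hne
      let q : PartialOrder (Fin 0) := inferInstance
      have hq : IsoPoset q α := ⟨Equiv.equivOfIsEmpty _ _, fun a => a.elim0⟩
      have := posetDual_apply K α q
      rw [h0, if_pos hq] at this
      exact zero_ne_one this
    · by_contra! hcon
      obtain ⟨h1, h2⟩ := hcon
      obtain ⟨a, ha⟩ := h1
      obtain ⟨b, hb⟩ := (Set.ne_univ_iff_exists_notMem S).1 h2
      -- `α` is the disjoint union of `S` and its complement
      let σ := Fintype.equivFin {x // x ∈ S}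
      let τ := Fintype.equivFin {x // x ∉ S}
      let p : PartialOrder (Fin (Fintype.card {x // x ∈ S})) :=
        PartialOrder.lift σ.symm σ.symm.injective
      let q : PartialOrder (Fin (Fintype.card {x // x ∉ S})) :=
        PartialOrder.lift τ.symm τ.symm.injective
      have hpq : IsoPoset (sumOrder p q) α := by
        refine ⟨(σ.symm.sumCongr τ.symm).trans (Equiv.sumCompl (· ∈ S)), ?_⟩
        rintro (x | x) (y | y)
        · exact Sum.liftRel_inl_inl
        · exact iff_of_false (fun h => by cases h) (hS _ (σ.symm x).2 _ (τ.symm y).2).1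
        · exact iff_of_false (fun h => by cases h) (hS _ (σ.symm y).2 _ (τ.symm x).2).2
        · exact Sum.liftRel_inr_inr
      have := posetDual_posetMul K α p q
      rw [hmul _ _ (Fintype.card_pos_iff.2 ⟨a, ha⟩) (Fintype.card_pos_iff.2 ⟨b, hb⟩),
        if_pos hpq] at this
      exact zero_ne_one this
  · intro hconn
    constructor
    · refine Finsupp.lhom_ext' fun u => LinearMap.ext_ring ?_
      induction u using Quot.ind with | _ q =>
      change posetDual K α 0 (Finsupp.single (IsoClass.mk posetSpecies q) 1) = 0
      rw [posetDual_apply, if_neg]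
      rintro ⟨e, -⟩
      exact (e.symm hconn.1.some).elim0
    · intro m n hm hn x y
      have : Nonempty (Fin m) := ⟨⟨0, hm⟩⟩
      have : Nonempty (Fin n) := ⟨⟨0, hn⟩⟩
      induction x using Finsupp.induction_linear with
      | zero => simp
      | add a b ha hb => rw [map_add, LinearMap.add_apply, map_add, ha, hb, add_zero]
      | single a c =>
      induction y using Finsupp.induction_linear with
      | zero => simp
      | add a b ha hb => rw [map_add, map_add, ha, hb, add_zero]
      | single b d =>
      induction a using Quot.ind with | _ p =>
      induction b using Quot.ind with | _ q =>
      rw [← mul_one c, ← mul_one d, ← smul_eq_mul, ← smul_eq_mul, ← Finsupp.smul_single,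
        ← Finsupp.smul_single, map_smul (posetMul K m n), LinearMap.smul_apply,
        map_smul, map_smul, map_smul]
      have := posetDual_posetMul K α p q
      rw [if_neg fun h => not_isConnectedPoset_of_sumOrder h hconn] at this
      change c • d • posetDual K α (m + n) (posetMul K m n
        (Finsupp.single (IsoClass.mk posetSpecies p) 1)
        (Finsupp.single (IsoClass.mk posetSpecies q) 1)) = 0
      rw [this, smul_zero, smul_zero]

/-! ### Faces of convex hulls and tangent cones -/

theorem dot_lt_of_convexHull {I : Type} [Fintype I] {V : Set (I → ℝ)} {y : I → ℝ} {M : ℝ}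
    (h : ∀ x ∈ V, y ⬝ᵥ x < M) {x : I → ℝ} (hx : x ∈ convexHull ℝ V) : y ⬝ᵥ x < M := by
  have hc : Convex ℝ {x : I → ℝ | y ⬝ᵥ x < M} :=
    convex_halfSpace_lt ⟨fun a b => dotProduct_add y a b, fun c a => dotProduct_smul c y a⟩ M
  exact convexHull_min h hc hx

theorem dot_eq_of_convexHull {I : Type} [Fintype I] {V : Set (I → ℝ)} {y : I → ℝ} {M : ℝ}
    (h : ∀ x ∈ V, y ⬝ᵥ x = M) {x : I → ℝ} (hx : x ∈ convexHull ℝ V) : y ⬝ᵥ x = M := by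
  refine le_antisymm (dot_le_of_convexHull (fun x hx => (h x hx).le) hx) ?_
  have := dot_le_of_convexHull (y := -y) (M := -M) (fun x hx => by
    rw [neg_dotProduct, h x hx]) hx
  rw [neg_dotProduct] at this
  linarith

/-- A functional which is at most `M` on `V` attains the value `M` on the convex hull of `V` only
on the convex hull of the points of `V` where it does so. -/
theorem mem_convexHull_of_dot_eq {I : Type} [Fintype I] {V : Set (I → ℝ)} {y : I → ℝ} {M : ℝ}
    (h : ∀ x ∈ V, y ⬝ᵥ x ≤ M) {x : I → ℝ} (hx : x ∈ convexHull ℝ V) (hxM : y ⬝ᵥ x = M) :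
    x ∈ convexHull ℝ {v ∈ V | y ⬝ᵥ v = M} := by
  have hV : V = {v ∈ V | y ⬝ᵥ v = M} ∪ {v ∈ V | y ⬝ᵥ v < M} := by
    ext v
    constructor
    · intro hv
      rcases (h v hv).eq_or_lt with h1 | h1
      · exact Or.inl ⟨hv, h1⟩
      · exact Or.inr ⟨hv, h1⟩
    · rintro (hv | hv) <;> exact hv.1
  rcases Set.eq_empty_or_nonempty {v ∈ V | y ⬝ᵥ v < M} with hB | hB
  · rw [hB, Set.union_empty] at hV
    rwa [← hV]
  rcases Set.eq_empty_or_nonempty {v ∈ V | y ⬝ᵥ v = M} with hA | hA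
  · rw [hA, Set.empty_union] at hV
    rw [hV] at hx
    exact absurd hxM (dot_lt_of_convexHull (fun v hv => hv.2) hx).ne
  rw [hV, convexHull_union hA hB, mem_convexJoin] at hx
  obtain ⟨p, hp, q, hq, a, b, ha, hb, hab, rfl⟩ := hx
  have h1 : y ⬝ᵥ p = M := dot_eq_of_convexHull (fun v hv => hv.2) hp
  have h2 : y ⬝ᵥ q < M := dot_lt_of_convexHull (fun v hv => hv.2) hq
  rw [dotProduct_add, dotProduct_smul, dotProduct_smul, h1, smul_eq_mul, smul_eq_mul] at hxM
  have hb0 : b = 0 := by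
    have : b * (M - y ⬝ᵥ q) = 0 := by
      have : a = 1 - b := by linarith
      subst this; linarith
    rcases mul_eq_zero.1 this with h | h
    · exact h
    · linarith
  have ha1 : a = 1 := by linarith
  rw [hb0, ha1, one_smul, zero_smul, add_zero]
  exact hp

theorem maxFace_convexHull_eq_singleton {I : Type} [Fintype I] {V : Set (I → ℝ)} {v y : I → ℝ}
    (hv : v ∈ V) (h : ∀ x ∈ V, x ≠ v → y ⬝ᵥ x < y ⬝ᵥ v) : {v} = maxFace (convexHull ℝ V) y := by
  have hle : ∀ x ∈ V, y ⬝ᵥ x ≤ y ⬝ᵥ v := fun x hx => by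
    rcases eq_or_ne x v with rfl | hne
    · exact le_rfl
    · exact (h x hx hne).le
  have hvP := subset_convexHull ℝ V hv
  rw [eq_comm, Set.eq_singleton_iff_unique_mem]
  refine ⟨⟨hvP, fun z hz => dot_le_of_convexHull hle hz⟩, fun x hx => ?_⟩
  have := mem_convexHull_of_dot_eq hle hx.1
    (le_antisymm (dot_le_of_convexHull hle hx.1) (hx.2 v hvP))
  have hsub : {w ∈ V | y ⬝ᵥ w = y ⬝ᵥ v} ⊆ {v} := by
    rintro w ⟨hw, he⟩
    by_contra hne
    exact (h w hw hne).ne he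
  have := convexHull_mono hsub this
  rwa [convexHull_singleton] at this

theorem vertices_convexHull_subset {I : Type} [Fintype I] {V : Set (I → ℝ)} (hf : V.Finite) :
    vertices (convexHull ℝ V) ⊆ V := by
  rintro v ⟨_, y, hy⟩
  have hv : v ∈ maxFace (convexHull ℝ V) y := hy ▸ rfl
  obtain ⟨x, hx, hxm⟩ := exists_mem_maxFace hf (convexHull_nonempty_iff.1 ⟨v, hv.1⟩) y
  rw [← hy] at hxm
  obtain rfl : x = v := hxm
  exact hx

theorem exists_dot_eq {I : Type} [Fintype I] (f : StrongDual ℝ (I → ℝ)) :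
    ∃ u : I → ℝ, ∀ x, f x = u ⬝ᵥ x := by
  classical
  refine ⟨fun i => f (Pi.single i 1), fun x => ?_⟩
  conv_lhs => rw [pi_eq_sum_univ' x]
  rw [map_sum, dotProduct]
  refine Finset.sum_congr rfl fun i _ => ?_
  rw [map_smul, smul_eq_mul, mul_comm]

/-- A finite set contains a subset of convexly independent points with the same convex hull. -/
theorem exists_convexIndependent_subset {E : Type*} [AddCommGroup E] [Module ℝ E] {V : Set E}
    (hf : V.Finite) : ∃ W ⊆ V, V ⊆ convexHull ℝ W ∧ ∀ d ∈ W, d ∉ convexHull ℝ (W \ {d}) := by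
  obtain ⟨W, hW⟩ := (hf.finite_subsets.subset (fun W (hW : W ⊆ V ∧ V ⊆ convexHull ℝ W) => hW.1)
    : {W | W ⊆ V ∧ V ⊆ convexHull ℝ W}.Finite).exists_minimal
      ⟨V, subset_rfl, subset_convexHull ℝ V⟩
  refine ⟨W, hW.prop.1, hW.prop.2, fun d hd hd' => ?_⟩
  have hsub : W ⊆ convexHull ℝ (W \ {d}) := by
    intro x hx
    by_cases hxd : x = d
    · rwa [hxd]
    · exact subset_convexHull ℝ _ ⟨hx, hxd⟩
  have := hW.le_of_le (y := W \ {d}) ⟨Set.sdiff_subset.trans hW.prop.1,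
    hW.prop.2.trans (convexHull_min hsub (convex_convexHull ℝ _))⟩ Set.sdiff_subset
  exact (this hd).2 rfl

/-- The tangent cone at a vertex contains the directions to all points of the polytope: an edge
cone contains the whole polytope. The directions to the points of `V`, scaled to lie in an affine
hyperplane, are convex combinations of convexly independent ones among them; each of those is
separated from the others by a functional, which exposes an edge of the polytope. -/
theorem sub_mem_tangentCone {I : Type} [Fintype I] {P : Set (I → ℝ)} (hP : IsPolytope P)
    {v w : I → ℝ} (hv : v ∈ vertices P) (hw : w ∈ P) : w - v ∈ tangentCone P v := by
  obtain ⟨V, hf, -, rfl⟩ := hP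
  have hvV := vertices_convexHull_subset hf hv
  have hvP := subset_convexHull ℝ V hvV
  obtain ⟨-, y, hy⟩ := hv
  -- `h x` is the amount by which `y` drops from `v` to `x`, `dir x` the scaled direction
  let h : (I → ℝ) → ℝ := fun x => y ⬝ᵥ v - y ⬝ᵥ x
  have hpos : ∀ x ∈ V, x ≠ v → 0 < h x := fun x hx hne =>
    sub_pos.2 (mem_maxFace_singleton hy (subset_convexHull ℝ V hx) hne)
  let dir : (I → ℝ) → I → ℝ := fun x => (h x)⁻¹ • (x - v)
  have hdir : ∀ x ∈ V, x ≠ v → x - v = h x • dir x := fun x hx hne => by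
    rw [smul_smul, mul_inv_cancel₀ (hpos x hx hne).ne', one_smul]
  have hydir : ∀ x ∈ V, x ≠ v → y ⬝ᵥ dir x = -1 := fun x hx hne => by
    have : h x ≠ 0 := (hpos x hx hne).ne'
    change y ⬝ᵥ ((h x)⁻¹ • (x - v)) = -1
    rw [dotProduct_smul, dotProduct_sub, smul_eq_mul, inv_mul_eq_iff_eq_mul₀ this]
    simp only [h]; ring
  obtain ⟨W, hWV, hVW, hind⟩ :=
    exists_convexIndependent_subset ((hf.subset (Set.sdiff_subset (t := {v}))).image dir)
  have hyW : ∀ e ∈ W, y ⬝ᵥ e = -1 := fun e he => by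
    obtain ⟨x, hx, rfl⟩ := hWV he
    exact hydir x hx.1 hx.2
  -- each of the convexly independent directions is the direction of an edge
  have hedge : ∀ d ∈ W, d ∈ tangentCone (convexHull ℝ V) v := by
    intro d hd
    have hWf : (W \ {d}).Finite :=
      ((hf.subset Set.sdiff_subset).image dir).subset (Set.sdiff_subset.trans hWV)
    obtain ⟨f, s, hs, hsd⟩ := geometric_hahn_banach_closed_point
      (convex_convexHull ℝ (W \ {d})) (hWf.isClosed_convexHull ℝ) (hind d hd)
    obtain ⟨u, hu⟩ := exists_dot_eq f
    let z : I → ℝ := u + (u ⬝ᵥ d) • y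
    have hzW : ∀ e ∈ W, e ≠ d → z ⬝ᵥ e < 0 := by
      intro e he hne
      have := hs e (subset_convexHull ℝ _ ⟨he, hne⟩)
      rw [hu] at this hsd
      rw [add_dotProduct, smul_dotProduct, hyW e he, smul_eq_mul]
      linarith
    have hzd : z ⬝ᵥ d = 0 := by
      rw [add_dotProduct, smul_dotProduct, hyW d hd, smul_eq_mul]; ring
    have hzW' : ∀ e ∈ W, z ⬝ᵥ e ≤ 0 := fun e he => by
      rcases eq_or_ne e d with rfl | hne
      · exact hzd.le
      · exact (hzW e he hne).le
    have hzV : ∀ x ∈ V, z ⬝ᵥ x ≤ z ⬝ᵥ v ∧ (z ⬝ᵥ x = z ⬝ᵥ v → x ≠ v → dir x = d) := by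
      intro x hx
      rcases eq_or_ne x v with rfl | hne
      · exact ⟨le_rfl, fun _ h => absurd rfl h⟩
      have hp := hpos x hx hne
      have hm : dir x ∈ convexHull ℝ W := hVW ⟨x, ⟨hx, hne⟩, rfl⟩
      have e1 : z ⬝ᵥ x - z ⬝ᵥ v = h x * (z ⬝ᵥ dir x) := by
        rw [← dotProduct_sub, hdir x hx hne, dotProduct_smul, smul_eq_mul]
      have e2 := dot_le_of_convexHull hzW' hm
      refine ⟨by nlinarith, fun he _ => ?_⟩
      rw [he, sub_self, eq_comm, mul_eq_zero, or_iff_right hp.ne'] at e1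
      have := mem_convexHull_of_dot_eq hzW' hm e1
      have hsub : {e ∈ W | z ⬝ᵥ e = 0} ⊆ {d} := by
        rintro e ⟨he, h0⟩
        by_contra hne
        exact (hzW e he hne).ne h0
      have := convexHull_mono hsub this
      rwa [convexHull_singleton] at this
    obtain ⟨x₀, ⟨hx₀, hne₀⟩, hd₀⟩ := hWV hd
    -- the other end of the edge is the farthest point of `V` in the direction `d`
    obtain ⟨w, ⟨hwV, hwne, hwd⟩, hwmax⟩ := Set.exists_max_image {x ∈ V | x ≠ v ∧ dir x = d} h
      (hf.subset fun x hx => hx.1) ⟨x₀, hx₀, hne₀, hd₀⟩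
    have hwv : w - v = h w • d := by rw [← hwd]; exact hdir w hwV hwne
    have hseg : segment ℝ v w = maxFace (convexHull ℝ V) z := by
      apply Set.Subset.antisymm
      · have hc : ∀ x ∈ segment ℝ v w, z ⬝ᵥ x = z ⬝ᵥ v := by
          intro x hx
          rw [segment_eq_image'] at hx
          obtain ⟨t, -, rfl⟩ := hx
          change z ⬝ᵥ (v + t • (w - v)) = _
          rw [hwv, dotProduct_add, dotProduct_smul, dotProduct_smul, hzd, smul_zero, smul_zero,
            add_zero]
        intro x hx
        refine ⟨(convex_convexHull ℝ V).segment_subset hvP (subset_convexHull ℝ V hwV) hx,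
          fun p hp => ?_⟩
        rw [hc x hx]
        exact dot_le_of_convexHull (fun x hx => (hzV x hx).1) hp
      · intro x hx
        have hle := dot_le_of_convexHull (fun x hx => (hzV x hx).1) hx.1
        have := mem_convexHull_of_dot_eq (fun x hx => (hzV x hx).1) hx.1
          (le_antisymm hle (hx.2 v hvP))
        refine convexHull_min ?_ (convex_segment v w) this
        rintro p ⟨hp, hpz⟩
        rcases eq_or_ne p v with rfl | hne
        · exact left_mem_segment ℝ p w
        have hpd := (hzV p hp).2 hpz hne
        have hpv : p - v = h p • d := by rw [← hpd]; exact hdir p hp hne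
        have h1 := hwmax p ⟨hp, hne, hpd⟩
        have h2 := hpos w hwV hwne
        rw [segment_eq_image']
        refine ⟨h p / h w, ⟨div_nonneg (hpos p hp hne).le h2.le, (div_le_one h2).2 h1⟩, ?_⟩
        change v + (h p / h w) • (w - v) = p
        rw [hwv, smul_smul, div_mul_cancel₀ _ h2.ne', ← hpv, add_sub_cancel]
    have hmem : w - v ∈ tangentCone (convexHull ℝ V) v :=
      Submodule.subset_span ⟨w, hwne, ⟨⟨v, left_mem_segment ℝ v w⟩, z, hseg⟩, rfl⟩
    have : d = (⟨(h w)⁻¹, inv_nonneg.2 (hpos w hwV hwne).le⟩ : {x : ℝ // 0 ≤ x}) • (w - v) := by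
      change d = (h w)⁻¹ • (w - v)
      rw [hwv, smul_smul, inv_mul_cancel₀ (hpos w hwV hwne).ne', one_smul]
    rw [this]
    exact Submodule.smul_mem _ _ hmem
  have hW : convexHull ℝ W ⊆ tangentCone (convexHull ℝ V) v :=
    convexHull_min hedge (PointedCone.convex _)
  have hconv : Convex ℝ {x | x - v ∈ tangentCone (convexHull ℝ V) v} := by
    intro a ha b hb s t hs ht hst
    have e : s • a + t • b - v = s • (a - v) + t • (b - v) := by
      rw [smul_sub, smul_sub, sub_add_sub_comm, ← add_smul, hst, one_smul]
    change s • a + t • b - v ∈ tangentCone (convexHull ℝ V) v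
    rw [e]
    exact PointedCone.convex _ ha hb hs ht hst
  refine convexHull_min (fun x hx => ?_) hconv hw
  change x - v ∈ tangentCone (convexHull ℝ V) v
  rcases eq_or_ne x v with rfl | hne
  · rw [sub_self]; exact Submodule.zero_mem _
  rw [hdir x hx hne]
  exact Submodule.smul_mem _ (⟨h x, (hpos x hx hne).le⟩ : {x : ℝ // 0 ≤ x})
    (hW (hVW ⟨x, ⟨hx, hne⟩, rfl⟩))

theorem tangentCone_le_of_forall_sub_mem {I : Type} [Fintype I] {P : Set (I → ℝ)} {v : I → ℝ}
    {C : PointedCone ℝ (I → ℝ)} (h : ∀ w ∈ P, w - v ∈ C) : tangentCone P v ≤ C := by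
  refine Submodule.span_le.2 ?_
  rintro _ ⟨w, -, hF, rfl⟩
  exact h w (hF.subset (right_mem_segment ℝ v w))

/-! ### Vertex posets of products -/

/-- A functional which is constant on the polytope vanishes on its tangent cones. -/
theorem dot_eq_zero_of_mem_tangentCone {I : Type} [Fintype I] {P : Set (I → ℝ)} {u v d : I → ℝ}
    {M : ℝ} (h : ∀ x ∈ P, u ⬝ᵥ x = M) (hv : v ∈ P) (hd : d ∈ tangentCone P v) : u ⬝ᵥ d = 0 := by
  refine Submodule.span_induction ?_ (dotProduct_zero u) ?_ ?_ hd
  · rintro _ ⟨w, -, hF, rfl⟩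
    rw [dotProduct_sub, h w (hF.subset (right_mem_segment ℝ v w)), h v hv, sub_self]
  · intro a b _ _ ha hb
    rw [dotProduct_add, ha, hb, add_zero]
  · rintro ⟨t, ht⟩ x _ hx
    change u ⬝ᵥ (t • x) = 0
    rw [dotProduct_smul, hx, smul_zero]

/-- In a product of polytopes with constant coordinate sums, elements of different blocks are
incomparable in every vertex poset. -/
theorem block_eq_of_vertexPoset_le {I : Type} [Fintype I] {k : ℕ} {c : I → Fin k}
    {P : ∀ j, Set ({i // c i = j} → ℝ)} (hP : ∀ j, ∃ M : ℝ, ∀ x ∈ P j, 1 ⬝ᵥ x = M)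
    (v : vertices (prodPolytope c P)) {a b : I} (hab : (vertexPoset _ v).le a b) : c a = c b := by
  classical
  by_contra hne
  let u : I → ℝ := fun i => if c i = c b then 1 else 0
  obtain ⟨M, hM⟩ := hP (c b)
  have hu : ∀ x ∈ prodPolytope c P, u ⬝ᵥ x = M := by
    intro x hx
    rw [← hM _ (hx (c b))]
    simp only [dotProduct, u, ite_mul, one_mul, zero_mul, Pi.one_apply]
    rw [← Finset.sum_filter, ← Finset.sum_subtype_eq_sum_filter]
    exact Finset.sum_congr (by ext; simp) fun _ _ => rfl
  have := dot_eq_zero_of_mem_tangentCone hu (IsFace.subset v.2 rfl) hab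
  rw [dotProduct_sub, dot_basisVec, dot_basisVec] at this
  simp [u, hne] at this

/-- If a vertex poset of a product is connected, the product has only one nontrivial factor. -/
theorem exists_block_of_isConnectedPoset {I : Type} [Fintype I] {k : ℕ} {c : I → Fin k}
    {P : ∀ j, Set ({i // c i = j} → ℝ)} (hP : ∀ j, ∃ M : ℝ, ∀ x ∈ P j, 1 ⬝ᵥ x = M)
    {α : Type} [PartialOrder α] (hα : IsConnectedPoset α)
    (h : vertexCount (prodPolytope c P) α ≠ 0) : ∃ j, ∀ i, c i = j := by
  obtain ⟨v, e, he⟩ := exists_vertex_of_vertexCount_ne_zero h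
  obtain ⟨⟨a₀⟩, hc⟩ := hα
  refine ⟨c (e.symm a₀), fun i => ?_⟩
  have hle : ∀ {a b}, a ≤ b → c (e.symm a) = c (e.symm b) := fun {a b} hab =>
    block_eq_of_vertexPoset_le hP v (by rwa [he, e.apply_symm_apply, e.apply_symm_apply])
  rcases hc {a | c (e.symm a) = c (e.symm a₀)}
    fun a ha b hb => ⟨fun h => hb ((hle h).symm.trans ha), fun h => hb ((hle h).trans ha)⟩
    with h0 | h0
  · exact absurd (show a₀ ∈ (∅ : Set α) from h0 ▸ rfl) id
  · have : e i ∈ {a | c (e.symm a) = c (e.symm a₀)} := h0 ▸ Set.mem_univ _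
    simpa using this

theorem prodPolytope_eq_relabelSet {I : Type} {k : ℕ} {c : I → Fin k}
    {P : ∀ j, Set ({i // c i = j} → ℝ)} (hP : ∀ j, (P j).Nonempty) {j : Fin k}
    (hj : ∀ i, c i = j) :
    prodPolytope c P = relabelSet (Equiv.subtypeUnivEquiv hj) (P j) := by
  ext x
  refine ⟨fun hx => hx j, fun hx j' => ?_⟩
  by_cases hjj : j' = j
  · subst hjj; exact hx
  · obtain ⟨z, hz⟩ := hP j'
    have : (fun i : {i // c i = j'} => x i.1) = z :=
      funext fun i => absurd (i.2.symm.trans (hj i.1)) hjj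
    rwa [this]

theorem mk_eq_mk_of_relabelSet {n : ℕ} {P Q : GenPerm (Fin n)} (σ : Fin n ≃ Fin n)
    (h : Q.carrier = relabelSet σ P.carrier) :
    IsoClass.mk gpSpecies (Quotient.mk _ Q) = IsoClass.mk gpSpecies (Quotient.mk _ P) := by
  rw [← IsoClass.mk_map gpSpecies σ (Quotient.mk _ P)]
  refine congrArg _ (Quotient.sound ?_)
  change normalFan Q.carrier = normalFan (relabelSet σ P.carrier)
  rw [h]

/-! ### Orbit polytopes -/

theorem orbitPolytope_const {n : ℕ} (lam : Composition n) (I : Type) [Fintype I] :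
    ∃ M : ℝ, ∀ x ∈ orbitPolytope lam I, 1 ⬝ᵥ x = M := by
  refine ⟨∑ i, compositionPoint lam i, fun x hx => dot_eq_of_convexHull ?_ hx⟩
  rintro _ ⟨f, rfl⟩
  simp only [dotProduct, Pi.one_apply, one_mul]
  exact Equiv.sum_comp f _

theorem relabelSet_orbitPolytope {n : ℕ} (lam : Composition n) {I J : Type} (σ : I ≃ J) :
    relabelSet σ (orbitPolytope lam I) = orbitPolytope lam J := by
  rw [orbitPolytope, relabelSet_convexHull, orbitPolytope]
  congr 1
  ext x
  constructor
  · rintro ⟨f, hf⟩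
    refine ⟨σ.symm.trans f, ?_⟩
    ext j
    simpa using congrFun hf (σ.symm j)
  · rintro ⟨f, rfl⟩
    exact ⟨σ.trans f, rfl⟩

theorem orbitPolytope_nonempty {n : ℕ} (lam : Composition n) {I : Type} (e : I ≃ Fin n) :
    (orbitPolytope lam I).Nonempty :=
  ⟨_, subset_convexHull ℝ _ ⟨e, rfl⟩⟩

/-- All arrangements have the same norm, so each is the unique maximum on the orbit polytope of
the functional which it defines. -/
theorem maxFace_orbitPolytope {n : ℕ} (lam : Composition n) (f : Fin n ≃ Fin n) :
    {compositionPoint lam ∘ f} =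
      maxFace (orbitPolytope lam (Fin n)) (compositionPoint lam ∘ f) := by
  refine maxFace_convexHull_eq_singleton ⟨f, rfl⟩ ?_
  rintro _ ⟨g, rfl⟩ hne
  set x := compositionPoint lam ∘ f
  change compositionPoint lam ∘ g ≠ x at hne
  change x ⬝ᵥ (compositionPoint lam ∘ g) < _
  set z := compositionPoint lam ∘ g
  have h1 : x ⬝ᵥ x = z ⬝ᵥ z := by
    rw [dot_comp f, dot_comp g]
  have h2 : 0 < (z - x) ⬝ᵥ (z - x) :=
    lt_of_le_of_ne (Finset.sum_nonneg fun i _ => mul_self_nonneg _)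
      fun h0 => sub_ne_zero.2 hne (dotProduct_self_eq_zero.1 h0.symm)
  rw [dotProduct_sub, sub_dotProduct, sub_dotProduct, dotProduct_comm z x] at h2
  linarith

theorem vertices_orbitPolytope {n : ℕ} (lam : Composition n) :
    vertices (orbitPolytope lam (Fin n)) =
      Set.range fun f : Fin n ≃ Fin n => compositionPoint lam ∘ f := by
  apply Set.Subset.antisymm
  · exact vertices_convexHull_subset (Set.finite_range _)
  · rintro _ ⟨f, rfl⟩
    exact ⟨Set.singleton_nonempty _, _, maxFace_orbitPolytope lam f⟩

/-- The vertex posets of an orbit polytope are layered, with the largest coordinates at the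
bottom. -/
theorem vertexPoset_orbitPolytope_le {n : ℕ} (lam : Composition n)
    (v : vertices (orbitPolytope lam (Fin n))) (i j : Fin n) :
    (vertexPoset _ v).le j i ↔ i = j ∨ v.1 i < v.1 j := by
  obtain ⟨v, hv⟩ := v
  obtain ⟨f, rfl⟩ := vertices_orbitPolytope lam ▸ hv
  change basisVec i - basisVec j ∈ tangentCone _ _ ↔ _
  constructor
  · intro h
    rcases tangentCone_dot (maxFace_orbitPolytope lam f) h with h | h
    · exact Or.inl (basisVec_injective (sub_eq_zero.1 h))
    · rw [dotProduct_sub, dot_basisVec, dot_basisVec, sub_neg] at h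
      exact Or.inr h
  · rintro (rfl | h)
    · rw [sub_self]; exact Submodule.zero_mem _
    have hw : compositionPoint lam ∘ (Equiv.swap i j).trans f ∈ orbitPolytope lam (Fin n) :=
      subset_convexHull ℝ _ ⟨_, rfl⟩
    have hm := sub_mem_tangentCone (orbitPolytope_isPolytope lam) hv hw
    set x : Fin n → ℝ := fun i => compositionPoint lam (f i)
    have h : x i < x j := h
    have e : compositionPoint lam ∘ (Equiv.swap i j).trans f - x =
        (x j - x i) • (basisVec i - basisVec j) := by
      have hne : i ≠ j := fun he => by rw [he] at h; exact lt_irrefl _ h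
      ext l
      change x (Equiv.swap i j l) - x l = (x j - x i) * (basisVec i l - basisVec j l)
      by_cases hi : l = i
      · subst hi
        rw [Equiv.swap_apply_left, basisVec_self, basisVec_ne hne]; ring
      · by_cases hj : l = j
        · subst hj
          rw [Equiv.swap_apply_right, basisVec_self, basisVec_ne hi]; ring
        · rw [Equiv.swap_apply_of_ne_of_ne hi hj, basisVec_ne hi, basisVec_ne hj]; ring
    change compositionPoint lam ∘ (Equiv.swap i j).trans f - x ∈ _ at hm
    rw [e] at hm
    have hp : 0 < x j - x i := sub_pos.2 h
    have := Submodule.smul_mem _ (⟨(x j - x i)⁻¹, inv_nonneg.2 hp.le⟩ : {x : ℝ // 0 ≤ x}) hm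
    change (x j - x i)⁻¹ • (x j - x i) • (basisVec i - basisVec j) ∈ _ at this
    rwa [smul_smul, inv_mul_cancel₀ hp.ne', one_smul] at this

theorem isoPoset_vertexPoset_orbitPolytope {n : ℕ} (lam : Composition n)
    (v : vertices (orbitPolytope lam (Fin n))) :
    IsoPoset (vertexPoset _ v) (LayeredPoset lam) := by
  obtain ⟨f, hf⟩ : v.1 ∈ Set.range fun f : Fin n ≃ Fin n => compositionPoint lam ∘ f := by
    rw [← vertices_orbitPolytope]; exact v.2
  refine ⟨f.trans lam.blocksFinEquiv.symm, fun a b => ?_⟩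
  rw [vertexPoset_orbitPolytope_le, ← hf]
  change _ ↔ (f.trans lam.blocksFinEquiv.symm) a = (f.trans lam.blocksFinEquiv.symm) b ∨
    lam.index (f a) < lam.index (f b)
  rw [(f.trans lam.blocksFinEquiv.symm).apply_eq_iff_eq, eq_comm]
  refine or_congr Iff.rfl ?_
  simp only [Function.comp_apply, compositionPoint, sub_lt_sub_iff_left, Nat.cast_lt]
  exact Fin.lt_def.symm

/-- The arrangements of the point of a composition are permuted transitively, with stabilizers the
products of the symmetric groups of the levels. -/
theorem card_vertices_orbitPolytope {n : ℕ} (lam : Composition n) :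
    Nat.card (vertices (orbitPolytope lam (Fin n))) * ∏ i, (lam.blocksFun i)! = n ! := by
  classical
  have hcomp : ∀ f g : Fin n ≃ Fin n, compositionPoint lam ∘ f = compositionPoint lam ∘ g ↔
      lam.index ∘ f = lam.index ∘ g := by
    intro f g
    simp only [funext_iff, Function.comp_apply, compositionPoint, sub_right_inj, Nat.cast_inj,
      Fin.val_inj]
  have hcard : ∀ i, Fintype.card {a // lam.index a = i} = lam.blocksFun i := by
    intro i
    rw [← Fintype.card_fin (lam.blocksFun i)]
    refine Fintype.card_congr ⟨fun a => a.2 ▸ lam.invEmbedding a.1,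
      fun j => ⟨lam.embedding i j, lam.index_embedding i j⟩, ?_, ?_⟩
    · rintro ⟨a, rfl⟩
      exact Subtype.ext (lam.embedding_comp_inv a)
    · intro j
      have key : ∀ i' (h : i' = i) (x : Fin (lam.blocksFun i')), (x : ℕ) = j →
          (h ▸ x : Fin (lam.blocksFun i)) = j := by
        rintro _ rfl x hx; exact Fin.ext hx
      exact key _ _ _ (lam.invEmbedding_comp i j)
  have hstab := DomMulAct.stabilizer_card lam.index
  simp only [hcard] at hstab
  rw [← hstab, vertices_orbitPolytope, ← Nat.card_eq_fintype_card, ← Nat.card_prod]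
  have hn : Nat.card (Equiv.Perm (Fin n)) = n ! := by
    rw [Nat.card_eq_fintype_card, Fintype.card_perm, Fintype.card_fin]
  rw [← hn]
  -- permutations with the same arrangement differ by a permutation preserving the levels
  choose s hs using fun x : Set.range fun f : Fin n ≃ Fin n => compositionPoint lam ∘ f => x.2
  have hs' : ∀ (x : Set.range fun f : Fin n ≃ Fin n => compositionPoint lam ∘ f),
    compositionPoint lam ∘ s x = x.1 := hs
  refine Nat.card_congr (Equiv.ofBijective
    (fun p => (s p.1).trans p.2.1) ⟨?_, fun f => ?_⟩)
  · rintro ⟨x, g, hg⟩ ⟨x', g', hg'⟩ h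
    have hx : ∀ (x : Set.range fun f : Fin n ≃ Fin n => compositionPoint lam ∘ f)
        (g : Equiv.Perm (Fin n)), lam.index ∘ g = lam.index →
        compositionPoint lam ∘ ((s x).trans g) = x.1 := by
      intro x g hg
      rw [← hs' x, hcomp, Equiv.coe_trans, ← Function.comp_assoc, hg]
    have : x = x' := Subtype.ext (by
      rw [← hx x g hg, ← hx x' g' hg']; exact congrArg (fun f : Fin n ≃ Fin n => _ ∘ f) h)
    subst this
    have : g = g' := by
      ext a
      have := DFunLike.congr_fun h ((s x).symm a)
      simpa using congrArg Fin.val this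
    subst this
    rfl
  · let x : Set.range fun f : Fin n ≃ Fin n => compositionPoint lam ∘ f := ⟨_, f, rfl⟩
    refine ⟨⟨x, (s x).symm.trans f, ?_⟩, by ext; simp⟩
    have := (hcomp _ _).1 (hs' x)
    rw [Equiv.coe_trans, ← Function.comp_assoc, ← this, Function.comp_assoc]
    simp

/-- An isomorphism of layered posets preserves the levels, as the level is the height. -/
theorem level_le_of_orderIso {m n : ℕ} {mu : Composition m} {lam : Composition n}
    (e : LayeredPoset mu ≃o LayeredPoset lam) (i : ℕ) :
    ∀ a : LayeredPoset mu, (a.1 : ℕ) = i → i ≤ (e a).1 := by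
  induction i with
  | zero => exact fun _ _ => Nat.zero_le _
  | succ i ih =>
    intro a ha
    let i' : Fin mu.length := ⟨i, by have := a.1.2; omega⟩
    let b : LayeredPoset mu := ⟨i', ⟨0, mu.one_le_blocksFun i'⟩⟩
    have hlt : b.1 < a.1 := Fin.lt_def.2 (by rw [ha]; exact Nat.lt_succ_self i)
    have hle : b ≤ a := Or.inr hlt
    rcases (e.le_iff_le.2 hle : e b = e a ∨ (e b).1 < (e a).1) with h | h
    · rw [e.injective h] at hlt
      exact absurd hlt (lt_irrefl _)
    · exact (ih b rfl).trans_lt h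

theorem level_orderIso {m n : ℕ} {mu : Composition m} {lam : Composition n}
    (e : LayeredPoset mu ≃o LayeredPoset lam) (a : LayeredPoset mu) :
    ((e a).1 : ℕ) = a.1 := by
  refine le_antisymm ?_ (level_le_of_orderIso e _ a rfl)
  have := level_le_of_orderIso e.symm _ (e a) rfl
  rwa [e.symm_apply_apply] at this

theorem length_le_of_orderIso {m n : ℕ} {mu : Composition m} {lam : Composition n}
    (e : LayeredPoset mu ≃o LayeredPoset lam) : mu.length ≤ lam.length := by
  by_contra! h
  let i : Fin mu.length := ⟨lam.length, h⟩
  have := level_orderIso e ⟨i, ⟨0, mu.one_le_blocksFun i⟩⟩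
  have h2 := (e ⟨i, ⟨0, mu.one_le_blocksFun i⟩⟩).1.2
  rw [this] at h2
  exact lt_irrefl _ h2

theorem blocksFun_le_of_orderIso {m n : ℕ} {mu : Composition m} {lam : Composition n}
    (e : LayeredPoset mu ≃o LayeredPoset lam) (i : ℕ) (h : i < mu.length) (h' : i < lam.length) :
    mu.blocksFun ⟨i, h⟩ ≤ lam.blocksFun ⟨i, h'⟩ := by
  have hl : ∀ j : Fin (mu.blocksFun ⟨i, h⟩), ∃ j', e ⟨⟨i, h⟩, j⟩ = ⟨⟨i, h'⟩, j'⟩ := by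
    intro j
    have := level_orderIso e ⟨⟨i, h⟩, j⟩
    rcases he : e ⟨⟨i, h⟩, j⟩ with ⟨l, j'⟩
    rw [he] at this
    obtain rfl : l = ⟨i, h'⟩ := Fin.ext this
    exact ⟨j', rfl⟩
  choose g hg using hl
  have hinj : Function.Injective g := fun j₁ j₂ hj => by
    have := e.injective ((hg j₁).trans ((congrArg _ hj).trans (hg j₂).symm))
    exact eq_of_heq (Sigma.mk.inj this).2
  simpa using Fintype.card_le_of_injective g hinj

theorem blocks_eq_of_orderIso {m n : ℕ} {mu : Composition m} {lam : Composition n}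
    (e : LayeredPoset mu ≃o LayeredPoset lam) : mu.blocks = lam.blocks := by
  have hlen : mu.length = lam.length :=
    le_antisymm (length_le_of_orderIso e) (length_le_of_orderIso e.symm)
  refine List.ext_getElem hlen fun i h h' => ?_
  exact le_antisymm (blocksFun_le_of_orderIso e i h h') (blocksFun_le_of_orderIso e.symm i h' h)

theorem orbitPolytope_eq_of_blocks_eq {m n : ℕ} {mu : Composition m} {lam : Composition n}
    (h : mu.blocks = lam.blocks) (I : Type) : orbitPolytope mu I = orbitPolytope lam I := by
  obtain rfl : m = n := by rw [← mu.blocks_sum, ← lam.blocks_sum, h]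
  rw [Composition.ext h]

theorem compositionPoint_ones {n : ℕ} (j : Fin n) :
    compositionPoint (Composition.ones n) j = (j.rev : ℕ) + 1 := by
  have h1 := (Composition.ones n).lt_sizeUpTo_index_succ j
  have h2 := (Composition.ones n).sizeUpTo_index_le j
  rw [Composition.ones_sizeUpTo] at h1 h2
  have hj := j.2
  have h3 : ((Composition.ones n).index j : ℕ) = j := by
    rw [Fin.val_succ] at h1
    omega
  rw [compositionPoint, h3, Composition.ones_length, Fin.val_rev, sub_eq_iff_eq_add]
  norm_cast
  omega

theorem permutahedron_eq_orbitPolytope (I : Type) [Fintype I] :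
    permutahedron I = orbitPolytope (Composition.ones (Fintype.card I)) I := by
  rw [permutahedron, orbitPolytope]
  congr 1
  ext x
  constructor
  · rintro ⟨f, rfl⟩
    refine ⟨f.trans Fin.revPerm, funext fun i => ?_⟩
    simp [compositionPoint_ones]
  · rintro ⟨f, rfl⟩
    refine ⟨f.trans Fin.revPerm, funext fun i => ?_⟩
    simp [compositionPoint_ones]

/-! ### Vertices of Minkowski sums -/

theorem maxFace_sum_eq_singleton {I T : Type} [Fintype I] [Fintype T] {P : T → Set (I → ℝ)}
    {y : I → ℝ} {v : T → I → ℝ} (h : ∀ t, {v t} = maxFace (P t) y) :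
    {∑ t, v t} = maxFace (∑ t, P t) y := by
  have hv : ∀ t, v t ∈ maxFace (P t) y := fun t => h t ▸ rfl
  rw [eq_comm, Set.eq_singleton_iff_unique_mem]
  refine ⟨⟨Set.mem_finsetSum _ _ _ |>.2 ⟨v, fun {t} _ => (hv t).1, rfl⟩, fun z hz => ?_⟩,
    fun z hz => ?_⟩
  · obtain ⟨g, hg, rfl⟩ := (Set.mem_finsetSum _ _ _).1 hz
    rw [dotProduct_sum, dotProduct_sum]
    exact Finset.sum_le_sum fun t _ => (hv t).2 _ (hg (Finset.mem_univ t))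
  · obtain ⟨g, hg, rfl⟩ := (Set.mem_finsetSum _ _ _).1 hz.1
    have hle : ∀ t ∈ Finset.univ, y ⬝ᵥ g t ≤ y ⬝ᵥ v t := fun t ht => (hv t).2 _ (hg ht)
    have hge := hz.2 (∑ t, v t)
      ((Set.mem_finsetSum _ _ _).2 ⟨v, fun {t} _ => (hv t).1, rfl⟩)
    rw [dotProduct_sum, dotProduct_sum] at hge
    have heq := (Finset.sum_eq_sum_iff_of_le hle).1 (le_antisymm (Finset.sum_le_sum hle) hge)
    refine Finset.sum_congr rfl fun t ht => ?_
    by_contra hne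
    exact (mem_maxFace_singleton (h t) (hg ht) hne).ne (heq t ht)

/-- If a Minkowski sum has a unique maximum, so have the summands. -/
theorem dot_lt_of_maxFace_sum {I T : Type} [Fintype I] [Fintype T] {P : T → Set (I → ℝ)}
    {y v : I → ℝ} (h : {v} = maxFace (∑ t, P t) y) :
    ∃ g : T → I → ℝ, (∀ t, g t ∈ P t) ∧ v = ∑ t, g t ∧
      ∀ t, ∀ x ∈ P t, x ≠ g t → y ⬝ᵥ x < y ⬝ᵥ g t := by
  classical
  have hv : v ∈ maxFace (∑ t, P t) y := h ▸ rfl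
  obtain ⟨g, hg, hgv⟩ := (Set.mem_finsetSum _ _ _).1 hv.1
  refine ⟨g, fun t => hg (Finset.mem_univ t), hgv.symm, fun t x hx hne => ?_⟩
  have e : ∑ s, Function.update g t x s = v + (x - g t) := by
    rw [Finset.sum_update_of_mem (Finset.mem_univ t), ← hgv,
      ← Finset.add_sum_erase _ g (Finset.mem_univ t), Finset.sdiff_singleton_eq_erase]
    abel
  have hm : v + (x - g t) ∈ ∑ s, P s := by
    rw [← e]
    refine (Set.mem_finsetSum _ _ _).2 ⟨_, fun {s} _ => ?_, rfl⟩
    rcases eq_or_ne s t with rfl | hs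
    · simpa using hx
    · rw [Function.update_of_ne hs]; exact hg (Finset.mem_univ s)
  have := mem_maxFace_singleton h hm fun he => hne (sub_eq_zero.1 (by simpa using he))
  rw [dotProduct_add, dotProduct_sub] at this
  linarith

/-! ### The vertices of associahedra -/

/-- The nonempty intervals of a linear order, given by their end points. -/
abbrev Intervals (L : Type) [LinearOrder L] : Type := {t : L × L // t.1 ≤ t.2}

theorem associahedron_eq_sum (L : Type) [Fintype L] [ℓ : LinearOrder L] :
    associahedron L ℓ = ∑ t : Intervals L, convexHull ℝ (basisVec '' Set.Icc t.1.1 t.1.2) :=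
  @Fintype.sum_equiv _ _ _ (_) (_) _ (Equiv.refl _) _ _ fun _ => rfl

theorem associahedron_const (I : Type) [Fintype I] (ℓ : LinearOrder I) :
    ∃ M : ℝ, ∀ x ∈ associahedron I ℓ, 1 ⬝ᵥ x = M := by
  refine ⟨∑ t : Intervals I, 1, fun x hx => ?_⟩
  rw [associahedron_eq_sum] at hx
  obtain ⟨g, hg, rfl⟩ := (Set.mem_finsetSum _ _ _).1 hx
  rw [dotProduct_sum]
  refine Finset.sum_congr rfl fun t ht => dot_eq_of_convexHull ?_ (hg ht)
  rintro _ ⟨i, -, rfl⟩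
  rw [dot_basisVec, Pi.one_apply]

theorem relabelSet_associahedron {I J : Type} [Fintype I] [Fintype J] [LinearOrder I]
    [LinearOrder J] (σ : I ≃o J) :
    relabelSet σ.toEquiv (associahedron I inferInstance) = associahedron J inferInstance := by
  rw [associahedron_eq_sum, associahedron_eq_sum, relabelSet_eq_image]
  have himage : ∀ (s : Finset (Intervals I)) (P : Intervals I → Set (I → ℝ)),
      LinearMap.funLeft ℝ ℝ σ.toEquiv.symm '' (∑ t ∈ s, P t) =
        ∑ t ∈ s, LinearMap.funLeft ℝ ℝ σ.toEquiv.symm '' P t := fun s P =>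
    Set.image_finsetSum _ _ _
  rw [himage]
  refine Fintype.sum_equiv ((σ.toEquiv.prodCongr σ.toEquiv).subtypeEquiv fun t => by simp) _ _
    fun t => ?_
  rw [← relabelSet_eq_image, relabelSet_convexHull, relabelSet_eq_image, Set.image_image]
  congr 1
  have : ∀ i, LinearMap.funLeft ℝ ℝ σ.toEquiv.symm (basisVec i) = basisVec (σ i) :=
    fun i => basisVec_comp σ.toEquiv i
  simp only [this]
  rw [← Set.image_image basisVec σ, OrderIso.image_Icc]
  rfl

/-- The relation `≤` of a partial order on a set which may carry another order. -/
abbrev leRel {L : Type} (p : PartialOrder L) : L → L → Prop := p.le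

/-- A partial order `le` on a linearly ordered set is a search order if it is the order of the
nodes of a binary search tree: every interval has a least element for it, and `a` is below `b` only
if it is below all elements between `a` and `b`. It is given as a relation, so that it cannot be
confused with the order on `L`. -/
def IsSearchOrder {L : Type} [LinearOrder L] (le : L → L → Prop) : Prop :=
  (∀ i j, i ≤ j → ∃ m ∈ Set.Icc i j, ∀ k ∈ Set.Icc i j, le m k) ∧
    ∀ a b, le a b → ∀ k ∈ Set.uIcc a b, le a k

/-- The least element of an interval for a search order. -/
noncomputable def IsSearchOrder.least {L : Type} [LinearOrder L] {le : L → L → Prop}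
    (hp : IsSearchOrder le) (t : Intervals L) : L :=
  (hp.1 t.1.1 t.1.2 t.2).choose

theorem IsSearchOrder.least_mem {L : Type} [LinearOrder L] {le : L → L → Prop}
    (hp : IsSearchOrder le) (t : Intervals L) : hp.least t ∈ Set.Icc t.1.1 t.1.2 :=
  (hp.1 t.1.1 t.1.2 t.2).choose_spec.1

theorem IsSearchOrder.least_le {L : Type} [LinearOrder L] {le : L → L → Prop}
    (hp : IsSearchOrder le) (t : Intervals L) {k : L} (hk : k ∈ Set.Icc t.1.1 t.1.2) :
    le (hp.least t) k :=
  (hp.1 t.1.1 t.1.2 t.2).choose_spec.2 k hk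

theorem exists_interval_eq_uIcc {L : Type} [LinearOrder L] (a b : L) :
    ∃ t : Intervals L, Set.Icc t.1.1 t.1.2 = Set.uIcc a b :=
  ⟨⟨(min a b, max a b), min_le_max⟩, rfl⟩

/-- The vertex of the associahedron given by a search order: the sum, over all intervals, of the
vertices of the simplices at their least elements. -/
noncomputable def IsSearchOrder.vertex {L : Type} [Fintype L] [LinearOrder L] {le : L → L → Prop}
    (hp : IsSearchOrder le) : L → ℝ := ∑ t, basisVec (hp.least t)

theorem IsSearchOrder.vertex_mem_vertices {L : Type} [Fintype L] {p : PartialOrder L}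
    [ℓ : LinearOrder L] (hp : IsSearchOrder (leRel p)) :
    hp.vertex ∈ vertices (associahedron L ℓ) := by
  -- minus the height is a functional strictly decreasing along `p`
  let y : L → ℝ := fun a => -({b | p.le b a}.ncard : ℝ)
  have hy : ∀ a b, p.le a b → b ≠ a → y b < y a := by
    intro a b hab hne
    refine neg_lt_neg (Nat.cast_lt.2 (Set.ncard_lt_ncard ?_ (Set.toFinite _)))
    refine ⟨fun c hc => p.le_trans _ _ _ hc hab, fun h => hne ?_⟩
    exact p.le_antisymm _ _ (h (p.le_refl b)) hab
  refine ⟨Set.singleton_nonempty _, y, ?_⟩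
  rw [associahedron_eq_sum]
  refine maxFace_sum_eq_singleton fun t => ?_
  refine maxFace_convexHull_eq_singleton ⟨_, hp.least_mem t, rfl⟩ ?_
  rintro _ ⟨k, hk, rfl⟩ hne
  rw [dot_basisVec, dot_basisVec]
  exact hy _ _ (hp.least_le t hk) fun h => hne (by rw [h])

/-- The summand of an interval can be moved from its least element to any other one, which gives the
generators of the cone of the order; conversely, all points of the sum arise by such moves. -/
theorem IsSearchOrder.vertexPoset_vertex {L : Type} [Fintype L] {p : PartialOrder L}
    [ℓ : LinearOrder L] (hp : IsSearchOrder (leRel p)) :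
    vertexPoset (associahedron L ℓ) ⟨hp.vertex, hp.vertex_mem_vertices⟩ = p := by
  classical
  refine vertexPoset_eq _ _ _ (le_antisymm (Submodule.span_le.2 ?_)
    (tangentCone_le_of_forall_sub_mem fun w hw => ?_))
  · rintro _ ⟨i, j, hij, rfl⟩
    obtain ⟨t, ht⟩ := exists_interval_eq_uIcc j i
    have hmin : hp.least t = j := p.le_antisymm _ _ (hp.least_le t (ht ▸ Set.left_mem_uIcc))
      (hp.2 j i hij _ (ht ▸ hp.least_mem t))
    -- move the summand of the interval between `i` and `j` from `e_j` to `e_i`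
    have hw : hp.vertex + (basisVec i - basisVec j) ∈ associahedron L ℓ := by
      have e : ∑ s, Function.update (fun s => basisVec (hp.least s)) t (basisVec i) s =
          hp.vertex + (basisVec i - basisVec j) := by
        rw [Finset.sum_update_of_mem (Finset.mem_univ t), IsSearchOrder.vertex,
          ← Finset.add_sum_erase _ _ (Finset.mem_univ t), Finset.sdiff_singleton_eq_erase, hmin]
        abel
      rw [← e, associahedron_eq_sum]
      refine (Set.mem_finsetSum _ _ _).2 ⟨_, fun {s} _ => ?_, rfl⟩
      rcases eq_or_ne s t with rfl | hs
      · rw [Function.update_self]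
        exact subset_convexHull ℝ _ ⟨i, ht ▸ Set.right_mem_uIcc, rfl⟩
      · rw [Function.update_of_ne hs]
        exact subset_convexHull ℝ _ ⟨_, hp.least_mem s, rfl⟩
    have := sub_mem_tangentCone (associahedron_isPolytope L ℓ) hp.vertex_mem_vertices hw
    rwa [add_sub_cancel_left] at this
  · rw [associahedron_eq_sum] at hw
    obtain ⟨g, hg, rfl⟩ := (Set.mem_finsetSum _ _ _).1 hw
    change ∑ t, g t - hp.vertex ∈ _
    rw [IsSearchOrder.vertex, ← Finset.sum_sub_distrib]
    refine Submodule.sum_mem _ fun t ht => ?_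
    have hconv : Convex ℝ {x | x - basisVec (hp.least t) ∈ posetCone p} := by
      intro a ha b hb r s hr hs hrs
      have e : r • a + s • b - basisVec (hp.least t) =
          r • (a - basisVec (hp.least t)) + s • (b - basisVec (hp.least t)) := by
        rw [smul_sub, smul_sub, sub_add_sub_comm, ← add_smul, hrs, one_smul]
      change r • a + s • b - basisVec (hp.least t) ∈ posetCone p
      rw [e]
      exact PointedCone.convex _ ha hb hr hs hrs
    refine convexHull_min ?_ hconv (hg ht)
    rintro _ ⟨k, hk, rfl⟩
    exact Submodule.subset_span ⟨k, hp.least t, hp.least_le t hk, rfl⟩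

/-- The search order of a functional with a unique maximum on every interval: `a` is below `b` if
it is the maximum on the interval between `a` and `b`. -/
@[reducible] def searchOrder {L : Type} [LinearOrder L] (y : L → ℝ) : PartialOrder L where
  le a b := ∀ k ∈ Set.uIcc a b, k ≠ a → y k < y a
  lt a b := (∀ k ∈ Set.uIcc a b, k ≠ a → y k < y a) ∧ ¬ ∀ k ∈ Set.uIcc b a, k ≠ b → y k < y b
  lt_iff_le_not_ge _ _ := Iff.rfl
  le_refl a k hk hne := absurd (by simpa using hk) hne
  le_trans a b c hab hbc k hk hne := by
    rcases Set.uIcc_subset_uIcc_union_uIcc (b := b) hk with h | h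
    · exact hab k h hne
    · rcases eq_or_ne b a with rfl | hb
      · exact hbc k h hne
      · have h1 := hab b Set.right_mem_uIcc hb
        rcases eq_or_ne k b with rfl | hkb
        · exact h1
        · exact (hbc k h hkb).trans h1
  le_antisymm a b hab hba := by
    by_contra hne
    exact lt_asymm (hab b Set.right_mem_uIcc (Ne.symm hne)) (hba a Set.right_mem_uIcc hne)

/-- A functional exposing a vertex of the sum exposes a vertex of each summand, so it has a unique
maximum on every interval. -/
theorem exists_searchOrder_of_vertex {L : Type} [Fintype L] [ℓ : LinearOrder L] {v : L → ℝ}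
    (hv : v ∈ vertices (associahedron L ℓ)) :
    ∃ (y : L → ℝ) (hp : IsSearchOrder (leRel (searchOrder y))), v = hp.vertex := by
  obtain ⟨-, y, hy⟩ := hv
  rw [associahedron_eq_sum] at hy
  obtain ⟨g, hg, rfl, hlt⟩ := dot_lt_of_maxFace_sum hy
  have hmax : ∀ t : Intervals L, ∃ m ∈ Set.Icc t.1.1 t.1.2, g t = basisVec m ∧
      ∀ k ∈ Set.Icc t.1.1 t.1.2, k ≠ m → y k < y m := by
    intro t
    obtain ⟨m, hm, hle⟩ := Set.exists_max_image (Set.Icc t.1.1 t.1.2) y (Set.toFinite _)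
      ⟨_, Set.left_mem_Icc.2 t.2⟩
    have hgt : y ⬝ᵥ g t ≤ y m := by
      refine dot_le_of_convexHull ?_ (hg t)
      rintro _ ⟨k, hk, rfl⟩
      rw [dot_basisVec]
      exact hle k hk
    have hgm : g t = basisVec m := by
      by_contra hne
      have := hlt t _ (subset_convexHull ℝ _ ⟨m, hm, rfl⟩) (Ne.symm hne)
      rw [dot_basisVec] at this
      exact this.not_ge hgt
    refine ⟨m, hm, hgm, fun k hk hne => ?_⟩
    have := hlt t _ (subset_convexHull ℝ _ ⟨k, hk, rfl⟩)
      (by rw [hgm]; exact fun h => hne (basisVec_injective h))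
    rwa [hgm, dot_basisVec, dot_basisVec] at this
  have hp : IsSearchOrder (leRel (searchOrder y)) := by
    constructor
    · intro i j hij
      obtain ⟨m, hm, -, hlt⟩ := hmax ⟨(i, j), hij⟩
      exact ⟨m, hm, fun k hk k' hk' hne => hlt k' (Set.OrdConnected.uIcc_subset
        Set.ordConnected_Icc hm hk hk') hne⟩
    · intro a b hab k hk k' hk' hne
      exact hab k' (Set.uIcc_subset_uIcc_left hk hk') hne
  refine ⟨_, hp, Finset.sum_congr rfl fun t _ => ?_⟩
  obtain ⟨m, hm, hgm, hlt⟩ := hmax t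
  rw [hgm]
  congr 1
  by_contra hne
  exact lt_asymm (hlt _ (hp.least_mem t) (Ne.symm hne))
    (hp.least_le t hm m Set.right_mem_uIcc hne)

/-- The vertices of an associahedron correspond to the search orders, by their vertex posets. -/
theorem vertexCount_associahedron {L : Type} [Fintype L] [ℓ : LinearOrder L] (α : Type)
    [PartialOrder α] : vertexCount (associahedron L ℓ) α =
      Nat.card {p : PartialOrder L // IsSearchOrder (leRel p) ∧ IsoPoset p α} := by
  have key : ∀ v : vertices (associahedron L ℓ), ∃ hp : IsSearchOrder (leRel (vertexPoset _ v)),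
      v.1 = hp.vertex := by
    rintro ⟨v, hv⟩
    obtain ⟨y, hp, rfl⟩ := exists_searchOrder_of_vertex hv
    rw [hp.vertexPoset_vertex]
    exact ⟨hp, rfl⟩
  refine Nat.card_congr (Equiv.ofBijective
    (fun v => ⟨vertexPoset _ v.1, (key v.1).1, v.2⟩) ⟨?_, ?_⟩)
  · intro v w h
    have h : vertexPoset _ v.1 = vertexPoset _ w.1 := congrArg Subtype.val h
    refine Subtype.ext (Subtype.ext ?_)
    obtain ⟨hv, ev⟩ := key v.1
    obtain ⟨hw, ew⟩ := key w.1
    have : ∀ {r s : L → L → Prop} (hr : IsSearchOrder r) (hs : IsSearchOrder s),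
        r = s → hr.vertex = hs.vertex := by
      rintro _ _ _ _ rfl; rfl
    rw [ev, ew, this hv hw (congrArg leRel h)]
  · rintro ⟨p, hp, hα⟩
    have := hp.vertexPoset_vertex
    exact ⟨⟨⟨_, hp.vertex_mem_vertices⟩, by rw [this]; exact hα⟩, Subtype.ext this⟩

/-! ### Nodes of binary trees -/

namespace RBTNode

variable {u : Unit} {l r : BinaryTree Unit}

/-- The root of a binary tree. -/
def root : RBTNode (.node u l r) := (⊥ : WithBot (RBTNode l ⊕ RBTNode r))

/-- A node of the left subtree. -/
def left (x : RBTNode l) : RBTNode (.node u l r) :=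
  ((Sum.inl x : RBTNode l ⊕ RBTNode r) : WithBot (RBTNode l ⊕ RBTNode r))

/-- A node of the right subtree. -/
def right (x : RBTNode r) : RBTNode (.node u l r) :=
  ((Sum.inr x : RBTNode l ⊕ RBTNode r) : WithBot (RBTNode l ⊕ RBTNode r))

instance : IsEmpty (RBTNode .nil) := inferInstanceAs (IsEmpty Empty)

@[elab_as_elim]
theorem cases {motive : RBTNode (.node u l r) → Prop} (root : motive root)
    (left : ∀ x, motive (left x)) (right : ∀ x, motive (right x)) (x : RBTNode (.node u l r)) :
    motive x := by
  change WithBot (RBTNode l ⊕ RBTNode r) at x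
  induction x with
  | bot => exact root
  | coe x => rcases x with x | x; exacts [left x, right x]

theorem root_le (x : RBTNode (.node u l r)) : root ≤ x :=
  bot_le (α := WithBot (RBTNode l ⊕ RBTNode r))

theorem left_le_left {x y : RBTNode l} :
    (left x : RBTNode (.node u l r)) ≤ left y ↔ x ≤ y :=
  (WithBot.coe_le_coe (α := RBTNode l ⊕ RBTNode r)).trans Sum.inl_le_inl_iff

theorem right_le_right {x y : RBTNode r} :
    (right x : RBTNode (.node u l r)) ≤ right y ↔ x ≤ y :=
  (WithBot.coe_le_coe (α := RBTNode l ⊕ RBTNode r)).trans Sum.inr_le_inr_iff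

theorem not_left_le_right {x : RBTNode l} {y : RBTNode r} :
    ¬ (left x : RBTNode (.node u l r)) ≤ right y := fun h =>
  Sum.not_inl_le_inr ((WithBot.coe_le_coe (α := RBTNode l ⊕ RBTNode r)).1 h)

theorem not_right_le_left {x : RBTNode r} {y : RBTNode l} :
    ¬ (right x : RBTNode (.node u l r)) ≤ left y := fun h =>
  Sum.not_inr_le_inl ((WithBot.coe_le_coe (α := RBTNode l ⊕ RBTNode r)).1 h)

theorem not_left_le_root {x : RBTNode l} : ¬ (left x : RBTNode (.node u l r)) ≤ root :=
  WithBot.not_coe_le_bot (α := RBTNode l ⊕ RBTNode r) _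

theorem not_right_le_root {x : RBTNode r} : ¬ (right x : RBTNode (.node u l r)) ≤ root :=
  WithBot.not_coe_le_bot (α := RBTNode l ⊕ RBTNode r) _

theorem left_injective : Function.Injective (left : RBTNode l → RBTNode (.node u l r)) :=
  fun _ _ h => le_antisymm (left_le_left.1 h.le) (left_le_left.1 h.ge)

theorem right_injective : Function.Injective (right : RBTNode r → RBTNode (.node u l r)) :=
  fun _ _ h => le_antisymm (right_le_right.1 h.le) (right_le_right.1 h.ge)

/-- The position of a node in the inorder traversal of a tree: left subtree, root, right
subtree. -/
def pos : (T : BinaryTree Unit) → RBTNode T → ℕ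
  | .nil => fun x => isEmptyElim x
  | .node _ l r => fun x =>
    WithBot.recBotCoe (C := fun _ : WithBot (RBTNode l ⊕ RBTNode r) => ℕ) l.numNodes
      (Sum.elim (pos l) fun y => l.numNodes + 1 + pos r y) x

theorem pos_root : pos (.node u l r) root = l.numNodes := rfl

theorem pos_left (x : RBTNode l) : pos (.node u l r) (left x) = pos l x := rfl

theorem pos_right (x : RBTNode r) :
    pos (.node u l r) (right x) = l.numNodes + 1 + pos r x := rfl

theorem pos_lt : ∀ (T : BinaryTree Unit) (x : RBTNode T), pos T x < T.numNodes
  | .nil => fun x => isEmptyElim x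
  | .node _ l r => fun x => by
    rw [BinaryTree.numNodes]
    induction x using cases with
    | root => rw [pos_root]; omega
    | left x => have := pos_lt l x; rw [pos_left]; omega
    | right x => have := pos_lt r x; rw [pos_right]; omega

theorem exists_pos_eq : ∀ (T : BinaryTree Unit) (i : ℕ), i < T.numNodes → ∃ x, pos T x = i
  | .nil => fun i hi => absurd hi (Nat.not_lt_zero i)
  | .node _ l r => fun i hi => by
    rw [BinaryTree.numNodes] at hi
    rcases lt_trichotomy i l.numNodes with h | h | h
    · obtain ⟨x, hx⟩ := exists_pos_eq l i h
      exact ⟨left x, by rw [pos_left, hx]⟩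
    · exact ⟨root, by rw [pos_root, h]⟩
    · obtain ⟨x, hx⟩ := exists_pos_eq r (i - (l.numNodes + 1)) (by omega)
      exact ⟨right x, by rw [pos_right, hx]; omega⟩

theorem pos_injective : ∀ T : BinaryTree Unit, Function.Injective (pos T)
  | .nil => fun x => isEmptyElim x
  | .node _ l r => fun x y h => by
    induction x using cases with
    | root =>
      induction y using cases with
      | root => rfl
      | left y => have := pos_lt l y; rw [pos_root, pos_left] at h; omega
      | right y => rw [pos_root, pos_right] at h; omega
    | left x =>
      have := pos_lt l x
      induction y using cases with
      | root => rw [pos_root, pos_left] at h; omega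
      | left y => rw [pos_left, pos_left] at h; rw [pos_injective l h]
      | right y => rw [pos_left, pos_right] at h; omega
    | right x =>
      induction y using cases with
      | root => rw [pos_root, pos_right] at h; omega
      | left y => have := pos_lt l y; rw [pos_left, pos_right] at h; omega
      | right y => rw [pos_right, pos_right] at h; rw [pos_injective r (Nat.add_left_cancel h)]

/-- The inorder numbering of the nodes of a tree. -/
noncomputable def inorder (T : BinaryTree Unit) : RBTNode T ≃ Fin T.numNodes :=
  Equiv.ofBijective (fun x => ⟨pos T x, pos_lt T x⟩)
    ⟨fun _ _ h => pos_injective T (congrArg Fin.val h), fun i => by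
      obtain ⟨x, hx⟩ := exists_pos_eq T i i.2
      exact ⟨x, Fin.ext hx⟩⟩

theorem inorder_val (T : BinaryTree Unit) (x : RBTNode T) : (inorder T x : ℕ) = pos T x := rfl

theorem exists_least_of_interval : ∀ (T : BinaryTree Unit) (i j : ℕ), i ≤ j → j < T.numNodes →
    ∃ x, (i ≤ pos T x ∧ pos T x ≤ j) ∧ ∀ z, i ≤ pos T z → pos T z ≤ j → x ≤ z
  | .nil => fun i j _ hj => absurd hj (Nat.not_lt_zero j)
  | .node _ l r => fun i j hij hj => by
    rw [BinaryTree.numNodes] at hj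
    by_cases h1 : j < l.numNodes
    · obtain ⟨x, hx, hmin⟩ := exists_least_of_interval l i j hij h1
      refine ⟨left x, hx, fun z hz hz' => ?_⟩
      induction z using cases with
      | root => rw [pos_root] at hz'; omega
      | left z => exact left_le_left.2 (hmin z hz hz')
      | right z => rw [pos_right] at hz'; omega
    by_cases h2 : l.numNodes < i
    · obtain ⟨x, hx, hmin⟩ := exists_least_of_interval r (i - (l.numNodes + 1))
        (j - (l.numNodes + 1)) (by omega) (by omega)
      refine ⟨right x, by rw [pos_right]; omega, fun z hz hz' => ?_⟩
      induction z using cases with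
      | root => rw [pos_root] at hz; omega
      | left z => have := pos_lt l z; rw [pos_left] at hz; omega
      | right z =>
        rw [pos_right] at hz hz'
        exact right_le_right.2 (hmin z (by omega) (by omega))
    · exact ⟨root, by rw [pos_root]; omega, fun z _ _ => root_le z⟩

/-- A node below another one is below all nodes between them in the inorder traversal, as subtrees
are traversed contiguously. -/
theorem le_of_pos_between : ∀ (T : BinaryTree Unit) (x z w : RBTNode T), x ≤ z →
    (pos T x ≤ pos T w ∧ pos T w ≤ pos T z ∨ pos T z ≤ pos T w ∧ pos T w ≤ pos T x) → x ≤ w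
  | .nil => fun x => isEmptyElim x
  | .node _ l r => fun x z w hxz hw => by
    induction x using cases with
    | root => exact root_le w
    | left x =>
      have h1 := pos_lt l x
      induction z using cases with
      | root => exact absurd hxz not_left_le_root
      | right z => exact absurd hxz not_left_le_right
      | left z =>
        have h2 := pos_lt l z
        rw [pos_left, pos_left] at hw
        induction w using cases with
        | root => rw [pos_root] at hw; omega
        | right w => rw [pos_right] at hw; omega
        | left w => exact left_le_left.2 (le_of_pos_between l x z w (left_le_left.1 hxz) hw)
    | right x =>
      induction z using cases with
      | root => exact absurd hxz not_right_le_root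
      | left z => exact absurd hxz not_right_le_left
      | right z =>
        rw [pos_right, pos_right] at hw
        induction w using cases with
        | root => rw [pos_root] at hw; omega
        | left w => have := pos_lt l w; rw [pos_left] at hw; omega
        | right w =>
          rw [pos_right] at hw
          exact right_le_right.2
            (le_of_pos_between r x z w (right_le_right.1 hxz) (by omega))

/-- A tree is determined by the order of its nodes and their positions: the root is the least
node, and its position tells the subtrees apart. -/
theorem eq_of_le_iff_le : ∀ (T T' : BinaryTree Unit), T.numNodes = T'.numNodes →
    (∀ (x y : RBTNode T) (x' y' : RBTNode T'), pos T x = pos T' x' → pos T y = pos T' y' →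
      (x ≤ y ↔ x' ≤ y')) → T = T'
  | .nil => fun T' hn _ => by
    cases T' with
    | nil => rfl
    | node _ l r => rw [BinaryTree.numNodes, BinaryTree.numNodes] at hn; omega
  | .node _ l r => fun T' hn h => by
    cases T' with
    | nil => rw [BinaryTree.numNodes, BinaryTree.numNodes] at hn; omega
    | node _ l' r' =>
      have hroot : l.numNodes = l'.numNodes := by
        obtain ⟨x', hx'⟩ := exists_pos_eq (.node _ l' r') l.numNodes
          (by rw [← hn, BinaryTree.numNodes]; omega)
        obtain ⟨y, hy⟩ := exists_pos_eq (.node _ l r) l'.numNodes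
          (by rw [hn, BinaryTree.numNodes]; omega)
        have := (h root y x' root hx'.symm hy).1 (root_le y)
        rw [le_antisymm this (root_le x')] at hx'
        exact hx'.symm
      rw [BinaryTree.numNodes, BinaryTree.numNodes] at hn
      have hl := eq_of_le_iff_le l l' hroot fun x y x' y' hx hy =>
        left_le_left.symm.trans
          ((h (left x) (left y) (left x') (left y') hx hy).trans left_le_left)
      have hr := eq_of_le_iff_le r r' (by omega) fun x y x' y' hx hy =>
        right_le_right.symm.trans ((h (right x) (right y) (right x') (right y')
          (by rw [pos_right, pos_right, hx, hroot])
          (by rw [pos_right, pos_right, hy, hroot])).trans right_le_right)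
      rw [hl, hr]

end RBTNode

/-! ### Search orders are the orders of binary trees -/

theorem IsSearchOrder.restrict {L : Type} [LinearOrder L] {le : L → L → Prop}
    (h : IsSearchOrder le) {s : Set L} (hs : s.OrdConnected) :
    IsSearchOrder fun a b : s => le a b := by
  constructor
  · intro i j hij
    obtain ⟨m, hm, hmin⟩ := h.1 i j hij
    exact ⟨⟨m, hs.out i.2 j.2 hm⟩, hm, fun k hk => hmin k hk⟩
  · intro a b hab k hk
    refine h.2 a b hab k ?_
    rw [Set.mem_uIcc] at hk ⊢
    exact hk

open RBTNode in
/-- A search order is that of a binary tree: its least element `ρ` is the root, and the elements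
before and after `ρ` form the subtrees. -/
theorem exists_tree_of_isSearchOrder (n : ℕ) : ∀ {L : Type} [Finite L] [LinearOrder L]
    {le : L → L → Prop}, Nat.card L = n → IsSearchOrder le →
    (∀ a b, le a b → le b a → a = b) →
    ∃ (T : BinaryTree Unit) (e : RBTNode T → L), Function.Bijective e ∧
      (∀ x y, x ≤ y ↔ le (e x) (e y)) ∧ ∀ x y, pos T x < pos T y → e x < e y := by
  induction n using Nat.strong_induction_on with | _ n ih =>
  intro L _ _ le hn h hanti
  cases isEmpty_or_nonempty L with
  | inl hL =>
    exact ⟨.nil, isEmptyElim, ⟨fun x => isEmptyElim x, fun a => isEmptyElim a⟩,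
      fun x => isEmptyElim x, fun x => isEmptyElim x⟩
  | inr hL =>
    obtain ⟨i, -, hi⟩ := Set.exists_min_image (Set.univ : Set L) id (Set.toFinite _)
      Set.univ_nonempty
    obtain ⟨j, -, hj⟩ := Set.exists_max_image (Set.univ : Set L) id (Set.toFinite _)
      Set.univ_nonempty
    obtain ⟨ρ, -, hρ⟩ := h.1 i j (hi j trivial)
    replace hρ : ∀ k, le ρ k := fun k => hρ k ⟨hi k trivial, hj k trivial⟩
    have hcard : ∀ s : Set L, ρ ∉ s → Nat.card s < n := fun s hs =>
      hn ▸ Finite.card_subtype_lt hs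
    obtain ⟨l, el, hlb, hl, hlpos⟩ := ih _ (hcard (Set.Iio ρ) (lt_irrefl ρ)) rfl
      (h.restrict Set.ordConnected_Iio) fun a b hab hba => Subtype.ext (hanti _ _ hab hba)
    obtain ⟨r, er, hrb, hr, hrpos⟩ := ih _ (hcard (Set.Ioi ρ) (lt_irrefl ρ)) rfl
      (h.restrict Set.ordConnected_Ioi) fun a b hab hba => Subtype.ext (hanti _ _ hab hba)
    have hltl : ∀ x, (el x).1 < ρ := fun x => (el x).2
    have hltr : ∀ x, ρ < (er x).1 := fun x => (er x).2
    let e : RBTNode (.node () l r) → L := fun x =>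
      WithBot.recBotCoe (C := fun _ : WithBot (RBTNode l ⊕ RBTNode r) => L) ρ
        (Sum.elim (fun x => (el x).1) fun x => (er x).1) x
    have e0 : e root = ρ := rfl
    have e1 : ∀ x, e (left x) = (el x).1 := fun _ => rfl
    have e2 : ∀ x, e (right x) = (er x).1 := fun _ => rfl
    have hrefl : ∀ a, le a a := fun a => by
      obtain ⟨m, hm, hle⟩ := h.1 a a le_rfl
      have := hle a ⟨le_rfl, le_rfl⟩
      rwa [le_antisymm hm.2 hm.1] at this
    have hpos : ∀ x y, pos (.node () l r) x < pos (.node () l r) y → e x < e y := by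
      intro x y hxy
      induction x using RBTNode.cases with
      | root =>
        induction y using RBTNode.cases with
        | root => exact absurd hxy (lt_irrefl _)
        | left y => have := pos_lt l y; rw [pos_root, pos_left] at hxy; omega
        | right y => exact hltr y
      | left x =>
        induction y using RBTNode.cases with
        | root => exact hltl x
        | left y => exact hlpos x y hxy
        | right y => exact (hltl x).trans (hltr y)
      | right x =>
        induction y using RBTNode.cases with
        | root => rw [pos_root, pos_right] at hxy; omega
        | left y => have := pos_lt l y; rw [pos_right, pos_left] at hxy; omega
        | right y => exact hrpos x y (by rw [pos_right, pos_right] at hxy; omega)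
    refine ⟨.node () l r, e, ⟨fun x y hxy => ?_, fun a => ?_⟩, fun x y => ?_, hpos⟩
    · by_contra hne
      rcases lt_or_gt_of_ne (fun h => hne (pos_injective _ h)) with h | h
      · exact (hpos _ _ h).ne hxy
      · exact (hpos _ _ h).ne' hxy
    · rcases lt_trichotomy a ρ with ha | rfl | ha
      · obtain ⟨x, hx⟩ := hlb.2 ⟨a, ha⟩
        exact ⟨left x, congrArg Subtype.val hx⟩
      · exact ⟨root, rfl⟩
      · obtain ⟨x, hx⟩ := hrb.2 ⟨a, ha⟩
        exact ⟨right x, congrArg Subtype.val hx⟩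
    · -- elements on different sides of the root are incomparable, as the root is between them
      have hroot : ∀ a, le a ρ → a = ρ := fun a ha => hanti _ _ ha (hρ a)
      induction x using RBTNode.cases with
      | root => exact iff_of_true (root_le y) (hρ _)
      | left x =>
        induction y using RBTNode.cases with
        | root => exact iff_of_false not_left_le_root fun h => (hltl x).ne (hroot _ h)
        | left y => exact left_le_left.trans (hl x y)
        | right y =>
          refine iff_of_false not_left_le_right fun hle => (hltl x).ne (hroot _ ?_)
          exact h.2 _ _ hle ρ (Set.mem_uIcc.2 (Or.inl ⟨(hltl x).le, (hltr y).le⟩))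
      | right x =>
        induction y using RBTNode.cases with
        | root => exact iff_of_false not_right_le_root fun h => (hltr x).ne' (hroot _ h)
        | left y =>
          refine iff_of_false not_right_le_left fun hle => (hltr x).ne' (hroot _ ?_)
          exact h.2 _ _ hle ρ (Set.mem_uIcc.2 (Or.inr ⟨(hltl y).le, (hltr x).le⟩))
        | right y => exact right_le_right.trans (hr x y)

/-- The order on `Fin n` of a binary tree with `n` nodes, numbered inorder. -/
@[reducible] noncomputable def treeOrder (n : ℕ) (T : {T : BinaryTree Unit // T.numNodes = n}) :
    PartialOrder (Fin n) :=
  relabelOrder ((RBTNode.inorder T.1).trans (finCongr T.2)) (rbtOrder T.1)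

theorem isSearchOrder_treeOrder (n : ℕ) (T : {T : BinaryTree Unit // T.numNodes = n}) :
    IsSearchOrder (leRel (treeOrder n T)) := by
  obtain ⟨T, rfl⟩ := T
  have hval : ∀ i, RBTNode.pos T ((RBTNode.inorder T).symm i) = i := fun i => by
    rw [← RBTNode.inorder_val, Equiv.apply_symm_apply]
  constructor
  · intro i j hij
    obtain ⟨x, hx, hmin⟩ := RBTNode.exists_least_of_interval T i j hij j.2
    refine ⟨RBTNode.inorder T x, hx, fun k hk => ?_⟩
    change (RBTNode.inorder T).symm (RBTNode.inorder T x) ≤ (RBTNode.inorder T).symm k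
    rw [Equiv.symm_apply_apply]
    exact hmin _ (by rw [hval]; exact hk.1) (by rw [hval]; exact hk.2)
  · intro a b hab k hk
    refine RBTNode.le_of_pos_between T _ _ _ hab ?_
    have := Set.mem_uIcc.1 hk
    rw [Fin.le_def, Fin.le_def, Fin.le_def, Fin.le_def] at this
    rw [← hval a, ← hval b, ← hval k] at this
    exact this

theorem treeOrder_injective (n : ℕ) : Function.Injective (treeOrder n) := by
  rintro ⟨T, hT⟩ ⟨T', hT'⟩ h
  refine Subtype.ext (RBTNode.eq_of_le_iff_le T T' (hT.trans hT'.symm) ?_)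
  subst hT
  intro x y x' y' hx hy
  have key : ∀ (z : RBTNode T) (z' : RBTNode T'), RBTNode.pos T z = RBTNode.pos T' z' →
      ((RBTNode.inorder T').trans (finCongr hT')).symm (RBTNode.inorder T z) = z' := by
    intro z z' hz
    rw [Equiv.symm_apply_eq]
    exact Fin.ext hz
  have := congrArg (fun p => leRel p (RBTNode.inorder T x) (RBTNode.inorder T y)) h
  change ((RBTNode.inorder T).symm _ ≤ (RBTNode.inorder T).symm _) =
    (((RBTNode.inorder T').trans (finCongr hT')).symm _ ≤
      ((RBTNode.inorder T').trans (finCongr hT')).symm _) at this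
  rw [Equiv.symm_apply_apply, Equiv.symm_apply_apply, key x x' hx, key y y' hy] at this
  exact this.to_iff

theorem exists_tree_of_isSearchOrder_fin {n : ℕ} {le : Fin n → Fin n → Prop}
    (h : IsSearchOrder le) (hanti : ∀ a b, le a b → le b a → a = b) :
    ∃ T : {T : BinaryTree Unit // T.numNodes = n}, leRel (treeOrder n T) = le := by
  obtain ⟨T, e, heb, hle, hpos⟩ := exists_tree_of_isSearchOrder n (Nat.card_fin n) h hanti
  let e' := Equiv.ofBijective e heb
  have hT : T.numNodes = n := by
    rw [← Fintype.card_fin T.numNodes, ← Fintype.card_fin n]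
    exact Fintype.card_congr ((RBTNode.inorder T).symm.trans e')
  subst hT
  -- both numberings of the nodes are increasing in the position, so they agree
  have hmono : StrictMono ((RBTNode.inorder T).symm.trans e') := fun a b hab => by
    refine hpos _ _ ?_
    rwa [← RBTNode.inorder_val, ← RBTNode.inorder_val, Equiv.apply_symm_apply,
      Equiv.apply_symm_apply]
  have hid : ∀ a, (RBTNode.inorder T).symm.trans e' a = a := fun a =>
    DFunLike.congr_fun (Subsingleton.elim
      (hmono.orderIsoOfSurjective _ ((RBTNode.inorder T).symm.trans e').surjective)
      (OrderIso.refl _)) a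
  refine ⟨⟨T, rfl⟩, funext₂ fun a b => propext ?_⟩
  change (RBTNode.inorder T).symm a ≤ (RBTNode.inorder T).symm b ↔ _
  rw [hle]
  change le ((RBTNode.inorder T).symm.trans e' a) ((RBTNode.inorder T).symm.trans e' b) ↔ _
  rw [hid, hid]

/-- The vertices of an associahedron with a given unlabelled vertex poset are counted by the
binary trees with that poset of nodes. -/
theorem vertexCount_assocGP (α : Type) [Fintype α] [PartialOrder α] :
    vertexCount (assocGP (Fintype.card α)).carrier α =
      Nat.card {T : BinaryTree Unit // Nonempty (RBTNode T ≃o α)} := by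
  have hiso : ∀ T, Nonempty (RBTNode T ≃o α) ↔ IsoPoset (rbtOrder T) α := fun T =>
    ⟨fun ⟨e⟩ => ⟨e.toEquiv, fun a b => e.le_iff_le.symm⟩,
      fun ⟨e, he⟩ => ⟨⟨e, fun {a b} => (he a b).symm⟩⟩⟩
  have hcard : ∀ T, Nonempty (RBTNode T ≃o α) → T.numNodes = Fintype.card α := fun T ⟨e⟩ => by
    rw [← Fintype.card_fin T.numNodes]
    exact Fintype.card_congr ((RBTNode.inorder T).symm.trans e.toEquiv)
  refine (vertexCount_associahedron (L := Fin (Fintype.card α)) α).trans ?_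
  symm
  refine Nat.card_congr (Equiv.ofBijective (fun T => ⟨treeOrder _ ⟨T.1, hcard _ T.2⟩,
    isSearchOrder_treeOrder _ _, (isoPoset_relabelOrder _ _ _).2 ((hiso _).1 T.2)⟩) ⟨?_, ?_⟩)
  · intro T T' h
    exact Subtype.ext (Subtype.mk.inj (treeOrder_injective _ (congrArg Subtype.val h)))
  · rintro ⟨p, hp, hα⟩
    obtain ⟨T, hT⟩ := exists_tree_of_isSearchOrder_fin hp fun a b => p.le_antisymm a b
    obtain rfl : treeOrder _ T = p := PartialOrder.ext fun a b => (congrFun₂ hT a b).to_iff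
    exact ⟨⟨T.1, (hiso _).2 ((isoPoset_relabelOrder _ _ _).1 hα)⟩, rfl⟩

/-! ### Isomorphisms of trees of nodes -/

/-- A monotone map to a disjoint union does not meet both summands if any two elements of its source
have a lower bound. -/
theorem forall_isLeft_or_forall_isRight {A B C : Type} [PartialOrder A] [PartialOrder B]
    [PartialOrder C] (hA : ∀ x y : A, ∃ z, z ≤ x ∧ z ≤ y) {g : A → B ⊕ C} (hg : Monotone g) :
    (∀ a, ∃ b, g a = .inl b) ∨ ∀ a, ∃ c, g a = .inr c := by
  by_contra! h
  obtain ⟨⟨a, ha⟩, b, hb⟩ := h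
  obtain ⟨z, hza, hzb⟩ := hA a b
  have h1 := hg hza
  have h2 := hg hzb
  rcases ea : g a with x | x
  · exact ha x ea
  rcases eb : g b with y | y
  · rw [ea] at h1
    rw [eb] at h2
    rcases ez : g z with w | w
    · rw [ez] at h1; exact Sum.not_inl_le_inr h1
    · rw [ez] at h2; exact Sum.not_inr_le_inl h2
  · exact hb y eb

theorem nonempty_orderIso_of_inl {A B A' B' : Type} [PartialOrder A] [PartialOrder B]
    [PartialOrder A'] [PartialOrder B'] (f : A ⊕ B ≃o A' ⊕ B')
    (hA : ∀ a, ∃ a', f (.inl a) = .inl a') (hB : ∀ b, ∃ b', f (.inr b) = .inr b') :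
    Nonempty (A ≃o A') := by
  choose g hg using hA
  have hle : ∀ {a b}, g a ≤ g b ↔ a ≤ b := fun {a b} => by
    rw [← Sum.inl_le_inl_iff (β := B'), ← hg, ← hg, f.le_iff_le, Sum.inl_le_inl_iff]
  refine ⟨RelIso.ofSurjective (OrderEmbedding.ofMapLEIff g fun _ _ => hle) fun a' => ?_⟩
  obtain ⟨a | b, h⟩ := f.surjective (.inl a')
  · rw [hg] at h
    exact ⟨a, Sum.inl.inj h⟩
  · obtain ⟨b', hb'⟩ := hB b
    rw [hb'] at h
    exact absurd h Sum.inr_ne_inl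

/-- The decomposition of a poset into two summands in which any two elements have a lower bound is
unique up to their order. -/
theorem nonempty_orderIso_sum_iff {A B A' B' : Type} [PartialOrder A] [PartialOrder B]
    [PartialOrder A'] [PartialOrder B'] (hA : ∀ x y : A, ∃ z, z ≤ x ∧ z ≤ y)
    (hB : ∀ x y : B, ∃ z, z ≤ x ∧ z ≤ y) (hA' : ∀ x y : A', ∃ z, z ≤ x ∧ z ≤ y)
    (hB' : ∀ x y : B', ∃ z, z ≤ x ∧ z ≤ y) :
    Nonempty (A ⊕ B ≃o A' ⊕ B') ↔ (Nonempty (A ≃o A') ∧ Nonempty (B ≃o B')) ∨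
      (Nonempty (A ≃o B') ∧ Nonempty (B ≃o A')) := by
  constructor
  · rintro ⟨f⟩
    -- the two cases in which the summands are mapped to different summands
    have h1 : (∀ a, ∃ a', f (.inl a) = .inl a') → (∀ b, ∃ b', f (.inr b) = .inr b') →
        Nonempty (A ≃o A') ∧ Nonempty (B ≃o B') := fun h h' =>
      ⟨nonempty_orderIso_of_inl f h h', nonempty_orderIso_of_inl
        ((OrderIso.sumComm B A).trans (f.trans (OrderIso.sumComm A' B')))
        (fun b => (h' b).imp fun b' hb => by simp [hb])
        (fun a => (h a).imp fun a' ha => by simp [ha])⟩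
    have h2 : (∀ a, ∃ b', f (.inl a) = .inr b') → (∀ b, ∃ a', f (.inr b) = .inl a') →
        Nonempty (A ≃o B') ∧ Nonempty (B ≃o A') := fun h h' =>
      ⟨nonempty_orderIso_of_inl (f.trans (OrderIso.sumComm A' B'))
        (fun a => (h a).imp fun a' ha => by simp [ha])
        (fun b => (h' b).imp fun b' hb => by simp [hb]),
      nonempty_orderIso_of_inl ((OrderIso.sumComm B A).trans f)
        (fun b => (h' b).imp fun b' hb => by simp [hb])
        (fun a => (h a).imp fun a' ha => by simp [ha])⟩
    -- if they are mapped to the same summand, one of them is empty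
    have h3 : ∀ {C : Type} [PartialOrder C] (_ : ∀ x y : C, ∃ z, z ≤ x ∧ z ≤ y)
        (g : C → A ⊕ B), Monotone g → ∀ {k : A → C} {k' : B → C}, (∀ a, g (k a) = .inl a) →
        (∀ b, g (k' b) = .inr b) → IsEmpty A ∨ IsEmpty B := by
      intro C _ hC g hg k k' hk hk'
      rcases forall_isLeft_or_forall_isRight hC hg with h | h
      · refine Or.inr ⟨fun b => ?_⟩
        obtain ⟨a, ha⟩ := h (k' b)
        exact Sum.inl_ne_inr (ha.symm.trans (hk' b))
      · refine Or.inl ⟨fun a => ?_⟩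
        obtain ⟨b, hb⟩ := h (k a)
        exact Sum.inl_ne_inr ((hk a).symm.trans hb)
    have hfA : Monotone fun a => f (.inl a) := fun _ _ h => f.monotone (Sum.inl_le_inl_iff.2 h)
    have hfB : Monotone fun b => f (.inr b) := fun _ _ h => f.monotone (Sum.inr_le_inr_iff.2 h)
    have hempty : IsEmpty A ∨ IsEmpty B →
        (∀ a, ∃ a', f (.inl a) = .inl a') ∨ (∀ a, ∃ b', f (.inl a) = .inr b') →
        (∀ b, ∃ a', f (.inr b) = .inl a') ∨ (∀ b, ∃ b', f (.inr b) = .inr b') →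
        (Nonempty (A ≃o A') ∧ Nonempty (B ≃o B')) ∨
          (Nonempty (A ≃o B') ∧ Nonempty (B ≃o A')) := by
      rintro (hE | hE) hA hB
      · exact hB.elim (fun h => Or.inr (h2 (fun a => hE.elim a) h))
          fun h => Or.inl (h1 (fun a => hE.elim a) h)
      · exact hA.elim (fun h => Or.inl (h1 h fun b => hE.elim b))
          fun h => Or.inr (h2 h fun b => hE.elim b)
    have hAc := forall_isLeft_or_forall_isRight hA hfA
    have hBc := forall_isLeft_or_forall_isRight hB hfB
    rcases hAc with ha | ha <;> rcases hBc with hb | hb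
    · refine hempty ?_ (Or.inl ha) (Or.inl hb)
      choose k hk using ha
      choose k' hk' using hb
      exact h3 hA' (fun c => f.symm (.inl c))
        (fun _ _ h => f.symm.monotone (Sum.inl_le_inl_iff.2 h))
        (k := k) (k' := k') (fun a => by rw [← hk, f.symm_apply_apply])
        (fun b => by rw [← hk', f.symm_apply_apply])
    · exact Or.inl (h1 ha hb)
    · exact Or.inr (h2 ha hb)
    · refine hempty ?_ (Or.inr ha) (Or.inr hb)
      choose k hk using ha
      choose k' hk' using hb
      exact h3 hB' (fun c => f.symm (.inr c))
        (fun _ _ h => f.symm.monotone (Sum.inr_le_inr_iff.2 h))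
        (k := k) (k' := k') (fun a => by rw [← hk, f.symm_apply_apply])
        (fun b => by rw [← hk', f.symm_apply_apply])
  · rintro (⟨⟨e⟩, ⟨e'⟩⟩ | ⟨⟨e⟩, ⟨e'⟩⟩)
    · exact ⟨OrderIso.sumCongr e e'⟩
    · exact ⟨(OrderIso.sumCongr e e').trans (OrderIso.sumComm B' A')⟩

theorem nonempty_orderIso_withBot_iff {X Y : Type} [PartialOrder X] [PartialOrder Y] :
    Nonempty (WithBot X ≃o WithBot Y) ↔ Nonempty (X ≃o Y) := by
  constructor
  · rintro ⟨e⟩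
    let e' : Option X ≃ Option Y := e.toEquiv
    have key : ∀ x, ((Equiv.removeNone e' x : Y) : WithBot Y) = e x := by
      intro x
      refine Equiv.removeNone_some e' (Option.ne_none_iff_exists'.1 fun h => ?_)
      have : e x = ⊥ := h
      rw [map_eq_bot_iff] at this
      exact WithBot.coe_ne_bot this
    refine ⟨⟨Equiv.removeNone e', fun {a b} => ?_⟩⟩
    rw [← WithBot.coe_le_coe, key, key, e.le_iff_le, WithBot.coe_le_coe]
  · rintro ⟨e⟩
    exact ⟨e.withBotCongr⟩

namespace RBTNode

theorem exists_isBot : ∀ (T : BinaryTree Unit), RBTNode T → ∃ b : RBTNode T, IsBot b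
  | .nil => fun x => isEmptyElim x
  | .node _ _ _ => fun _ => ⟨root, root_le⟩

theorem exists_le_and_le {T : BinaryTree Unit} (x y : RBTNode T) : ∃ z, z ≤ x ∧ z ≤ y := by
  obtain ⟨b, hb⟩ := exists_isBot T x
  exact ⟨b, hb x, hb y⟩

theorem nonempty_orderIso_node_iff {u u' : Unit} {l r l' r' : BinaryTree Unit} :
    Nonempty (RBTNode (.node u l r) ≃o RBTNode (.node u' l' r')) ↔
      (Nonempty (RBTNode l ≃o RBTNode l') ∧ Nonempty (RBTNode r ≃o RBTNode r')) ∨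
      (Nonempty (RBTNode l ≃o RBTNode r') ∧ Nonempty (RBTNode r ≃o RBTNode l')) :=
  (nonempty_orderIso_withBot_iff (X := RBTNode l ⊕ RBTNode r)
    (Y := RBTNode l' ⊕ RBTNode r')).trans
    (nonempty_orderIso_sum_iff exists_le_and_le exists_le_and_le exists_le_and_le
      exists_le_and_le)

theorem numNodes_eq_of_orderIso {T T' : BinaryTree Unit} (e : RBTNode T ≃o RBTNode T') :
    T.numNodes = T'.numNodes := by
  rw [← Fintype.card_fin T.numNodes, ← Fintype.card_fin T'.numNodes]
  exact Fintype.card_congr ((inorder T).symm.trans (e.toEquiv.trans (inorder T')))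

instance (T : BinaryTree Unit) : Finite (RBTNode T) := Finite.of_equiv _ (inorder T).symm

/-- The trees with the same poset of nodes as a given tree. -/
def sameShape (T : BinaryTree Unit) : Set (BinaryTree Unit) :=
  {T' | Nonempty (RBTNode T' ≃o RBTNode T)}

theorem sameShape_finite (T : BinaryTree Unit) : (sameShape T).Finite :=
  (BinaryTree.treesOfNumNodesEq T.numNodes).finite_toSet.subset fun _ ⟨e⟩ =>
    BinaryTree.mem_treesOfNumNodesEq.2 (numNodes_eq_of_orderIso e)

open Classical in
/-- The number of nodes of a tree whose left and right subtrees have different posets of nodes. -/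
noncomputable def twists : BinaryTree Unit → ℕ
  | .nil => 0
  | .node _ l r => twists l + twists r + if Nonempty (RBTNode l ≃o RBTNode r) then 0 else 1

/-- The trees with the poset of nodes of a given tree arise from it by exchanging the subtrees at
nodes where they differ. -/
theorem ncard_sameShape : ∀ T : BinaryTree Unit, (sameShape T).ncard = 2 ^ twists T
  | .nil => by
    have : sameShape .nil = {.nil} := by
      refine Set.eq_singleton_iff_unique_mem.2 ⟨⟨OrderIso.refl _⟩, fun T ⟨e⟩ => ?_⟩
      cases T with
      | nil => rfl
      | node _ l r => exact isEmptyElim (e root)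
    rw [this, Set.ncard_singleton, twists, pow_zero]
  | .node u l r => by
    let node : BinaryTree Unit × BinaryTree Unit → BinaryTree Unit := fun T => .node u T.1 T.2
    have hnode : Function.Injective node := by
      rintro ⟨a, b⟩ ⟨a', b'⟩ h
      obtain ⟨-, rfl, rfl⟩ := BinaryTree.node.inj h
      rfl
    have hS : sameShape (.node u l r) =
        node '' (sameShape l ×ˢ sameShape r ∪ sameShape r ×ˢ sameShape l) := by
      ext T
      constructor
      · intro h
        cases T with
        | nil => obtain ⟨e⟩ := h; exact isEmptyElim (e.symm root)
        | node _ l' r' => exact ⟨(l', r'), nonempty_orderIso_node_iff.1 h, rfl⟩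
      · rintro ⟨⟨l', r'⟩, h, rfl⟩
        exact nonempty_orderIso_node_iff.2 h
    rw [hS, Set.ncard_image_of_injective _ hnode, twists]
    by_cases hlr : Nonempty (RBTNode l ≃o RBTNode r)
    · have : sameShape l = sameShape r := by
        obtain ⟨e⟩ := hlr
        ext T
        exact ⟨fun ⟨f⟩ => ⟨f.trans e⟩, fun ⟨f⟩ => ⟨f.trans e.symm⟩⟩
      rw [if_pos hlr, this, Set.union_self, Set.ncard_prod, ncard_sameShape r, add_zero, pow_add,
        ← ncard_sameShape l, this, ncard_sameShape r]
    · have hdisj : Disjoint (sameShape l ×ˢ sameShape r) (sameShape r ×ˢ sameShape l) := by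
        rw [Set.disjoint_left]
        rintro ⟨a, b⟩ ⟨⟨e⟩, -⟩ ⟨⟨f⟩, -⟩
        exact hlr ⟨e.symm.trans f⟩
      rw [if_neg hlr, Set.ncard_union_eq hdisj ((sameShape_finite l).prod (sameShape_finite r))
        ((sameShape_finite r).prod (sameShape_finite l)), Set.ncard_prod, Set.ncard_prod,
        ncard_sameShape l, ncard_sameShape r]
      ring

end RBTNode

/-! ### Maximal and symmetric elements of trees of nodes -/

/-- Maximality in an upper set is maximality in the whole poset. -/
theorem isMax_apply_iff {A B : Type} [PartialOrder A] [PartialOrder B] (ι : A ↪o B)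
    (hι : ∀ a b, ι a ≤ b → b ∈ Set.range ι) {a : A} : IsMax (ι a) ↔ IsMax a := by
  constructor
  · intro h b hab
    exact ι.le_iff_le.1 (h (ι.le_iff_le.2 hab))
  · intro h b hab
    obtain ⟨b, rfl⟩ := hι a b hab
    exact ι.le_iff_le.2 (h (ι.le_iff_le.1 hab))

theorem nonempty_orderIso_Ici {A B : Type} [PartialOrder A] [PartialOrder B] (ι : A ↪o B)
    (hι : ∀ a b, ι a ≤ b → b ∈ Set.range ι) (a : A) :
    Nonempty (Set.Ici a ≃o Set.Ici (ι a)) := by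
  refine ⟨RelIso.ofSurjective (OrderEmbedding.ofMapLEIff
    (fun x => (⟨ι x.1, ι.le_iff_le.2 x.2⟩ : Set.Ici (ι a))) fun _ _ => ι.le_iff_le) ?_⟩
  rintro ⟨b, hb⟩
  obtain ⟨b, rfl⟩ := hι a b hb
  exact ⟨⟨b, ι.le_iff_le.1 hb⟩, rfl⟩

/-- Being symmetric depends only on the elements above. -/
theorem isSymmetricElt_apply_iff {A B : Type} [PartialOrder A] [PartialOrder B] (ι : A ↪o B)
    (hι : ∀ a b, ι a ≤ b → b ∈ Set.range ι) {a : A} :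
    IsSymmetricElt (ι a) ↔ IsSymmetricElt a := by
  constructor
  · rintro ⟨v, w, hne, hv, hw, ⟨e⟩⟩
    obtain ⟨v, rfl⟩ := hι a v hv.le
    obtain ⟨w, rfl⟩ := hι a w hw.le
    obtain ⟨ev⟩ := nonempty_orderIso_Ici ι hι v
    obtain ⟨ew⟩ := nonempty_orderIso_Ici ι hι w
    exact ⟨v, w, fun h => hne (by rw [h]), hv.of_image, hw.of_image,
      ⟨ev.trans (e.trans ew.symm)⟩⟩
  · rintro ⟨v, w, hne, hv, hw, ⟨e⟩⟩
    have hconn : (Set.range ι).OrdConnected := by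
      refine ⟨?_⟩
      rintro _ ⟨b, rfl⟩ _ - c ⟨hc, -⟩
      exact hι b c hc
    obtain ⟨ev⟩ := nonempty_orderIso_Ici ι hι v
    obtain ⟨ew⟩ := nonempty_orderIso_Ici ι hι w
    exact ⟨ι v, ι w, fun h => hne (ι.injective h), hv.image ι hconn, hw.image ι hconn,
      ⟨ev.symm.trans (e.trans ew)⟩⟩

theorem numMaximal_congr {A B : Type} [PartialOrder A] [PartialOrder B] (e : A ≃o B) :
    numMaximal A = numMaximal B :=
  Nat.card_congr (e.toEquiv.subtypeEquiv fun _ => (isMax_apply_iff e.toOrderEmbedding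
    fun _ b _ => e.surjective b).symm)

theorem numSymmetric_congr {A B : Type} [PartialOrder A] [PartialOrder B] (e : A ≃o B) :
    numSymmetric A = numSymmetric B :=
  Nat.card_congr (e.toEquiv.subtypeEquiv fun _ => (isSymmetricElt_apply_iff e.toOrderEmbedding
    fun _ b _ => e.surjective b).symm)

namespace RBTNode

variable {u : Unit} {l r : BinaryTree Unit}

/-- The inclusion of the left subtree. -/
def leftEmb : RBTNode l ↪o RBTNode (.node u l r) :=
  OrderEmbedding.ofMapLEIff left fun _ _ => left_le_left

/-- The inclusion of the right subtree. -/
def rightEmb : RBTNode r ↪o RBTNode (.node u l r) :=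
  OrderEmbedding.ofMapLEIff right fun _ _ => right_le_right

theorem mem_range_leftEmb (x : RBTNode l) (y : RBTNode (.node u l r)) (h : leftEmb x ≤ y) :
    y ∈ Set.range leftEmb := by
  induction y using cases with
  | root => exact absurd h not_left_le_root
  | left y => exact ⟨y, rfl⟩
  | right y => exact absurd h not_left_le_right

theorem mem_range_rightEmb (x : RBTNode r) (y : RBTNode (.node u l r)) (h : rightEmb x ≤ y) :
    y ∈ Set.range rightEmb := by
  induction y using cases with
  | root => exact absurd h not_right_le_root
  | left y => exact absurd h not_right_le_left
  | right y => exact ⟨y, rfl⟩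

open Classical in
theorem card_subtype_node (Q : RBTNode (.node u l r) → Prop) :
    Nat.card {x // Q x} = (if Q root then 1 else 0) + (Nat.card {x // Q (left x)} +
      Nat.card {x // Q (right x)}) := by
  have key : ∀ {A B : Type} [Fintype A] [Fintype B] (Q : Option (A ⊕ B) → Prop),
      Nat.card {x // Q x} = (if Q none then 1 else 0) + (Nat.card {a // Q (some (.inl a))} +
        Nat.card {b // Q (some (.inr b))}) := by
    intro A B _ _ Q
    rw [Nat.card_eq_fintype_card, Nat.card_eq_fintype_card, Nat.card_eq_fintype_card,
      Fintype.card_subtype, Fintype.card_subtype, Fintype.card_subtype, Finset.card_filter,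
      Finset.card_filter, Finset.card_filter, Fintype.sum_option, Fintype.sum_sum_type]
  exact @key _ _ (Fintype.ofFinite (RBTNode l)) (Fintype.ofFinite (RBTNode r)) Q

theorem isMax_root_iff : IsMax (root : RBTNode (.node u l r)) ↔
    IsEmpty (RBTNode l) ∧ IsEmpty (RBTNode r) := by
  constructor
  · intro h
    exact ⟨⟨fun x => not_left_le_root (h (root_le (left x)))⟩,
      ⟨fun x => not_right_le_root (h (root_le (right x)))⟩⟩
  · rintro ⟨h1, h2⟩ x -
    induction x using cases with
    | root => exact le_rfl
    | left x => exact h1.elim x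
    | right x => exact h2.elim x

theorem root_lt_left (x : RBTNode l) : (root : RBTNode (.node u l r)) < left x :=
  lt_of_le_not_ge (root_le _) not_left_le_root

theorem root_lt_right (x : RBTNode r) : (root : RBTNode (.node u l r)) < right x :=
  lt_of_le_not_ge (root_le _) not_right_le_root

theorem root_covBy_left_iff {x : RBTNode l} :
    (root : RBTNode (.node u l r)) ⋖ left x ↔ IsBot x := by
  constructor
  · intro h
    obtain ⟨b, hb⟩ := exists_isBot l x
    rcases (left_le_left (u := u) (r := r).2 (hb x)).eq_or_lt with he | hlt
    · rwa [← left_injective he]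
    · exact absurd hlt (h.2 (root_lt_left b))
  · refine fun hx => ⟨root_lt_left x, fun c hc hcx => ?_⟩
    induction c using cases with
    | root => exact lt_irrefl _ hc
    | left c => exact hcx.not_ge (left_le_left.2 (hx c))
    | right c => exact not_right_le_left hcx.le

theorem root_covBy_right_iff {x : RBTNode r} :
    (root : RBTNode (.node u l r)) ⋖ right x ↔ IsBot x := by
  constructor
  · intro h
    obtain ⟨b, hb⟩ := exists_isBot r x
    rcases (right_le_right (u := u) (l := l).2 (hb x)).eq_or_lt with he | hlt
    · rwa [← right_injective he]
    · exact absurd hlt (h.2 (root_lt_right b))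
  · refine fun hx => ⟨root_lt_right x, fun c hc hcx => ?_⟩
    induction c using cases with
    | root => exact lt_irrefl _ hc
    | left c => exact not_left_le_right hcx.le
    | right c => exact hcx.not_ge (right_le_right.2 (hx c))

theorem nonempty_orderIso_Ici_of_isBot {A : Type} [PartialOrder A] {x : A} (hx : IsBot x) :
    Nonempty (Set.Ici x ≃o A) :=
  ⟨(OrderIso.setCongr _ _ (Set.eq_univ_of_forall hx)).trans OrderIso.Set.univ⟩

theorem isSymmetricElt_root_iff : IsSymmetricElt (root : RBTNode (.node u l r)) ↔
    Nonempty (RBTNode l) ∧ Nonempty (RBTNode l ≃o RBTNode r) := by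
  have hl : ∀ x : RBTNode l, IsBot x →
      Nonempty (RBTNode l ≃o Set.Ici (left x : RBTNode (.node u l r))) := fun x hx => by
    obtain ⟨e⟩ := nonempty_orderIso_Ici_of_isBot hx
    obtain ⟨f⟩ := nonempty_orderIso_Ici (leftEmb (u := u) (r := r)) mem_range_leftEmb x
    exact ⟨e.symm.trans f⟩
  have hr : ∀ x : RBTNode r, IsBot x →
      Nonempty (RBTNode r ≃o Set.Ici (right x : RBTNode (.node u l r))) := fun x hx => by
    obtain ⟨e⟩ := nonempty_orderIso_Ici_of_isBot hx
    obtain ⟨f⟩ := nonempty_orderIso_Ici (rightEmb (u := u) (l := l)) mem_range_rightEmb x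
    exact ⟨e.symm.trans f⟩
  constructor
  · rintro ⟨v, w, hne, hv, hw, ⟨e⟩⟩
    induction v using cases with
    | root => exact absurd hv.lt (lt_irrefl _)
    | left v =>
      obtain ⟨ev⟩ := hl v (root_covBy_left_iff.1 hv)
      induction w using cases with
      | root => exact absurd hw.lt (lt_irrefl _)
      | left w =>
        exact absurd (congrArg left (le_antisymm (root_covBy_left_iff.1 hv w)
          (root_covBy_left_iff.1 hw v))) hne
      | right w =>
        obtain ⟨ew⟩ := hr w (root_covBy_right_iff.1 hw)
        exact ⟨⟨v⟩, ⟨ev.trans (e.trans ew.symm)⟩⟩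
    | right v =>
      obtain ⟨ev⟩ := hr v (root_covBy_right_iff.1 hv)
      induction w using cases with
      | root => exact absurd hw.lt (lt_irrefl _)
      | left w =>
        obtain ⟨ew⟩ := hl w (root_covBy_left_iff.1 hw)
        exact ⟨⟨w⟩, ⟨ew.trans (e.symm.trans ev.symm)⟩⟩
      | right w =>
        exact absurd (congrArg right (le_antisymm (root_covBy_right_iff.1 hv w)
          (root_covBy_right_iff.1 hw v))) hne
  · rintro ⟨⟨x⟩, ⟨e⟩⟩
    obtain ⟨b, hb⟩ := exists_isBot l x
    obtain ⟨c, hc⟩ := exists_isBot r (e x)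
    obtain ⟨f⟩ := hl b hb
    obtain ⟨g⟩ := hr c hc
    exact ⟨left b, right c, fun h => not_left_le_right h.le, root_covBy_left_iff.2 hb,
      root_covBy_right_iff.2 hc, ⟨f.symm.trans (e.trans g)⟩⟩

/-- Every node is a leaf, or symmetric, or has subtrees with different posets of nodes. -/
theorem twists_add_numMaximal_add_numSymmetric : ∀ T : BinaryTree Unit,
    twists T + numMaximal (RBTNode T) + numSymmetric (RBTNode T) = T.numNodes
  | .nil => by simp [twists, numMaximal, numSymmetric]
  | .node u l r => by
    classical
    have hm : numMaximal (RBTNode (.node u l r)) =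
        (if IsMax (root : RBTNode (.node u l r)) then 1 else 0) +
          (numMaximal (RBTNode l) + numMaximal (RBTNode r)) := by
      rw [numMaximal, card_subtype_node]
      congr 2
      · exact Nat.card_congr (Equiv.subtypeEquivRight fun x =>
          isMax_apply_iff leftEmb mem_range_leftEmb)
      · exact Nat.card_congr (Equiv.subtypeEquivRight fun x =>
          isMax_apply_iff rightEmb mem_range_rightEmb)
    have hs : numSymmetric (RBTNode (.node u l r)) =
        (if IsSymmetricElt (root : RBTNode (.node u l r)) then 1 else 0) +
          (numSymmetric (RBTNode l) + numSymmetric (RBTNode r)) := by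
      rw [numSymmetric, card_subtype_node]
      congr 2
      · exact Nat.card_congr (Equiv.subtypeEquivRight fun x =>
          isSymmetricElt_apply_iff leftEmb mem_range_leftEmb)
      · exact Nat.card_congr (Equiv.subtypeEquivRight fun x =>
          isSymmetricElt_apply_iff rightEmb mem_range_rightEmb)
    have hl := twists_add_numMaximal_add_numSymmetric l
    have hr := twists_add_numMaximal_add_numSymmetric r
    -- the root is either a leaf, or symmetric, or has different subtrees
    have key : (if Nonempty (RBTNode l ≃o RBTNode r) then 0 else 1) +
        (if IsMax (root : RBTNode (.node u l r)) then 1 else 0) +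
        (if IsSymmetricElt (root : RBTNode (.node u l r)) then 1 else 0) = 1 := by
      rw [isMax_root_iff, isSymmetricElt_root_iff]
      by_cases hiso : Nonempty (RBTNode l ≃o RBTNode r)
      · obtain ⟨e⟩ := id hiso
        by_cases hne : Nonempty (RBTNode l)
        · rw [if_pos hiso, if_neg fun h => not_isEmpty_iff.2 hne h.1, if_pos ⟨hne, hiso⟩]
        · have hE := not_nonempty_iff.1 hne
          rw [if_pos hiso, if_pos ⟨hE, e.symm.toEquiv.isEmpty⟩, if_neg fun h => hne h.1]
      · rw [if_neg hiso, if_neg, if_neg fun h => hiso h.2]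
        rintro ⟨h1, h2⟩
        exact hiso ⟨⟨Equiv.equivOfIsEmpty _ _, fun {a} => isEmptyElim a⟩⟩
    rw [hm, hs, twists, BinaryTree.numNodes, ← hl, ← hr]
    omega

end RBTNode

/-- The number of binary trees whose poset of nodes is a given one. -/
theorem card_trees_orderIso {α : Type} [Fintype α] [PartialOrder α] (h : IsRBTPoset α) :
    Nat.card {T : BinaryTree Unit // Nonempty (RBTNode T ≃o α)} =
      2 ^ (Fintype.card α - numMaximal α - numSymmetric α) := by
  obtain ⟨T, ⟨e⟩⟩ := h
  have h1 := RBTNode.twists_add_numMaximal_add_numSymmetric T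
  have h2 : Fintype.card α = T.numNodes := by
    rw [← Fintype.card_fin T.numNodes]
    exact Fintype.card_congr (e.toEquiv.trans (RBTNode.inorder T))
  rw [← numMaximal_congr e, ← numSymmetric_congr e, ← h2] at h1
  rw [show Fintype.card α - numMaximal α - numSymmetric α = RBTNode.twists T by omega,
    ← RBTNode.ncard_sameShape, Set.ncard]
  exact Nat.card_congr (Equiv.subtypeEquivRight fun T' =>
    ⟨fun ⟨f⟩ => ⟨f.trans e⟩, fun ⟨f⟩ => ⟨f.trans e.symm⟩⟩)

/-! ### The images of the dual basis vectors of connected posets -/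

theorem IsoPoset.trans {I : Type} {q : PartialOrder I} {α β : Type} [PartialOrder α]
    [PartialOrder β] (h : IsoPoset q α) (f : α ≃o β) : IsoPoset q β := by
  obtain ⟨e, he⟩ := h
  exact ⟨e.trans f.toEquiv, fun a b => (he a b).trans f.le_iff_le.symm⟩

theorem IsoPoset.nonempty_orderIso {I : Type} {q : PartialOrder I} {α β : Type} [PartialOrder α]
    [PartialOrder β] (h : IsoPoset q α) (h' : IsoPoset q β) : Nonempty (α ≃o β) := by
  obtain ⟨e, he⟩ := h
  obtain ⟨f, hf⟩ := h'
  refine ⟨⟨e.symm.trans f, fun {a b} => ?_⟩⟩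
  rw [Equiv.trans_apply, Equiv.trans_apply, ← hf, he, e.apply_symm_apply, e.apply_symm_apply]

theorem nonempty_orderIso_of_vertexCount_ne_zero {n : ℕ} {lam : Composition n} {α : Type}
    [PartialOrder α] (h : vertexCount (orbitPolytope lam (Fin n)) α ≠ 0) :
    Nonempty (α ≃o LayeredPoset lam) := by
  obtain ⟨v, hv⟩ := exists_vertex_of_vertexCount_ne_zero h
  exact hv.nonempty_orderIso (isoPoset_vertexPoset_orbitPolytope lam v)

theorem vertexCount_orbitPolytope {n : ℕ} {lam : Composition n} {α : Type} [PartialOrder α]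
    (e : α ≃o LayeredPoset lam) :
    vertexCount (orbitPolytope lam (Fin n)) α * ∏ i, (lam.blocksFun i)! = n ! := by
  rw [← card_vertices_orbitPolytope lam, vertexCount]
  congr 1
  exact Nat.card_congr (Equiv.subtypeUnivEquiv fun v =>
    (isoPoset_vertexPoset_orbitPolytope lam v).trans e.symm)

theorem permutahedron_fin (n : ℕ) :
    permutahedron (Fin n) = orbitPolytope (Composition.ones n) (Fin n) := by
  rw [permutahedron_eq_orbitPolytope]
  exact orbitPolytope_eq_of_blocks_eq (by simp) _

theorem layeredPoset_ones_total {n : ℕ} (a b : LayeredPoset (Composition.ones n)) :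
    a ≤ b ∨ b ≤ a := by
  obtain ⟨i, x⟩ := a
  obtain ⟨j, y⟩ := b
  rcases lt_trichotomy i j with h | rfl | h
  · exact Or.inl (Or.inr h)
  · have hs : Subsingleton (Fin ((Composition.ones n).blocksFun i)) := by
      rw [Composition.ones_blocksFun]; infer_instance
    rw [Subsingleton.elim x y]
    exact Or.inl le_rfl
  · exact Or.inr (Or.inr h)

theorem nonempty_orderIso_fin {α : Type} [PartialOrder α] {n : ℕ} (e : α ≃ Fin n)
    (h : ∀ a b : α, a ≤ b ∨ b ≤ a) : Nonempty (Fin n ≃o α) := by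
  classical
  let _ : Fintype α := Fintype.ofEquiv _ e.symm
  let _ : LinearOrder α := { ‹PartialOrder α› with
    le_total := h
    toDecidableLE := Classical.decRel _ }
  exact ⟨Fintype.orderIsoFinOfCardEq α ((Fintype.card_congr e).trans (Fintype.card_fin n))⟩

theorem nonempty_orderIso_layeredPoset_ones_iff {α : Type} [Fintype α] [PartialOrder α] :
    Nonempty (α ≃o LayeredPoset (Composition.ones (Fintype.card α))) ↔
      ∀ a b : α, a ≤ b ∨ b ≤ a := by
  constructor
  · rintro ⟨e⟩ a b
    rw [← e.le_iff_le, ← e.le_iff_le]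
    exact layeredPoset_ones_total _ _
  · intro h
    obtain ⟨e⟩ := nonempty_orderIso_fin (Fintype.equivFin α) h
    obtain ⟨f⟩ := nonempty_orderIso_fin
      (α := LayeredPoset (Composition.ones (Fintype.card α)))
      (Composition.ones (Fintype.card α)).blocksFinEquiv layeredPoset_ones_total
    exact ⟨e.symm.trans f⟩

theorem exists_relabelSet_associahedron {I : Type} [Fintype I] (ℓ : LinearOrder I) {n : ℕ}
    (h : Fintype.card I = n) :
    ∃ e : Fin n ≃ I, associahedron I ℓ = relabelSet e (associahedron (Fin n) inferInstance) :=
  ⟨(Fintype.orderIsoFinOfCardEq I h).toEquiv, (relabelSet_associahedron _).symm⟩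

section

variable {K : Type*} [Field K] {α : Type} [PartialOrder α]

/-- The products of permutahedra which span `permSpecies`. -/
def IsPermProduct {n : ℕ} (Q : GenPerm (Fin n)) : Prop :=
  ∃ (k : ℕ) (c : Fin n → Fin k), Q.carrier = prodPolytope c fun j => permutahedron {i // c i = j}

/-- The products of associahedra which span `assocSpecies`. -/
def IsAssocProduct {n : ℕ} (Q : GenPerm (Fin n)) : Prop :=
  ∃ (k : ℕ) (c : Fin n → Fin k) (ℓ : ∀ j, LinearOrder {i // c i = j}),
    Q.carrier = prodPolytope c fun j => associahedron {i // c i = j} (ℓ j)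

/-- The products of orbit polytopes which span `orbitSpecies`. -/
def IsOrbitProduct {n : ℕ} (Q : GenPerm (Fin n)) : Prop :=
  ∃ (k : ℕ) (c : Fin n → Fin k) (lam : ∀ j, Composition (Fintype.card {i // c i = j})),
    Q.carrier = prodPolytope c fun j => orbitPolytope (lam j) {i // c i = j}

theorem permSpecies_le (n : ℕ) : permSpecies K (Fin n) ≤ Submodule.span K
    {b | ∃ Q, IsPermProduct Q ∧ b = Finsupp.single (Quotient.mk _ Q) 1} :=
  Submodule.span_mono fun _ ⟨Q, k, c, hQ, hb⟩ => ⟨Q, ⟨k, c, hQ⟩, hb⟩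

theorem assocSpecies_le (n : ℕ) : assocSpecies K (Fin n) ≤ Submodule.span K
    {b | ∃ Q, IsAssocProduct Q ∧ b = Finsupp.single (Quotient.mk _ Q) 1} :=
  Submodule.span_mono fun _ ⟨Q, k, c, ℓ, hQ, hb⟩ => ⟨Q, ⟨k, c, ℓ, hQ⟩, hb⟩

theorem orbitSpecies_le (n : ℕ) : orbitSpecies K (Fin n) ≤ Submodule.span K
    {b | ∃ Q, IsOrbitProduct Q ∧ b = Finsupp.single (Quotient.mk _ Q) 1} :=
  Submodule.span_mono fun _ ⟨Q, k, c, lam, hQ, hb⟩ => ⟨Q, ⟨k, c, lam, hQ⟩, hb⟩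

theorem IsPermProduct.carrier_eq {n : ℕ} {Q : GenPerm (Fin n)} (hQ : IsPermProduct Q)
    (hα : IsConnectedPoset α) (h : vertexCount Q.carrier α ≠ 0) :
    Q.carrier = permutahedron (Fin n) := by
  obtain ⟨k, c, hQ⟩ := hQ
  rw [hQ] at h ⊢
  obtain ⟨j, hj⟩ := exists_block_of_isConnectedPoset (fun j => by
    rw [permutahedron_eq_orbitPolytope]; exact orbitPolytope_const _ _) hα h
  rw [prodPolytope_eq_relabelSet (fun j => by
    rw [permutahedron_eq_orbitPolytope]
    exact orbitPolytope_nonempty _ (Fintype.equivFin _)) hj, relabelSet_permutahedron]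

theorem IsAssocProduct.exists_carrier_eq {n : ℕ} {Q : GenPerm (Fin n)} (hQ : IsAssocProduct Q)
    (hα : IsConnectedPoset α) (h : vertexCount Q.carrier α ≠ 0) :
    ∃ σ : Fin n ≃ Fin n, Q.carrier = relabelSet σ (assocGP n).carrier := by
  obtain ⟨k, c, ℓ, hQ⟩ := hQ
  rw [hQ] at h ⊢
  obtain ⟨j, hj⟩ := exists_block_of_isConnectedPoset (fun j => associahedron_const _ (ℓ j)) hα h
  have hcard : Fintype.card {i // c i = j} = n :=
    (Fintype.card_congr (Equiv.subtypeUnivEquiv hj)).trans (Fintype.card_fin n)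
  obtain ⟨e, he⟩ := exists_relabelSet_associahedron (ℓ j) hcard
  refine ⟨e.trans (Equiv.subtypeUnivEquiv hj), ?_⟩
  rw [prodPolytope_eq_relabelSet (fun j => by
    obtain ⟨V, -, hV, hP⟩ := associahedron_isPolytope _ (ℓ j)
    rw [hP]; exact hV.convexHull) hj, he]
  rfl

theorem IsOrbitProduct.exists_carrier_eq {n : ℕ} {Q : GenPerm (Fin n)} (hQ : IsOrbitProduct Q)
    (hα : IsConnectedPoset α) (h : vertexCount Q.carrier α ≠ 0) :
    ∃ mu : Composition n, Q.carrier = orbitPolytope mu (Fin n) := by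
  obtain ⟨k, c, lam, hQ⟩ := hQ
  rw [hQ] at h ⊢
  obtain ⟨j, hj⟩ := exists_block_of_isConnectedPoset (fun j => orbitPolytope_const _ _) hα h
  have hcard : Fintype.card {i // c i = j} = n :=
    (Fintype.card_congr (Equiv.subtypeUnivEquiv hj)).trans (Fintype.card_fin n)
  refine ⟨(lam j).cast hcard, ?_⟩
  rw [prodPolytope_eq_relabelSet
    (fun j => orbitPolytope_nonempty _ (Fintype.equivFin _)) hj, relabelSet_orbitPolytope]
  exact orbitPolytope_eq_of_blocks_eq (mu := lam j) (lam := (lam j).cast hcard) rfl _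

variable [Fintype α]

theorem dualBrion_permSpecies (hα : IsConnectedPoset α) (h : ∀ a b : α, a ≤ b ∨ b ≤ a) :
    (permSpecies K).dualBrion (posetDual K α) =
      ((Fintype.card α)! : K) • (permSpecies K).dualVec (permGP (Fintype.card α)) := by
  refine SubGP.dualBrion_eq_smul (permSpecies_le _) _ ?_ fun Q hQ hc =>
    mk_eq_mk_of_relabelSet (Equiv.refl _) (hQ.carrier_eq hα hc)
  obtain ⟨e⟩ := nonempty_orderIso_layeredPoset_ones_iff.2 h
  have := vertexCount_orbitPolytope e
  rw [← permutahedron_fin] at this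
  simp only [Composition.ones_blocksFun, Nat.factorial_one, Finset.prod_const_one, mul_one] at this
  rw [← this]
  rfl

theorem dualBrion_permSpecies_eq_zero (hα : IsConnectedPoset α)
    (h : ¬ ∀ a b : α, a ≤ b ∨ b ≤ a) : (permSpecies K).dualBrion (posetDual K α) = 0 := by
  refine SubGP.dualBrion_eq_zero (permSpecies_le _) fun Q hQ => ?_
  by_contra hc
  have := hQ.carrier_eq hα hc
  rw [this, permutahedron_fin] at hc
  exact h (nonempty_orderIso_layeredPoset_ones_iff.1 (nonempty_orderIso_of_vertexCount_ne_zero hc))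

theorem dualBrion_assocSpecies (hα : IsConnectedPoset α) (h : IsRBTPoset α) :
    (assocSpecies K).dualBrion (posetDual K α) =
      ((2 : K) ^ (Fintype.card α - numMaximal α - numSymmetric α)) •
        (assocSpecies K).dualVec (assocGP (Fintype.card α)) := by
  refine SubGP.dualBrion_eq_smul (assocSpecies_le _) _ ?_ fun Q hQ hc => ?_
  · rw [vertexCount_assocGP, card_trees_orderIso h, Nat.cast_pow, Nat.cast_ofNat]
  · obtain ⟨σ, hσ⟩ := hQ.exists_carrier_eq hα hc
    exact mk_eq_mk_of_relabelSet σ hσ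

theorem dualBrion_assocSpecies_eq_zero (hα : IsConnectedPoset α) (h : ¬ IsRBTPoset α) :
    (assocSpecies K).dualBrion (posetDual K α) = 0 := by
  have h0 : vertexCount (assocGP (Fintype.card α)).carrier α = 0 := by
    rw [vertexCount_assocGP, Nat.card_eq_zero]
    exact Or.inl ⟨fun ⟨T, ⟨e⟩⟩ => h ⟨T, ⟨e.symm⟩⟩⟩
  rw [← zero_smul K ((assocSpecies K).dualVec (assocGP (Fintype.card α)))]
  refine SubGP.dualBrion_eq_smul (assocSpecies_le _) _ (by rw [h0, Nat.cast_zero])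
    fun Q hQ hc => ?_
  obtain ⟨σ, hσ⟩ := hQ.exists_carrier_eq hα hc
  exact mk_eq_mk_of_relabelSet σ hσ

theorem dualBrion_orbitSpecies [CharZero K] (hα : IsConnectedPoset α)
    (lam : Composition (Fintype.card α)) (h : Nonempty (α ≃o LayeredPoset lam)) :
    (orbitSpecies K).dualBrion (posetDual K α) =
      (((Fintype.card α)! : K) / ∏ i, ((lam.blocksFun i)! : K)) •
        (orbitSpecies K).dualVec (orbitGP lam) := by
  obtain ⟨e⟩ := h
  refine SubGP.dualBrion_eq_smul (orbitSpecies_le _) _ ?_ fun Q hQ hc => ?_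
  · rw [eq_div_iff (Finset.prod_ne_zero_iff.2 fun i _ =>
      Nat.cast_ne_zero.2 (Nat.factorial_ne_zero _)), ← vertexCount_orbitPolytope e]
    push_cast
    rfl
  · obtain ⟨mu, hmu⟩ := hQ.exists_carrier_eq hα hc
    rw [hmu] at hc
    obtain ⟨f⟩ := nonempty_orderIso_of_vertexCount_ne_zero hc
    refine mk_eq_mk_of_relabelSet (Equiv.refl _) ?_
    rw [hmu, orbitPolytope_eq_of_blocks_eq (blocks_eq_of_orderIso (f.symm.trans e))]
    rfl

theorem dualBrion_orbitSpecies_eq_zero (hα : IsConnectedPoset α)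
    (h : ¬ ∃ lam : Composition (Fintype.card α), Nonempty (α ≃o LayeredPoset lam)) :
    (orbitSpecies K).dualBrion (posetDual K α) = 0 := by
  refine SubGP.dualBrion_eq_zero (orbitSpecies_le _) fun Q hQ => ?_
  by_contra hc
  obtain ⟨mu, hmu⟩ := hQ.exists_carrier_eq hα hc
  rw [hmu] at hc
  exact h ⟨mu, nonempty_orderIso_of_vertexCount_ne_zero hc⟩

end

end BrionMap

theorem mainTheorem8 (K : Type*) [Field K] [CharZero K] (α : Type) [Fintype α]
    [PartialOrder α] :
    (posetDual K α ∈ posetPrimitives K ↔ IsConnectedPoset α) ∧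
    (posetDual K α ∈ posetPrimitives K →
      -- (i) permutahedra
      (((∀ a b : α, a ≤ b ∨ b ≤ a) →
          (permSpecies K).dualBrion (posetDual K α) =
            ((Fintype.card α)! : K) • (permSpecies K).dualVec (permGP (Fintype.card α))) ∧
        (¬ (∀ a b : α, a ≤ b ∨ b ≤ a) →
          (permSpecies K).dualBrion (posetDual K α) = 0)) ∧
      -- (ii) associahedra
      ((IsRBTPoset α →
          (assocSpecies K).dualBrion (posetDual K α) =
            ((2 : K) ^ (Fintype.card α - numMaximal α - numSymmetric α)) •
              (assocSpecies K).dualVec (assocGP (Fintype.card α))) ∧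
        (¬ IsRBTPoset α → (assocSpecies K).dualBrion (posetDual K α) = 0)) ∧
      -- (iii) orbit polytopes
      ((∀ lam : Composition (Fintype.card α), Nonempty (α ≃o LayeredPoset lam) →
          (orbitSpecies K).dualBrion (posetDual K α) =
            (((Fintype.card α)! : K) / ∏ i, ((lam.blocksFun i)! : K)) •
              (orbitSpecies K).dualVec (orbitGP lam)) ∧
        ((¬ ∃ lam : Composition (Fintype.card α), Nonempty (α ≃o LayeredPoset lam)) →
          (orbitSpecies K).dualBrion (posetDual K α) = 0))) := by
  refine ⟨mem_posetPrimitives_iff K α, fun hp => ?_⟩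
  have hα := (mem_posetPrimitives_iff K α).1 hp
  exact ⟨⟨dualBrion_permSpecies hα, dualBrion_permSpecies_eq_zero hα⟩,
    ⟨dualBrion_assocSpecies hα, dualBrion_assocSpecies_eq_zero hα⟩,
    dualBrion_orbitSpecies hα, dualBrion_orbitSpecies_eq_zero hα⟩
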